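/- Consider a stable tandem queue: two single-server first-in-first-out stations in series with infinite buffers. Let $\tau_n\ge 0$ be the time between the arrivals of customers $n$ and $n+1$ ($n\in\mathbb Z$) at station 1 and let $\sigma^{(i)}_n\ge 0$ be the service time of customer $n$ in station $i=1,2$. The three sequences $\{\tau_n\}$, $\{\sigma^{(1)}_n\}$, $\{\sigma^{(2)}_n\}$ are mutually independent and each of them is i.i.d., with finite means $a=\mathbf E\tau_0$ and $b^{(i)}=\mathbf E\sigma^{(i)}_0$. Let $W^{(2)}$ be the stationary waiting time of customer $0$ in the second queue, that is, the (nondecreasing) limit, as $m\to\infty$, of the waiting time of customer $0$ in queue 2 when the network starts empty and customer $-m$ is the first one. Let $F$ be a distribution on $[0,\infty)$ with tail $\overline F=1-F$ and with finite first moment $\int_0^\infty\overline F(u)\,du$, and let $F^s$ be the distribution on $[0,\infty)$ with tail $\overline{F}^s(x)=\min\{1,\int_x^\infty\overline F(u)\,du\}$. Assume that $F$ and $F^s$ are both subexponential, where a distribution $G$ on $[0,\infty)$ is subexponential if $\overline G(x)=1-G(x)>0$ for all $x$ and $\mathbf P(\xi_1+\xi_2>x)/\overline G(x)\to 2$ as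 $x\to\infty$ for independent $\xi_1,\xi_2$ with distribution $G$. Assume that, for $i=1,2$, $\mathbf P(\sigma^{(i)}_0>x)/\overline F(x)\to d^{(i)}$ as $x\to\infty$, where $d^{(1)},d^{(2)}\ge 0$ and $d^{(1)}+d^{(2)}>0$. If $b^{(1)}<b^{(2)}<a$, then, as $x\to\infty$, $$\mathbf P(W^{(2)}>x)=\frac{d^{(2)}}{a-b^{(2)}}\,\overline{F}^s(x)+\frac{d^{(1)}}{a-b^{(2)}}\,\overline{F}^s\!\left(x\,\frac{a-b^{(1)}}{b^{(2)}-b^{(1)}}\right)+o\bigl(\overline{F}^s(x)\bigr).$$ In particular, if either (i) $d^{(2)}>0$, or (ii) $d^{(2)}=0$, $d^{(1)}>0$ and $\liminf_{x\to\infty}\overline{F}^s(2x)/\overline{F}^s(x)>0$, then $$\mathbf P(W^{(2)}>x)\sim\frac{d^{(2)}}{a-b^{(2)}}\,\overline{F}^s(x)+\frac{d^{(1)}}{a-b^{(2)}}\,\overline{F}^s\!\left(x\,\frac{a-b^{(1)}}{b^{(2)}-b^{(1)}}\right),$$ meaning that the ratio of the two sides tends to $1$ as $x\to\infty$. -/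

import Mathlib

open MeasureTheory ProbabilityTheory Filter Topology Set Asymptotics
open scoped ENNReal

namespace TandemQueue

/-! ### Distributions on the half line, their tails, and subexponentiality -/

/-- The tail `x ↦ μ (x, ∞)` of a probability law `μ` on the line. -/
noncomputable def tail (μ : Measure ℝ) (x : ℝ) : ℝ := μ.real (Ioi x)

/-- A law `μ` on `[0, ∞)` whose tail never vanishes is subexponential if, for independent
`ξ₁, ξ₂` with law `μ`, `P(ξ₁ + ξ₂ > x) / P(ξ₁ > x) → 2` as `x → ∞`. -/
structure IsSubexponential (μ : Measure ℝ) : Prop where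
  isProbabilityMeasure : IsProbabilityMeasure μ
  nonneg : μ (Iio 0) = 0
  tail_pos : ∀ x, 0 < tail μ x
  tendsto_two : Tendsto (fun x => (μ.prod μ).real {p : ℝ × ℝ | x < p.1 + p.2} / tail μ x)
    atTop (𝓝 2)

/-- The integrated tail `min {1, ∫_x^∞ F̄(u) du}` of the law `F`. -/
noncomputable def integratedTail (F : Measure ℝ) (x : ℝ) : ℝ :=
  min 1 (∫ u in Ioi x, tail F u)

section IntegratedTail

lemma tail_nonneg (F : Measure ℝ) (x : ℝ) : 0 ≤ tail F x := measureReal_nonneg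

lemma integratedTail_le_one (F : Measure ℝ) (x : ℝ) : integratedTail F x ≤ 1 := min_le_left _ _

variable (F : Measure ℝ) [IsProbabilityMeasure F]

lemma tail_le_one (x : ℝ) : tail F x ≤ 1 := measureReal_le_one

lemma tail_antitone : Antitone (tail F) := fun _ _ h => measureReal_mono (Ioi_subset_Ioi h)

lemma integrableOn_tail_Ioc (x y : ℝ) : IntegrableOn (tail F) (Ioc x y) := by
  refine Measure.integrableOn_of_bounded (M := 1) (by simp)
    (tail_antitone F).measurable.aestronglyMeasurable ?_
  filter_upwards with u
  rw [Real.norm_of_nonneg (tail_nonneg F u)]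
  exact tail_le_one F u

lemma integrableOn_tail_Ioi {x : ℝ} (h : IntegrableOn (tail F) (Ioi x)) (y : ℝ) :
    IntegrableOn (tail F) (Ioi y) := by
  rcases le_total x y with hxy | hxy
  · exact h.mono_set (Ioi_subset_Ioi hxy)
  · rw [← Ioc_union_Ioi_eq_Ioi hxy]
    exact (integrableOn_tail_Ioc F y x).union h

lemma integral_tail_bounds {x y : ℝ} (hxy : x ≤ y) :
    ∫ u in Ioi y, tail F u ≤ ∫ u in Ioi x, tail F u ∧
      ∫ u in Ioi x, tail F u ≤ (∫ u in Ioi y, tail F u) + (y - x) := by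
  by_cases h : IntegrableOn (tail F) (Ioi x)
  · have hy := integrableOn_tail_Ioi F h y
    have hI := integrableOn_tail_Ioc F x y
    have e : ∫ u in Ioi x, tail F u = (∫ u in Ioc x y, tail F u) + ∫ u in Ioi y, tail F u := by
      rw [← Ioc_union_Ioi_eq_Ioi hxy]
      exact setIntegral_union (Ioc_disjoint_Ioi le_rfl) measurableSet_Ioi hI hy
    have h0 : 0 ≤ ∫ u in Ioc x y, tail F u := integral_nonneg (tail_nonneg F)
    have h1 : ∫ u in Ioc x y, tail F u ≤ y - x := by
      calc ∫ u in Ioc x y, tail F u ≤ ∫ _ in Ioc x y, (1 : ℝ) :=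
            integral_mono hI (by simp) (tail_le_one F)
        _ = y - x := by simp [hxy]
    constructor <;> linarith
  · have hy : ¬ IntegrableOn (tail F) (Ioi y) := fun h' => h (integrableOn_tail_Ioi F h' x)
    rw [integral_undef h, integral_undef hy]
    constructor <;> linarith

lemma integratedTail_nonneg (x : ℝ) : 0 ≤ integratedTail F x :=
  le_min zero_le_one (integral_nonneg (tail_nonneg F))

lemma integratedTail_antitone : Antitone (integratedTail F) :=
  fun _ _ h => min_le_min le_rfl (integral_tail_bounds F h).1

lemma continuous_integratedTail : Continuous (integratedTail F) := by
  have : LipschitzWith 1 (fun x => ∫ u in Ioi x, tail F u) := by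
    refine LipschitzWith.of_le_add fun x y => ?_
    rcases le_total x y with h | h
    · have := (integral_tail_bounds F h).2
      rw [Real.dist_eq, abs_sub_comm, abs_of_nonneg (sub_nonneg.2 h)]
      exact this
    · exact (integral_tail_bounds F h).1.trans (le_add_of_nonneg_right dist_nonneg)
  exact continuous_const.min this.continuous

/-- The integrated tail distribution function `F^s` on the half line: it is `0` on `(-∞, 0)` and
`1 - min {1, ∫_x^∞ F̄(u) du}` at `x ≥ 0`. -/
noncomputable def integratedTailCDF : StieltjesFunction ℝ where
  toFun x := if x < 0 then 0 else 1 - integratedTail F x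
  mono' := by
    intro x y hxy
    have hy := integratedTail_le_one F y
    have h := integratedTail_antitone F hxy
    dsimp only
    split_ifs <;> linarith
  right_continuous' := by
    intro x
    by_cases hx : x < 0
    · have : (fun y : ℝ => if y < 0 then 0 else 1 - integratedTail F y) =ᶠ[𝓝 x] fun _ => 0 := by
        filter_upwards [Iio_mem_nhds hx] with y hy
        exact if_pos hy
      exact (continuousAt_const.congr this.symm).continuousWithinAt
    · have hc : Continuous fun y => 1 - integratedTail F y :=
        continuous_const.sub (continuous_integratedTail F)
      refine (hc.continuousWithinAt (s := Ici x) (x := x)).congr (fun y hy => ?_) ?_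
      · exact if_neg (not_lt.2 ((not_lt.1 hx).trans hy))
      · exact if_neg hx

/-- The law on `[0, ∞)` with distribution function `F^s`. -/
noncomputable def integratedTailLaw : Measure ℝ := (integratedTailCDF F).measure

/-- `F^s` has the tail `min {1, ∫_x^∞ F̄(u) du}` when `F` has a finite first moment. -/
lemma tail_integratedTailLaw (hF : IntegrableOn (tail F) (Ioi 0)) {x : ℝ} (hx : 0 ≤ x) :
    tail (integratedTailLaw F) x = integratedTail F x := by
  have h0 : Tendsto (fun x => ∫ u in Ioi x, tail F u) atTop (𝓝 0) := by
    have h1 := (intervalIntegral_tendsto_integral_Ioi 0 hF tendsto_id).const_sub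
      (∫ u in Ioi 0, tail F u)
    rw [sub_self] at h1
    refine h1.congr' ?_
    filter_upwards [eventually_ge_atTop 0] with y hy
    have := intervalIntegral.integral_Ioi_sub_Ioi (f := tail F) hF hy
    simp only [id]
    linarith
  have h1 : Tendsto (integratedTailCDF F) atTop (𝓝 1) := by
    have h2 : Tendsto (fun x => 1 - integratedTail F x) atTop (𝓝 1) := by
      have := ((tendsto_const_nhds (x := (1 : ℝ))).min h0).const_sub 1
      simpa [integratedTail] using this
    refine h2.congr' ?_
    filter_upwards [eventually_ge_atTop 0] with y hy
    exact (if_neg (not_lt.2 hy)).symm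
  have e : integratedTailCDF F x = 1 - integratedTail F x := if_neg (not_lt.2 hx)
  rw [tail, integratedTailLaw, Measure.real, StieltjesFunction.measure_Ioi _ h1, e,
    sub_sub_cancel, ENNReal.toReal_ofReal (integratedTail_nonneg F x)]

end IntegratedTail

/-! ### The tandem queue

Customers are indexed by `ℤ` and served in order of arrival by station 1 and then by station 2,
each of which has a single server and an infinite buffer. Customer `n` needs the service time
`σ₁ n` in station 1 and `σ₂ n` in station 2, and `τ n` is the time between the arrivals of the
customers `n` and `n + 1` at station 1. -/

/-- The time between the arrivals at station 2 of the customers `n` and `n + 1`, that is, between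
their departures from station 1, if customer `n` waits for the time `w` in queue 1. -/
def interarrival₂ (σ₁ τ : ℤ → ℝ) (n : ℤ) (w : ℝ) : ℝ :=
  σ₁ (n + 1) - min 0 (w + σ₁ n - τ n)

/-- The waiting times in queue 1 and in queue 2 of customer `s + k` in the network that starts
empty and in which customer `s` is the first one. -/
def waiting (σ₁ σ₂ τ : ℤ → ℝ) (s : ℤ) : ℕ → ℝ × ℝ
  | 0 => (0, 0)
  | k + 1 =>
    let w := waiting σ₁ σ₂ τ s k
    (max 0 (w.1 + σ₁ (s + k) - τ (s + k)),
      max 0 (w.2 + σ₂ (s + k) - interarrival₂ σ₁ τ (s + k) w.1))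

/-- The waiting time of customer `0` in queue 2, in the network that starts empty and in which
customer `-m` is the first one, is nondecreasing in `m`. -/
lemma waiting₂_mono {σ₁ σ₂ τ : ℤ → ℝ} :
    Monotone fun m : ℕ => (waiting σ₁ σ₂ τ (-m) m).2 := by
  have key : ∀ (s : ℤ) (k : ℕ),
      (waiting σ₁ σ₂ τ s k).1 ≤ (waiting σ₁ σ₂ τ (s - 1) (k + 1)).1 ∧
      (waiting σ₁ σ₂ τ s k).2 ≤ (waiting σ₁ σ₂ τ (s - 1) (k + 1)).2 := by
    intro s k
    induction k with
    | zero => exact ⟨le_max_left _ _, le_max_left _ _⟩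
    | succ k ih =>
      obtain ⟨h1, h2⟩ := ih
      have e : s - 1 + ((k + 1 : ℕ) : ℤ) = s + k := by push_cast; ring
      rw [waiting, waiting]
      simp only [e, interarrival₂]
      refine ⟨max_le_max le_rfl (by linarith), max_le_max le_rfl ?_⟩
      have := min_le_min (le_refl (0 : ℝ)) (show (waiting σ₁ σ₂ τ s k).1 + σ₁ (s + k) - τ (s + k)
        ≤ (waiting σ₁ σ₂ τ (s - 1) (k + 1)).1 + σ₁ (s + k) - τ (s + k) by linarith)
      linarith
  refine monotone_nat_of_le_succ fun m => ?_
  have := (key (-m) m).2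
  have e : (-m - 1 : ℤ) = -((m + 1 : ℕ) : ℤ) := by push_cast; ring
  rwa [e] at this

/-- The stationary waiting time `W^{(2)}` of customer `0` in queue 2, as an element of `[0, ∞]`:
the nondecreasing limit, as `m → ∞`, of the waiting time of this customer in queue 2 when the
network starts empty and customer `-m` is the first one. -/
noncomputable def stationaryWaiting₂ (σ₁ σ₂ τ : ℤ → ℝ) : ℝ≥0∞ :=
  ⨆ m : ℕ, ENNReal.ofReal (waiting σ₁ σ₂ τ (-m) m).2

end TandemQueue

/-! A long wait of customer `0` in queue 2 is caused by a single huge service time. Number the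
customers backwards from `0`, and let `U`, `V`, `T` be the partial sums of the service times in
stations 1 and 2 and of the interarrival times. A service of length `y` at station 2, about `n`
customers back, is drained at rate `a - b₂` per customer and leaves a wait above `x` if `y > x + n
(a - b₂)`; summing `d₂ * tail F` over `n` gives `d₂ / (a - b₂)` times the integrated tail. A huge
service at station 1 first builds a queue there, which then feeds station 2 at the rate of station
1, so the backlog in queue 2 grows by only `b₂ - b₁` per customer. Hence `n` must also exceed `x /
(b₂ - b₁)`, and the sum over `n` starts at the level `x + x (a - b₂) / (b₂ - b₁) = x (a - b₁) / (b₂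
- b₁)`.

Upper bound. A wait above `x` puts the path in `delayEvent`. For `s` slightly below `a`, this forces
`x < M + R`, where `M` is the maximum of the random walk `V_n - n s` and `R` is the maximal `excess`
of station 1 fed at constant spacing `s`. `M` and `R` are independent with tails of the order of the
integrated tail, so subexponentiality leaves only "`M` large" and "`R` large". The first gives the
`d₂` term. In the second, `V` is independent of `R` and typically at most linear with slope close to
`b₂`, which reduces the event to `fluidEvent`; there the law of large numbers for `U` and `T` forces
an excess of about `x (a - b₁) / (b₂ - b₁)` (`eventually_fluidEvent_le`).

Both maxima are controlled by `eventually_maxExcess_le`. The excess is subadditive under restarting,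
so decomposing at the first crossing of a line `K - k c` gives a renewal inequality whose kernel has
small mass for large `K`; the tail of the kernel is governed by one service time. `renewal_bound`
then turns this into a bound uniform in the length of the path.

Lower bound. Each big jump of the two kinds, combined with partial sums close to their means
elsewhere, puts the path in `lowerEvent` (`mem_lowerEvent`). The jumps are pairwise independent and
each is independent of the typical behaviour of the rest, so the Bonferroni inequality
`le_measureReal_biUnion` bounds the probability of their union below by nearly the sum of their
probabilities.

No regular variation is assumed: `integral_tail_mul_le` compares the integrated tail at nearby
multiples of `x`, with an error that is a small multiple of its value at `x`. -/

namespace TandemQueue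

/-! ### Subexponential laws -/

section Subexponential

variable {μ : Measure ℝ}

lemma tail_anti (μ : Measure ℝ) [IsFiniteMeasure μ] : Antitone (tail μ) :=
  fun _ _ h => measureReal_mono (Ioi_subset_Ioi h)

lemma tail_le_univ (μ : Measure ℝ) [IsFiniteMeasure μ] (x : ℝ) : tail μ x ≤ μ.real univ :=
  measureReal_mono (subset_univ _)

lemma tendsto_tail_atTop (μ : Measure ℝ) [IsFiniteMeasure μ] : Tendsto (tail μ) atTop (𝓝 0) := by
  have h : Tendsto (μ ∘ fun x : ℝ => Ioi x) atTop (𝓝 (μ (⋂ x : ℝ, Ioi x))) :=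
    tendsto_measure_iInter_atTop (fun x => measurableSet_Ioi.nullMeasurableSet)
      (fun _ _ h => Ioi_subset_Ioi h) ⟨0, measure_ne_top _ _⟩
  have e : (⋂ x : ℝ, Ioi x) = ∅ := by
    ext y
    simp only [mem_iInter, mem_Ioi, mem_empty_iff_false, iff_false, not_forall, not_lt]
    exact ⟨y, le_rfl⟩
  rw [e, measure_empty] at h
  have := (ENNReal.tendsto_toReal ENNReal.zero_ne_top).comp h
  exact this

lemma measurableSet_lt_add (x : ℝ) : MeasurableSet {p : ℝ × ℝ | x < p.1 + p.2} :=
  measurableSet_lt measurable_const (measurable_fst.add measurable_snd)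

lemma IsSubexponential.real_Ici (h : IsSubexponential μ) : μ.real (Ici 0) = 1 := by
  have := h.isProbabilityMeasure
  have h1 : μ.real (Iio 0)ᶜ = 1 - μ.real (Iio 0) := probReal_compl_eq_one_sub measurableSet_Iio
  rw [compl_Iio] at h1
  rw [h1, Measure.real, h.nonneg]
  simp

lemma IsSubexponential.real_Icc (h : IsSubexponential μ) {A : ℝ} (hA : 0 ≤ A) :
    μ.real (Icc 0 A) = 1 - tail μ A := by
  have := h.isProbabilityMeasure
  have h1 : μ.real (Icc 0 A ∪ Ioi A) = μ.real (Icc 0 A) + μ.real (Ioi A) :=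
    measureReal_union (by
      rw [Set.disjoint_left]
      intro y hy hy'
      exact absurd hy.2 (not_le.2 hy')) measurableSet_Ioi
  rw [Icc_union_Ioi_eq_Ici hA, h.real_Ici] at h1
  rw [tail]
  linarith

lemma real_Ioc_eq (μ : Measure ℝ) [IsFiniteMeasure μ] {A B : ℝ} (hAB : A ≤ B) :
    μ.real (Ioc A B) = tail μ A - tail μ B := by
  have h1 : μ.real (Ioc A B ∪ Ioi B) = μ.real (Ioc A B) + μ.real (Ioi B) :=
    measureReal_union (Ioc_disjoint_Ioi le_rfl) measurableSet_Ioi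
  rw [Ioc_union_Ioi_eq_Ioi hAB] at h1
  rw [tail, tail]
  linarith

/-- The tail of a subexponential law is long. -/
theorem IsSubexponential.eventually_tail_sub_le (h : IsSubexponential μ) (A : ℝ) {L : ℝ}
    (hL : 1 < L) : ∀ᶠ x in atTop, tail μ (x - A) ≤ L * tail μ x := by
  have := h.isProbabilityMeasure
  wlog hA : 0 ≤ A generalizing A
  · filter_upwards with x
    have h1 := tail_anti μ (show x ≤ x - A by linarith)
    have h2 := h.tail_pos x
    nlinarith
  have hr := h.tendsto_two
  have hpos := h.tail_pos A
  have t0 := tendsto_tail_atTop μ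
  have l1 : Tendsto (fun x => (μ.prod μ).real {p : ℝ × ℝ | x < p.1 + p.2} / tail μ x
      - 1 - (1 - tail μ A)) atTop (𝓝 (tail μ A)) := by
    have := (hr.sub_const 1).sub_const (1 - tail μ A)
    convert this using 2
    ring
  have l2 : Tendsto (fun x => L * (tail μ A - tail μ x)) atTop (𝓝 (L * tail μ A)) := by
    have := (t0.const_sub (tail μ A)).const_mul L
    simpa using this
  have hlt : tail μ A < L * tail μ A := by nlinarith
  filter_upwards [l1.eventually_lt l2 hlt, eventually_gt_atTop A,
    t0.eventually_lt_const hpos] with x hx hxA htx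
  have htx0 := h.tail_pos x
  -- Three disjoint rectangles inside `x < y + z`: `y > x`; `y ≤ A` with `z > x`; and `A < y ≤ x`
  -- with `z > x - A`. The whole event has mass about `2 * tail μ x`, so the last rectangle has at
  -- most about `tail μ A * tail μ x`, which caps `tail μ (x - A)`.
  have key : tail μ x + (1 - tail μ A) * tail μ x + (tail μ A - tail μ x) * tail μ (x - A)
      ≤ (μ.prod μ).real {p : ℝ × ℝ | x < p.1 + p.2} := by
    have e1 : (μ.prod μ).real (Ioi x ×ˢ Ici 0) = tail μ x := by
      rw [measureReal_prod_prod, h.real_Ici, mul_one, tail]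
    have e2 : (μ.prod μ).real (Icc 0 A ×ˢ Ioi x) = (1 - tail μ A) * tail μ x := by
      rw [measureReal_prod_prod, h.real_Icc hA, tail, tail]
    have e3 : (μ.prod μ).real (Ioc A x ×ˢ Ioi (x - A)) =
        (tail μ A - tail μ x) * tail μ (x - A) := by
      rw [measureReal_prod_prod, real_Ioc_eq μ hxA.le, tail, tail, tail]
    nth_rw 1 [← e1]
    rw [← e2, ← e3, ← measureReal_union, ← measureReal_union]
    · refine measureReal_mono ?_
      rintro ⟨y, z⟩ hp
      simp only [mem_union, mem_prod, mem_Ioi, mem_Ici, mem_Icc, mem_Ioc, mem_ofPred_eq] at hp ⊢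
      rcases hp with (hp | hp) | hp
      · linarith [hp.1, hp.2]
      · linarith [hp.1.1, hp.2]
      · linarith [hp.1.1, hp.2]
    · rw [Set.disjoint_left]
      rintro ⟨y, z⟩ hp hp'
      simp only [mem_union, mem_prod, mem_Ioi, mem_Ici, mem_Icc, mem_Ioc] at hp hp'
      rcases hp with hp | hp
      · linarith [hp'.1.2, hp.1]
      · linarith [hp.1.2, hp'.1.1]
    · exact measurableSet_Ioc.prod measurableSet_Ioi
    · rw [Set.disjoint_left]
      rintro ⟨y, z⟩ hp hp'
      simp only [mem_prod, mem_Ioi, mem_Ici, mem_Icc] at hp hp'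
      linarith [hp'.1.2, hp.1]
    · exact measurableSet_Icc.prod measurableSet_Ioi
  have h2 : (tail μ A - tail μ x) * tail μ (x - A) ≤
      ((μ.prod μ).real {p : ℝ × ℝ | x < p.1 + p.2} / tail μ x - 1 - (1 - tail μ A)) *
        tail μ x := by
    have : (μ.prod μ).real {p : ℝ × ℝ | x < p.1 + p.2} / tail μ x * tail μ x =
      (μ.prod μ).real {p : ℝ × ℝ | x < p.1 + p.2} := div_mul_cancel₀ _ htx0.ne'
    nlinarith
  have h3 : (tail μ A - tail μ x) * tail μ (x - A) ≤
      (tail μ A - tail μ x) * (L * tail μ x) := by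
    calc _ ≤ _ := h2
      _ ≤ L * (tail μ A - tail μ x) * tail μ x := mul_le_mul_of_nonneg_right hx.le htx0.le
      _ = _ := by ring
  exact le_of_mul_le_mul_left h3 (by linarith)

/-- Two independent summands with a subexponential law are unlikely to be both far from `0` when
their sum is large. -/
theorem IsSubexponential.eventually_prod_le (h : IsSubexponential μ) {A δ : ℝ} (hA : 0 ≤ A)
    (hδ : 0 < δ) : ∀ᶠ x in atTop, (μ.prod μ).real
      {p : ℝ × ℝ | p.2 ∈ Ioc A (x - A) ∧ x < p.1 + p.2} ≤ (2 * tail μ A + δ) * tail μ x := by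
  have := h.isProbabilityMeasure
  filter_upwards [h.tendsto_two.eventually_lt_const (show (2 : ℝ) < 2 + δ by linarith),
    eventually_gt_atTop A] with x hx hxA
  have htx0 := h.tail_pos x
  rw [div_lt_iff₀ htx0] at hx
  have e1 : (μ.prod μ).real (Ioi x ×ˢ Icc 0 A) = (1 - tail μ A) * tail μ x := by
    rw [measureReal_prod_prod, h.real_Icc hA, tail, tail, mul_comm]
  have e2 : (μ.prod μ).real (Icc 0 A ×ˢ Ioi x) = (1 - tail μ A) * tail μ x := by
    rw [measureReal_prod_prod, h.real_Icc hA, tail, tail]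
  have ms : MeasurableSet {p : ℝ × ℝ | p.2 ∈ Ioc A (x - A) ∧ x < p.1 + p.2} :=
    (measurable_snd measurableSet_Ioc).inter (measurableSet_lt_add x)
  -- The two rectangles with one coordinate in `[0, A]` and the other beyond `x` already take all
  -- but `2 * tail μ A * tail μ x` of the asymptotic mass `2 * tail μ x`.
  have key : (1 - tail μ A) * tail μ x + (1 - tail μ A) * tail μ x +
      (μ.prod μ).real {p : ℝ × ℝ | p.2 ∈ Ioc A (x - A) ∧ x < p.1 + p.2} ≤
      (μ.prod μ).real {p : ℝ × ℝ | x < p.1 + p.2} := by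
    nth_rw 1 [← e1]
    rw [← e2, ← measureReal_union, ← measureReal_union]
    · refine measureReal_mono ?_
      rintro ⟨y, z⟩ hp
      simp only [mem_union, mem_prod, mem_Ioi, mem_Icc, mem_Ioc, mem_ofPred_eq] at hp ⊢
      rcases hp with (hp | hp) | hp
      · linarith [hp.1, hp.2.1]
      · linarith [hp.2, hp.1.1]
      · exact hp.2
    · rw [Set.disjoint_left]
      rintro ⟨y, z⟩ hp hp'
      simp only [mem_union, mem_prod, mem_Ioi, mem_Icc, mem_Ioc, mem_ofPred_eq] at hp hp'
      rcases hp with hp | hp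
      · linarith [hp'.1.1, hp.2.2]
      · linarith [hp.1.2, hp'.1.2, hp'.2]
    · exact ms
    · rw [Set.disjoint_left]
      rintro ⟨y, z⟩ hp hp'
      simp only [mem_prod, mem_Ioi, mem_Icc] at hp hp'
      linarith [hp'.1.2, hp.1]
    · exact measurableSet_Icc.prod measurableSet_Ioi
  linarith

/-- For a fixed first coordinate `y` the section is a half line starting at `x - y`, so only the
tail of the second law matters. A summand may thus be replaced by a dominating one as long as the
side condition `B` concerns the other summand. -/
lemma prod_le_of_tail_le {H ν ρ : Measure ℝ} [SFinite H] [SFinite ν] [SFinite ρ] {c : ℝ≥0∞}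
    (hc : ∀ x, ν (Ioi x) ≤ c * ρ (Ioi x)) {B : Set ℝ} (hB : MeasurableSet B) (x : ℝ) :
    (H.prod ν) {p : ℝ × ℝ | p.1 ∈ B ∧ x < p.1 + p.2} ≤
      c * (H.prod ρ) {p : ℝ × ℝ | p.1 ∈ B ∧ x < p.1 + p.2} := by
  have ms : MeasurableSet {p : ℝ × ℝ | p.1 ∈ B ∧ x < p.1 + p.2} :=
    (measurable_fst hB).inter (measurableSet_lt_add x)
  rw [Measure.prod_apply ms, Measure.prod_apply ms,
    ← lintegral_const_mul _ (measurable_measure_prodMk_left ms)]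
  refine lintegral_mono fun y => ?_
  by_cases hy : y ∈ B
  · have e : Prod.mk y ⁻¹' {p : ℝ × ℝ | p.1 ∈ B ∧ x < p.1 + p.2} = Ioi (x - y) := by
      ext z
      simp only [mem_preimage, mem_ofPred_eq, hy, true_and, mem_Ioi, sub_lt_iff_lt_add']
    rw [e]
    exact hc _
  · have e : Prod.mk y ⁻¹' {p : ℝ × ℝ | p.1 ∈ B ∧ x < p.1 + p.2} = ∅ := by
      ext z
      simp [hy]
    simp [e]

lemma prod_swap_apply {ν ρ : Measure ℝ} [SFinite ν] [SFinite ρ] {B : Set ℝ}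
    (hB : MeasurableSet B) (x : ℝ) :
    (ν.prod ρ) {p : ℝ × ℝ | p.2 ∈ B ∧ x < p.1 + p.2} =
      (ρ.prod ν) {p : ℝ × ℝ | p.1 ∈ B ∧ x < p.1 + p.2} := by
  have ms : MeasurableSet {p : ℝ × ℝ | p.2 ∈ B ∧ x < p.1 + p.2} :=
    (measurable_snd hB).inter (measurableSet_lt_add x)
  rw [← Measure.prod_swap, Measure.map_apply measurable_swap ms]
  congr 1
  ext ⟨y, z⟩
  simp [add_comm]

lemma le_mul_of_tail_le {ν ρ : Measure ℝ} [IsFiniteMeasure ν] [IsFiniteMeasure ρ] {C : ℝ}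
    (hC : 0 ≤ C) {x : ℝ} (h : tail ν x ≤ C * tail ρ x) :
    ν (Ioi x) ≤ ENNReal.ofReal C * ρ (Ioi x) := by
  rw [tail, tail] at h
  rw [← ofReal_measureReal (μ := ν), ← ofReal_measureReal (μ := ρ), ← ENNReal.ofReal_mul hC]
  exact ENNReal.ofReal_le_ofReal h

/-- If the tails of `H` and of `ρ` are dominated by a subexponential tail, then independent summands
with these laws are unlikely to be both far below a high level that their sum exceeds. -/
theorem IsSubexponential.exists_prod_both_le (h : IsSubexponential μ) {C δ : ℝ} (hC : 0 ≤ C)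
    (hδ : 0 < δ) : ∃ A, 0 ≤ A ∧ ∀ᶠ x in atTop, ∀ (H ρ : Measure ℝ) [IsFiniteMeasure H]
      [IsFiniteMeasure ρ], (∀ x, tail H x ≤ C * tail μ x) → ∀ α, 0 ≤ α →
      (∀ x, tail ρ x ≤ α * tail μ x) →
      (H.prod ρ).real {p : ℝ × ℝ | p.1 ≤ x - A ∧ p.2 ≤ x - A ∧ x < p.1 + p.2} ≤
        α * δ * tail μ x := by
  have := h.isProbabilityMeasure
  -- The factor `5 = 2 + 3`: `2` from `tail μ (x - A) ≤ 2 * tail μ x`, and `3` from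
  -- `eventually_prod_le` with `δ` equal to `tail μ A`.
  obtain ⟨A, hA0, hA⟩ : ∃ A, 0 ≤ A ∧ C * (5 * tail μ A) < δ := by
    have : Tendsto (fun A => C * (5 * tail μ A)) atTop (𝓝 0) := by
      simpa using ((tendsto_tail_atTop μ).const_mul 5).const_mul C
    obtain ⟨A, h1, h2⟩ := ((eventually_ge_atTop 0).and (this.eventually_lt_const hδ)).exists
    exact ⟨A, h1, h2⟩
  have hAp := h.tail_pos A
  refine ⟨A, hA0, ?_⟩
  filter_upwards [h.eventually_prod_le hA0 (h.tail_pos A),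
    h.eventually_tail_sub_le A one_lt_two] with x h1 h2
  intro H ρ _ _ hH α hα hρ
  have hB : MeasurableSet (Ioc A (x - A)) := measurableSet_Ioc
  have htx := h.tail_pos x
  have hrest : (H.prod ρ).real {p : ℝ × ℝ | p.1 ∈ Ioc A (x - A) ∧ x < p.1 + p.2} ≤
      α * (H.prod μ).real {p : ℝ × ℝ | p.1 ∈ Ioc A (x - A) ∧ x < p.1 + p.2} := by
    have := ENNReal.toReal_mono (by finiteness)
      (prod_le_of_tail_le (H := H) (fun x => le_mul_of_tail_le hα (hρ x)) hB x)
    rwa [ENNReal.toReal_mul, ENNReal.toReal_ofReal hα] at this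
  have hswap : (H.prod μ).real {p : ℝ × ℝ | p.2 ∈ Ioc A (x - A) ∧ x < p.1 + p.2} ≤
      C * (μ.prod μ).real {p : ℝ × ℝ | p.2 ∈ Ioc A (x - A) ∧ x < p.1 + p.2} := by
    have := ENNReal.toReal_mono (by finiteness)
      (prod_le_of_tail_le (H := μ) (fun x => le_mul_of_tail_le hC (hH x)) hB x)
    rw [ENNReal.toReal_mul, ENNReal.toReal_ofReal hC] at this
    simpa only [Measure.real, prod_swap_apply hB] using this
  -- The window must move from the first coordinate to the second before `H` can be replaced by `μ`.
  -- Off the corner where both coordinates are large, `y ≤ x - A` and `y + z > x` place `z` in the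
  -- same window.
  have hmid : (H.prod μ).real {p : ℝ × ℝ | p.1 ∈ Ioc A (x - A) ∧ x < p.1 + p.2} ≤
      tail H A * tail μ (x - A) +
        (H.prod μ).real {p : ℝ × ℝ | p.2 ∈ Ioc A (x - A) ∧ x < p.1 + p.2} := by
    have e : (H.prod μ).real (Ioi A ×ˢ Ioi (x - A)) = tail H A * tail μ (x - A) := by
      rw [measureReal_prod_prod, tail, tail]
    rw [← e]
    refine (measureReal_mono ?_).trans (measureReal_union_le _ _)
    rintro ⟨y, z⟩ hp
    simp only [mem_union, mem_prod, mem_Ioi, mem_Ioc, mem_ofPred_eq] at hp ⊢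
    rcases lt_or_ge (x - A) z with hz | hz
    · exact Or.inl ⟨hp.1.1, hz⟩
    · exact Or.inr ⟨⟨by linarith [hp.1.2, hp.2], hz⟩, hp.2⟩
  have hsub : (H.prod ρ).real {p : ℝ × ℝ | p.1 ≤ x - A ∧ p.2 ≤ x - A ∧ x < p.1 + p.2} ≤
      (H.prod ρ).real {p : ℝ × ℝ | p.1 ∈ Ioc A (x - A) ∧ x < p.1 + p.2} := by
    refine measureReal_mono ?_
    rintro ⟨y, z⟩ ⟨hy, hz, hp⟩
    simp only at hy hz hp
    exact ⟨⟨by simp only; linarith, hy⟩, hp⟩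
  have hHA := hH A
  have hfin : (H.prod μ).real {p : ℝ × ℝ | p.1 ∈ Ioc A (x - A) ∧ x < p.1 + p.2} ≤
      δ * tail μ x := by
    calc _ ≤ _ := hmid
      _ ≤ (C * tail μ A) * (2 * tail μ x) + C * ((2 * tail μ A + tail μ A) * tail μ x) :=
        add_le_add (mul_le_mul hHA h2 measureReal_nonneg (by positivity))
          (hswap.trans (mul_le_mul_of_nonneg_left h1 hC))
      _ = C * (5 * tail μ A) * tail μ x := by ring
      _ ≤ _ := mul_le_mul_of_nonneg_right hA.le htx.le
  calc _ ≤ _ := hsub.trans hrest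
    _ ≤ _ := by
      rw [mul_assoc]
      exact mul_le_mul_of_nonneg_left hfin hα

/-- If the tails of `H` and of `ρ` are dominated by a subexponential tail, then the sum of
independent summands with these laws is large mostly because one of them is. -/
theorem IsSubexponential.exists_prod_le (h : IsSubexponential μ) {C δ : ℝ} (hC : 0 ≤ C)
    (hδ : 0 < δ) : ∃ A, 0 ≤ A ∧ ∀ᶠ x in atTop, ∀ (H ρ : Measure ℝ) [IsFiniteMeasure H]
      [IsFiniteMeasure ρ], (∀ x, tail H x ≤ C * tail μ x) → ∀ α, 0 ≤ α →
      (∀ x, tail ρ x ≤ α * tail μ x) →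
      (H.prod ρ).real {p : ℝ × ℝ | x < p.1 + p.2} ≤
        H.real univ * tail ρ (x - A) + ρ.real univ * tail H (x - A) + α * δ * tail μ x := by
  obtain ⟨A, hA0, hA⟩ := h.exists_prod_both_le hC hδ
  refine ⟨A, hA0, ?_⟩
  filter_upwards [hA] with x hx
  intro H ρ _ _ hH α hα hρ
  have hsplit : (H.prod ρ).real {p : ℝ × ℝ | x < p.1 + p.2} ≤
      H.real univ * tail ρ (x - A) + ρ.real univ * tail H (x - A) +
        (H.prod ρ).real {p : ℝ × ℝ | p.1 ≤ x - A ∧ p.2 ≤ x - A ∧ x < p.1 + p.2} := by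
    have e1 : (H.prod ρ).real (univ ×ˢ Ioi (x - A)) = H.real univ * tail ρ (x - A) := by
      rw [measureReal_prod_prod, tail]
    have e2 : (H.prod ρ).real (Ioi (x - A) ×ˢ univ) = ρ.real univ * tail H (x - A) := by
      rw [measureReal_prod_prod, tail, mul_comm]
    rw [← e1, ← e2]
    refine (measureReal_mono ?_).trans ((measureReal_union_le _ _).trans
      (add_le_add_left (measureReal_union_le _ _) _))
    rintro ⟨y, z⟩ hp
    simp only [mem_union, mem_prod, mem_Ioi, mem_univ, true_and, and_true,
      mem_ofPred_eq] at hp ⊢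
    rcases lt_or_ge (x - A) z with hz | hz
    · exact Or.inl (Or.inl hz)
    rcases lt_or_ge (x - A) y with hy | hy
    · exact Or.inl (Or.inr hy)
    exact Or.inr ⟨hy, hz, hp⟩
  exact hsplit.trans (add_le_add le_rfl (hx H ρ hH α hα hρ))

/-- A subexponential tail is heavier than any exponential. -/
theorem IsSubexponential.eventually_exp_le (h : IsSubexponential μ) {s δ : ℝ} (hs : 0 < s)
    (hδ : 0 < δ) : ∀ᶠ x in atTop, Real.exp (-(s * x)) ≤ δ * tail μ x := by
  have := h.isProbabilityMeasure
  -- Losing at most a factor `exp (s / 2)` per unit step, the tail decays no faster than `exp (-(s /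
  -- 2) x)`; the other half of the exponent is left to beat the constant `δ`.
  have hL : 1 < Real.exp (s / 2) := Real.one_lt_exp_iff.2 (by linarith)
  obtain ⟨x₀, hx₀⟩ := eventually_atTop.1 (h.eventually_tail_sub_le 1 hL)
  have hstep : ∀ k : ℕ, tail μ x₀ ≤ Real.exp (s / 2) ^ k * tail μ (x₀ + k) := by
    intro k
    induction k with
    | zero => simp
    | succ k ih =>
      have h1 := hx₀ (x₀ + (k + 1 : ℕ)) (by push_cast; linarith [k.cast_nonneg (α := ℝ)])
      have e : x₀ + (k + 1 : ℕ) - 1 = x₀ + k := by push_cast; ring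
      rw [e] at h1
      calc _ ≤ _ := ih
        _ ≤ Real.exp (s / 2) ^ k * (Real.exp (s / 2) * tail μ (x₀ + (k + 1 : ℕ))) := by gcongr
        _ = _ := by ring
  have hp := h.tail_pos x₀
  have hlim : Tendsto (fun x : ℝ => Real.exp (-(s / 2 * x)) * Real.exp (s / 2 * (1 - x₀)))
      atTop (𝓝 0) := by
    have : Tendsto (fun x : ℝ => Real.exp (-(s / 2 * x))) atTop (𝓝 0) :=
      Real.tendsto_exp_neg_atTop_nhds_zero.comp (tendsto_id.const_mul_atTop (half_pos hs))
    simpa using this.mul_const (Real.exp (s / 2 * (1 - x₀)))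
  filter_upwards [eventually_ge_atTop x₀, hlim.eventually_le_const (mul_pos hδ hp)] with x hx hxl
  have h1 := hstep ⌈x - x₀⌉₊
  have h2 : tail μ (x₀ + ⌈x - x₀⌉₊) ≤ tail μ x :=
    tail_anti μ (by linarith [Nat.le_ceil (x - x₀)])
  have h3 : Real.exp (s / 2) ^ ⌈x - x₀⌉₊ ≤ Real.exp (s / 2 * (x - x₀ + 1)) := by
    rw [← Real.exp_nat_mul]
    refine Real.exp_le_exp.2 ?_
    have := (Nat.ceil_lt_add_one (show 0 ≤ x - x₀ by linarith)).le
    nlinarith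
  have h4 : tail μ x₀ ≤ Real.exp (s / 2 * (x - x₀ + 1)) * tail μ x :=
    h1.trans (mul_le_mul h3 h2 measureReal_nonneg (Real.exp_pos _).le)
  have h5 : Real.exp (-(s * x)) * Real.exp (s / 2 * (x - x₀ + 1)) =
      Real.exp (-(s / 2 * x)) * Real.exp (s / 2 * (1 - x₀)) := by
    rw [← Real.exp_add, ← Real.exp_add]
    congr 1
    ring
  have h6 : Real.exp (-(s * x)) * Real.exp (s / 2 * (x - x₀ + 1)) ≤
      (δ * tail μ x) * Real.exp (s / 2 * (x - x₀ + 1)) := by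
    rw [h5]
    calc _ ≤ _ := hxl
      _ ≤ δ * (Real.exp (s / 2 * (x - x₀ + 1)) * tail μ x) := by gcongr
      _ = _ := by ring
  exact le_of_mul_le_mul_right h6 (Real.exp_pos _)

/-- An eventual domination by a subexponential tail holds everywhere up to a constant. -/
theorem IsSubexponential.le_mul_tail_of_forall_ge (h : IsSubexponential μ) {x₀ L x y M : ℝ}
    (hM : 0 ≤ M) (hL : 0 ≤ L) (hyM : y ≤ M) (hy : x₀ ≤ x → y ≤ L * tail μ x) :
    y ≤ (L + M / tail μ x₀) * tail μ x := by
  have := h.isProbabilityMeasure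
  have hx := h.tail_pos x
  have h0 := h.tail_pos x₀
  rcases le_total x₀ x with hxx | hxx
  · have := hy hxx
    have : 0 ≤ M / tail μ x₀ * tail μ x := by positivity
    linarith
  · have h1 := tail_anti μ hxx
    have : M ≤ M / tail μ x₀ * tail μ x := by
      rw [div_mul_eq_mul_div, le_div_iff₀ h0]
      exact mul_le_mul_of_nonneg_left h1 hM
    have : 0 ≤ L * tail μ x := by positivity
    linarith

end Subexponential

/-! ### Renewal-type inequalities with a subexponential forcing term -/

section Renewal

variable {μ : Measure ℝ}

/-- By `exists_prod_le` either the summand from `ρ N` is large, at the price of the mass `γ` of `H`,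
or the one from `H` is, or both are moderate. A domination constant `α` for `ρ N` enters only
multiplied by `δ`, so a crude `α` will do. -/
lemma renewal_step (h : IsSubexponential μ) {γ L K : ℝ} (hγ0 : 0 ≤ γ) (hL : 0 ≤ L)
    {H : Measure ℝ} [IsFiniteMeasure H] (hHγ : H.real univ ≤ γ)
    (hH : ∀ᶠ x in atTop, tail H x ≤ L * tail μ x)
    {ρ : ℕ → Measure ℝ} [∀ N, IsProbabilityMeasure (ρ N)]
    (hstep : ∀ N, ∀ x, K ≤ x →
      tail (ρ (N + 1)) x ≤ (H.prod (ρ N)).real {p : ℝ × ℝ | x < p.1 + p.2})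
    {δ : ℝ} (hδ : 0 < δ) :
    ∃ A, ∀ᶠ x in atTop, ∀ N, ∀ α, 0 ≤ α → (∀ y, tail (ρ N) y ≤ α * tail μ y) →
      tail (ρ (N + 1)) x ≤ γ * tail (ρ N) (x - A) + (L + δ) * tail μ x + α * δ * tail μ x := by
  obtain ⟨x₀, hx₀⟩ := eventually_atTop.1 hH
  have hC : ∀ x, tail H x ≤ (L + γ / tail μ x₀) * tail μ x := fun x =>
    h.le_mul_tail_of_forall_ge hγ0 hL ((tail_le_univ H x).trans hHγ) (hx₀ x)
  have hp := h.tail_pos x₀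
  obtain ⟨A, -, hA⟩ := h.exists_prod_le (show 0 ≤ L + γ / tail μ x₀ by positivity) hδ
  have h1 : 1 < 1 + δ / (L + 1) := by
    have : 0 < δ / (L + 1) := by positivity
    linarith
  refine ⟨A, ?_⟩
  filter_upwards [hA, h.eventually_tail_sub_le A h1, eventually_ge_atTop K,
    eventually_ge_atTop (x₀ + A)] with x hx hxA hxK hxx N α hα hρ
  have h2 := hx H (ρ N) hC α hα hρ
  have h3 := hstep N x hxK
  have h4 := hx₀ (x - A) (by linarith)
  have h5 : tail H (x - A) ≤ (L + δ) * tail μ x := by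
    calc _ ≤ L * ((1 + δ / (L + 1)) * tail μ x) :=
          h4.trans (mul_le_mul_of_nonneg_left hxA hL)
      _ = (L + δ * (L / (L + 1))) * tail μ x := by ring
      _ ≤ (L + δ * 1) * tail μ x := by
          have := h.tail_pos x
          have : L / (L + 1) ≤ 1 := by
            rw [div_le_one (by linarith)]
            linarith
          gcongr
      _ = _ := by rw [mul_one]
  have h6 : H.real univ * tail (ρ N) (x - A) ≤ γ * tail (ρ N) (x - A) :=
    mul_le_mul_of_nonneg_right hHγ (tail_nonneg _ _)
  have h7 : (ρ N).real univ = 1 := probReal_univ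
  rw [h7, one_mul] at h2
  linarith

/-- If the laws `ρ N` satisfy `ρ (N + 1) ≤ H ∗ ρ N` far out, where `H` has mass `γ < 1` and a tail
dominated by `L` times a subexponential tail, then the tails of the `ρ N` are asymptotically
dominated, uniformly in `N`, by `L / (1 - γ)` times the subexponential tail. -/
theorem renewal_bound (h : IsSubexponential μ) {γ L K : ℝ} (hγ0 : 0 ≤ γ) (hγ1 : γ < 1)
    (hL : 0 ≤ L) {H : Measure ℝ} [IsFiniteMeasure H] (hHγ : H.real univ ≤ γ)
    (hH : ∀ᶠ x in atTop, tail H x ≤ L * tail μ x)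
    {ρ : ℕ → Measure ℝ} [∀ N, IsProbabilityMeasure (ρ N)] (hρ0 : ∀ x, 0 ≤ x → tail (ρ 0) x = 0)
    (hstep : ∀ N, ∀ x, K ≤ x →
      tail (ρ (N + 1)) x ≤ (H.prod (ρ N)).real {p : ℝ × ℝ | x < p.1 + p.2})
    {η : ℝ} (hη : 0 < η) :
    ∀ᶠ x in atTop, ∀ N, tail (ρ N) x ≤ (L / (1 - γ) + η) * tail μ x := by
  have := h.isProbabilityMeasure
  have core := fun {δ : ℝ} (hδ : 0 < δ) => renewal_step h hγ0 hL hHγ hH hstep hδ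
  -- First a crude constant, by induction on `N`. One step maps `α` to `θ * α + (L + δ)` with `θ <
  -- 1`, so `(L + δ) / (1 - θ)` is preserved; `1 / tail μ x₁` takes care of `x ≤ x₁`.
  obtain ⟨α, hα0, hα⟩ : ∃ α, 0 ≤ α ∧ ∀ N x, tail (ρ N) x ≤ α * tail μ x := by
    set δ := (1 - γ) / 4 with hδd
    have hδ : 0 < δ := by rw [hδd]; linarith
    obtain ⟨A, hA⟩ := core hδ
    obtain ⟨x₁, hx₁⟩ := eventually_atTop.1 ((hA.and (eventually_ge_atTop 0)).and
      (h.eventually_tail_sub_le A (show 1 < 1 + δ by linarith)))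
    have hx₁0 : 0 ≤ x₁ := (hx₁ x₁ le_rfl).1.2
    have hp := h.tail_pos x₁
    set θ := γ * (1 + δ) + δ with hθ
    have hθ1 : θ < 1 := by nlinarith
    have hα1 : (L + δ) ≤ max (1 / tail μ x₁) ((L + δ) / (1 - θ)) * (1 - θ) := by
      rw [← div_le_iff₀ (by linarith)]
      exact le_max_right _ _
    have hα2 : 1 ≤ max (1 / tail μ x₁) ((L + δ) / (1 - θ)) * tail μ x₁ := by
      rw [← div_le_iff₀ hp]
      exact le_max_left _ _
    set α := max (1 / tail μ x₁) ((L + δ) / (1 - θ))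
    have hα0 : 0 ≤ α := le_trans (by positivity) (le_max_left _ _)
    refine ⟨α, hα0, fun N => ?_⟩
    have hsmall : ∀ N x, x ≤ x₁ → tail (ρ N) x ≤ α * tail μ x := fun N x hx =>
      (measureReal_le_one.trans hα2).trans (mul_le_mul_of_nonneg_left (tail_anti μ hx) hα0)
    induction N with
    | zero =>
      intro x
      rcases le_total x x₁ with hx | hx
      · exact hsmall 0 x hx
      · rw [hρ0 x (hx₁0.trans hx)]
        exact mul_nonneg hα0 (tail_nonneg _ _)
    | succ N ih =>
      intro x
      rcases le_total x x₁ with hx | hx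
      · exact hsmall _ x hx
      · have h1 := (hx₁ x hx).1.1 N α hα0 ih
        have h2 := (hx₁ x hx).2
        have h3 : γ * tail (ρ N) (x - A) ≤ γ * (α * ((1 + δ) * tail μ x)) :=
          mul_le_mul_of_nonneg_left ((ih _).trans (mul_le_mul_of_nonneg_left h2 hα0)) hγ0
        have h4 := mul_le_mul_of_nonneg_right hα1 (h.tail_pos x).le
        calc _ ≤ _ := h1
          _ ≤ γ * (α * ((1 + δ) * tail μ x)) + α * (1 - θ) * tail μ x + α * δ * tail μ x := by
            linarith
          _ = α * tail μ x := by rw [hθ]; ring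
  -- An eventual bound `β` improves itself to `γ * β + (L + δ)`. Iterating this contraction
  -- approaches its fixed point `(L + δ) / (1 - γ)`.
  have improve : ∀ {β δ : ℝ}, 0 ≤ β → 0 < δ →
      (∀ᶠ x in atTop, ∀ N, tail (ρ N) x ≤ β * tail μ x) →
      ∀ᶠ x in atTop, ∀ N, tail (ρ N) x ≤ (γ * β + (L + δ)) * tail μ x := by
    intro β δ hβ hδ hQ
    set δ' := δ / (γ * β + 1 + α) with hδd
    have hδ' : 0 < δ' := by positivity
    have hδ'' : γ * β * δ' + δ' + α * δ' = δ := by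
      rw [hδd]
      field_simp
    obtain ⟨A, hA⟩ := core hδ'
    have hQA := (tendsto_atTop_add_const_right atTop (-A) tendsto_id).eventually hQ
    filter_upwards [hA, hQA, eventually_ge_atTop 0,
      h.eventually_tail_sub_le A (show 1 < 1 + δ' by linarith)] with x h1 h2 h3 h4 N
    have htx := h.tail_pos x
    cases N with
    | zero =>
      rw [hρ0 x h3]
      positivity
    | succ N =>
      have h5 := h1 N α hα0 (hα N)
      have h6 : tail (ρ N) (x - A) ≤ β * tail μ (x - A) := h2 N
      have h7 : γ * tail (ρ N) (x - A) ≤ γ * (β * ((1 + δ') * tail μ x)) :=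
        mul_le_mul_of_nonneg_left (h6.trans (mul_le_mul_of_nonneg_left h4 hβ)) hγ0
      calc _ ≤ _ := h5
        _ ≤ γ * (β * ((1 + δ') * tail μ x)) + (L + δ') * tail μ x + α * δ' * tail μ x := by
          linarith
        _ = (γ * β + (L + (γ * β * δ' + δ' + α * δ'))) * tail μ x := by ring
        _ = _ := by rw [hδ'']
  set δ := (1 - γ) * (η / 2) with hδd
  have h1γ : 0 < 1 - γ := by linarith
  have hδ : 0 < δ := by positivity
  have iter : ∀ j : ℕ, ∀ᶠ x in atTop, ∀ N,
      tail (ρ N) x ≤ (γ ^ j * α + (L + δ) / (1 - γ)) * tail μ x := by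
    intro j
    induction j with
    | zero =>
      filter_upwards with x N
      have htx := h.tail_pos x
      refine (hα N x).trans (mul_le_mul_of_nonneg_right ?_ htx.le)
      have : 0 ≤ (L + δ) / (1 - γ) := by positivity
      linarith
    | succ j ih =>
      have := improve (by positivity) hδ ih
      convert this using 5
      field_simp
      ring
  have hpow : Tendsto (fun j : ℕ => γ ^ j * α) atTop (𝓝 0) := by
    simpa using (tendsto_pow_atTop_nhds_zero_of_lt_one hγ0 hγ1).mul_const α
  obtain ⟨j, hj⟩ := (hpow.eventually_le_const (half_pos hη)).exists
  filter_upwards [iter j] with x hx N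
  refine (hx N).trans (mul_le_mul_of_nonneg_right ?_ (h.tail_pos x).le)
  have : (L + δ) / (1 - γ) = L / (1 - γ) + η / 2 := by
    rw [hδd]
    field_simp
  linarith

end Renewal

/-! ### Integrated tails -/

section Integrated

lemma integral_tail_nonneg {F : Measure ℝ} (x : ℝ) : 0 ≤ ∫ u in Ioi x, tail F u :=
  integral_nonneg (tail_nonneg F)

variable {F : Measure ℝ} [IsProbabilityMeasure F]

lemma integral_tail_sub (hF : IntegrableOn (tail F) (Ioi 0)) {x y : ℝ} (hxy : x ≤ y) :
    (y - x) * tail F y ≤ (∫ u in Ioi x, tail F u) - ∫ u in Ioi y, tail F u ∧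
      (∫ u in Ioi x, tail F u) - ∫ u in Ioi y, tail F u ≤ (y - x) * tail F x := by
  have hI := integrableOn_tail_Ioc F x y
  have e : ∫ u in Ioi x, tail F u = (∫ u in Ioc x y, tail F u) + ∫ u in Ioi y, tail F u := by
    rw [← Ioc_union_Ioi_eq_Ioi hxy]
    exact setIntegral_union (Ioc_disjoint_Ioi le_rfl) measurableSet_Ioi hI
      (integrableOn_tail_Ioi F hF y)
  have hc : ∀ c : ℝ, ∫ _ in Ioc x y, c = (y - x) * c := by
    intro c
    simp [hxy]
  rw [e, add_sub_cancel_right]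
  constructor
  · rw [← hc]
    exact setIntegral_mono_on (by simp) hI measurableSet_Ioc
      fun u hu => tail_antitone F hu.2
  · rw [← hc]
    exact setIntegral_mono_on hI (by simp) measurableSet_Ioc
      fun u hu => tail_antitone F hu.1.le

lemma eventually_integratedTail_eq (hF : IntegrableOn (tail F) (Ioi 0))
    (hFs : IsSubexponential (integratedTailLaw F)) :
    ∀ᶠ x in atTop, tail (integratedTailLaw F) x = ∫ u in Ioi x, tail F u := by
  have := hFs.isProbabilityMeasure
  filter_upwards [eventually_ge_atTop 0,
    (tendsto_tail_atTop (integratedTailLaw F)).eventually_lt_const one_pos] with x hx h1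
  rw [tail_integratedTailLaw F hF hx, integratedTail] at h1 ⊢
  rcases min_lt_iff.1 h1 with h | h
  · exact absurd h (lt_irrefl _)
  · exact min_eq_right h.le

/-- The drop of the integrated tail over `(x - 1, x]` is at least `tail F x`, and the long tail of
`F^s` makes this drop negligible. -/
lemma tail_isLittleO (hF : IntegrableOn (tail F) (Ioi 0))
    (hFs : IsSubexponential (integratedTailLaw F)) {δ : ℝ} (hδ : 0 < δ) :
    ∀ᶠ x in atTop, tail F x ≤ δ * tail (integratedTailLaw F) x := by
  have e := eventually_integratedTail_eq hF hFs
  filter_upwards [e, (tendsto_atTop_add_const_right atTop (-1) tendsto_id).eventually e,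
    hFs.eventually_tail_sub_le 1 (show 1 < 1 + δ by linarith)] with x h1 h2 h3
  have h4 := (integral_tail_sub hF (show x - 1 ≤ x by linarith)).1
  have h2' : tail (integratedTailLaw F) (x - 1) = ∫ u in Ioi (x - 1), tail F u := h2
  rw [← h1, ← h2'] at h4
  linarith

/-- By monotonicity, each term but the first is at most `1 / c` times the integral over the interval
that precedes it. -/
lemma sum_tail_le (hF : IntegrableOn (tail F) (Ioi 0)) {c : ℝ} (hc : 0 < c) (y : ℝ) (M : ℕ) :
    ∑ k ∈ Finset.range M, tail F (y + k * c) ≤ tail F y + (∫ u in Ioi y, tail F u) / c := by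
  have key : ∀ M : ℕ, ∑ k ∈ Finset.range (M + 1), tail F (y + k * c) ≤
      tail F y + ((∫ u in Ioi y, tail F u) - ∫ u in Ioi (y + M * c), tail F u) / c := by
    intro M
    induction M with
    | zero => simp
    | succ M ih =>
      rw [Finset.sum_range_succ]
      have h1 := (integral_tail_sub hF
        (show y + M * c ≤ y + ((M + 1 : ℕ) : ℝ) * c by push_cast; linarith)).1
      have e : y + ((M + 1 : ℕ) : ℝ) * c - (y + M * c) = c := by push_cast; ring
      rw [e, mul_comm, ← le_div_iff₀ hc, sub_div] at h1
      rw [sub_div] at ih ⊢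
      linarith
  have h0 : ∑ k ∈ Finset.range M, tail F (y + k * c) ≤
      ∑ k ∈ Finset.range (M + 1), tail F (y + k * c) := by
    rw [Finset.sum_range_succ]
    linarith [tail_nonneg F (y + M * c)]
  refine h0.trans ((key M).trans ?_)
  have := integral_tail_nonneg (F := F) (y + M * c)
  gcongr
  linarith

/-- By monotonicity, each term is at least `1 / c` times the integral over the interval that follows
it. -/
lemma le_sum_tail (hF : IntegrableOn (tail F) (Ioi 0)) {c : ℝ} (hc : 0 < c) (y : ℝ) (M : ℕ) :
    ((∫ u in Ioi y, tail F u) - ∫ u in Ioi (y + M * c), tail F u) / c ≤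
      ∑ k ∈ Finset.range M, tail F (y + k * c) := by
  induction M with
  | zero => simp
  | succ M ih =>
    rw [Finset.sum_range_succ]
    have h1 := (integral_tail_sub hF
      (show y + M * c ≤ y + ((M + 1 : ℕ) : ℝ) * c by push_cast; linarith)).2
    have e : y + ((M + 1 : ℕ) : ℝ) * c - (y + M * c) = c := by push_cast; ring
    rw [e, mul_comm c, ← div_le_iff₀ hc, sub_div] at h1
    rw [sub_div] at ih ⊢
    linarith

/-- This stands in for regular variation. On `(c₁ x, c₂ x]` the tail is at most `tail F (c₁ * x)`,
and `(c₁ - 1) * x * tail F (c₁ * x)` is at most the integral over `(x, c₁ x]`. -/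
lemma integral_tail_mul_le (hF : IntegrableOn (tail F) (Ioi 0)) {c₁ c₂ x : ℝ} (h1 : 1 < c₁)
    (h12 : c₁ ≤ c₂) (hx : 0 ≤ x) :
    ∫ u in Ioi (c₁ * x), tail F u ≤ (∫ u in Ioi (c₂ * x), tail F u) +
      (c₂ - c₁) / (c₁ - 1) * ∫ u in Ioi x, tail F u := by
  have e1 := (integral_tail_sub hF (mul_le_mul_of_nonneg_right h12 hx)).2
  have e2 := (integral_tail_sub hF (show x ≤ c₁ * x by nlinarith)).1
  have e3 := integral_tail_nonneg (F := F) (c₁ * x)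
  have h : 0 < c₁ - 1 := by linarith
  have e4 : x * tail F (c₁ * x) ≤ (∫ u in Ioi x, tail F u) / (c₁ - 1) := by
    rw [le_div_iff₀ h]
    linarith
  have e5 : (c₂ - c₁) * (x * tail F (c₁ * x)) ≤
      (c₂ - c₁) * ((∫ u in Ioi x, tail F u) / (c₁ - 1)) :=
    mul_le_mul_of_nonneg_left e4 (by linarith)
  have e6 : (c₂ - c₁) / (c₁ - 1) * ∫ u in Ioi x, tail F u =
      (c₂ - c₁) * ((∫ u in Ioi x, tail F u) / (c₁ - 1)) := by ring
  rw [e6]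
  linarith

/-- Sums of a tail asymptotic to `d` times the tail of `F`, along an arithmetic progression, are
asymptotically at most `d / c` times the integrated tail. -/
lemma eventually_sum_le (hF : IntegrableOn (tail F) (Ioi 0)) (hFpos : ∀ x, 0 < tail F x)
    (hFs : IsSubexponential (integratedTailLaw F)) {q : ℝ → ℝ} {d : ℝ} (hd : 0 ≤ d)
    (hq : Tendsto (fun x => q x / tail F x) atTop (𝓝 d)) {c L : ℝ} (hc : 0 < c)
    (hL : d / c < L) (D : ℝ) :
    ∀ᶠ x in atTop, ∀ M : ℕ, ∑ k ∈ Finset.range M, q (x - D + k * c) ≤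
      L * tail (integratedTailLaw F) x := by
  obtain ⟨d', hd', hdL⟩ : ∃ d', d < d' ∧ d' / c < L := by
    rw [div_lt_iff₀ hc] at hL
    obtain ⟨d', h1, h2⟩ := exists_between hL
    exact ⟨d', h1, (div_lt_iff₀ hc).2 h2⟩
  have hd'0 : 0 < d' := hd.trans_lt hd'
  -- The first `δ` pays for the leading term of the sum, a tail of `F`, and `1 + δ` for the shift by
  -- `D`.
  obtain ⟨δ, hδ, hδL⟩ : ∃ δ : ℝ, 0 < δ ∧ d' * (δ + 1 / c) * (1 + δ) ≤ L := by
    have : Tendsto (fun δ : ℝ => d' * (δ + 1 / c) * (1 + δ)) (𝓝[>] 0)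
        (𝓝 (d' * (0 + 1 / c) * (1 + 0))) := by
      refine Tendsto.mono_left (Continuous.tendsto ?_ 0) nhdsWithin_le_nhds
      fun_prop
    have h2 : d' * (0 + 1 / c) * (1 + 0) < L := by
      convert hdL using 1
      ring
    obtain ⟨δ, h3, h4⟩ := ((this.eventually_lt_const h2).and self_mem_nhdsWithin).exists
    exact ⟨δ, h4, h3.le⟩
  have hshift : Tendsto (fun x : ℝ => x - D) atTop atTop :=
    tendsto_atTop_add_const_right atTop (-D) tendsto_id
  obtain ⟨x₀, hx₀⟩ := eventually_atTop.1 (hq.eventually_lt_const hd')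
  filter_upwards [hshift.eventually (eventually_ge_atTop x₀),
    hshift.eventually (eventually_integratedTail_eq hF hFs),
    hshift.eventually (tail_isLittleO hF hFs hδ),
    hFs.eventually_tail_sub_le D (show 1 < 1 + δ by linarith)] with x h1 h2 h3 h4 M
  have hG := hFs.tail_pos x
  calc ∑ k ∈ Finset.range M, q (x - D + k * c)
      ≤ ∑ k ∈ Finset.range M, d' * tail F (x - D + k * c) := by
        refine Finset.sum_le_sum fun k _ => ?_
        have h5 := hx₀ (x - D + k * c) (h1.trans (by
          have : 0 ≤ (k : ℝ) * c := by positivity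
          linarith))
        exact ((div_lt_iff₀ (hFpos _)).1 h5).le
    _ = d' * ∑ k ∈ Finset.range M, tail F (x - D + k * c) := by rw [Finset.mul_sum]
    _ ≤ d' * (δ * tail (integratedTailLaw F) (x - D) +
          tail (integratedTailLaw F) (x - D) / c) := by
        refine mul_le_mul_of_nonneg_left ((sum_tail_le hF hc _ M).trans ?_) hd'0.le
        rw [← h2]
        linarith
    _ = d' * (δ + 1 / c) * tail (integratedTailLaw F) (x - D) := by ring
    _ ≤ d' * (δ + 1 / c) * ((1 + δ) * tail (integratedTailLaw F) x) :=
        mul_le_mul_of_nonneg_left h4 (by positivity)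
    _ = d' * (δ + 1 / c) * (1 + δ) * tail (integratedTailLaw F) x := by ring
    _ ≤ _ := mul_le_mul_of_nonneg_right hδL hG.le

lemma eventually_le_sum (hF : IntegrableOn (tail F) (Ioi 0)) (hFpos : ∀ x, 0 < tail F x)
    {q : ℝ → ℝ} {d d' : ℝ} (hq : Tendsto (fun x => q x / tail F x) atTop (𝓝 d)) (hd0 : 0 ≤ d')
    (hd' : d' < d) {c : ℝ} (hc : 0 < c) :
    ∀ᶠ y in atTop, ∀ M : ℕ,
      d' / c * ((∫ u in Ioi y, tail F u) - ∫ u in Ioi (y + M * c), tail F u) ≤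
        ∑ k ∈ Finset.range M, q (y + k * c) := by
  obtain ⟨x₀, hx₀⟩ := eventually_atTop.1 (hq.eventually_const_lt hd')
  filter_upwards [eventually_ge_atTop x₀] with y hy M
  calc _ = d' * (((∫ u in Ioi y, tail F u) - ∫ u in Ioi (y + M * c), tail F u) / c) := by ring
    _ ≤ d' * ∑ k ∈ Finset.range M, tail F (y + k * c) :=
        mul_le_mul_of_nonneg_left (le_sum_tail hF hc y M) hd0
    _ = ∑ k ∈ Finset.range M, d' * tail F (y + k * c) := by rw [Finset.mul_sum]
    _ ≤ _ := by
        refine Finset.sum_le_sum fun k _ => ?_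
        have h5 := hx₀ (y + k * c) (hy.trans (by
          have : 0 ≤ (k : ℝ) * c := by positivity
          linarith))
        exact ((lt_div_iff₀ (hFpos _)).1 h5).le

end Integrated

/-! ### A last-passage functional of a path of service and interarrival times -/

section Paths

/-- The last-passage time of a path through a station whose customers arrive at times `β, 2β, …`:
the customer `k` departs at time `lpp β w (k + 1)` when `(w k).1` is its service time. -/
def lpp (β : ℝ) (w : ℕ → ℝ × ℝ) : ℕ → ℝ
  | 0 => 0
  | k + 1 => max (lpp β w k) ((k + 1 : ℕ) * β) + (w k).1

/-- The last-passage time minus the sum of the second coordinates of the path. -/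
def excess (β : ℝ) (w : ℕ → ℝ × ℝ) (k : ℕ) : ℝ := lpp β w k - ∑ i ∈ Finset.range k, (w i).2

/-- The path without its first `k` entries. -/
def shift (k : ℕ) (w : ℕ → ℝ × ℝ) : ℕ → ℝ × ℝ := fun i => w (k + i)

/-- The path with all entries but the first `k` replaced by `0`. -/
def trunc (k : ℕ) (w : ℕ → ℝ × ℝ) : ℕ → ℝ × ℝ := fun i => if i < k then w i else 0

variable {β : ℝ} {w : ℕ → ℝ × ℝ}

lemma excess_zero : excess β w 0 = 0 := by simp [excess, lpp]

lemma measurable_lpp (β : ℝ) (k : ℕ) : Measurable fun w => lpp β w k := by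
  induction k with
  | zero => exact measurable_const
  | succ k ih => exact (ih.max measurable_const).add (measurable_fst.comp (measurable_pi_apply k))

lemma measurable_excess (β : ℝ) (k : ℕ) : Measurable fun w => excess β w k :=
  (measurable_lpp β k).sub
    (Finset.measurable_sum _ fun i _ => measurable_snd.comp (measurable_pi_apply i))

lemma measurable_shift (k : ℕ) : Measurable (shift k) :=
  measurable_pi_lambda _ fun i => measurable_pi_apply (k + i)

lemma measurable_trunc (k : ℕ) : Measurable (trunc k) := by
  refine measurable_pi_lambda _ fun i => ?_
  by_cases h : i < k
  · simpa [trunc, h] using measurable_pi_apply i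
  · simp [trunc, h]

lemma lpp_trunc {j k : ℕ} (h : j ≤ k) : lpp β (trunc k w) j = lpp β w j := by
  induction j with
  | zero => rfl
  | succ j ih =>
    rw [lpp, lpp, ih (by omega)]
    simp [trunc, show j < k by omega]

lemma excess_trunc {j k : ℕ} (h : j ≤ k) : excess β (trunc k w) j = excess β w j := by
  rw [excess, excess, lpp_trunc h]
  congr 1
  refine Finset.sum_congr rfl fun i hi => ?_
  have := Finset.mem_range.1 hi
  simp [trunc, show i < k by omega]

lemma le_lpp (hw : ∀ i, 0 ≤ (w i).1) (k : ℕ) : (k : ℝ) * β ≤ lpp β w k := by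
  cases k with
  | zero => simp [lpp]
  | succ k => exact (le_max_right _ _).trans (le_add_of_nonneg_right (hw k))

/-- Restart the station at time `lpp β w k` with the remaining customers. Since this time is at
least `k * β`, every later arrival is only delayed, so the departures can only get later. -/
lemma lpp_add_le (hw : ∀ i, 0 ≤ (w i).1) (k j : ℕ) :
    lpp β w (k + j) ≤ lpp β w k + lpp β (shift k w) j := by
  induction j with
  | zero => simp [lpp]
  | succ j ih =>
    rw [← add_assoc, lpp, lpp, ← add_assoc]
    refine add_le_add (max_le ?_ ?_) le_rfl
    · exact ih.trans (add_le_add le_rfl (le_max_left _ _))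
    · have h1 := le_lpp (β := β) hw k
      have h2 := le_max_right (lpp β (shift k w) j) (((j + 1 : ℕ) : ℝ) * β)
      push_cast at h2 ⊢
      linarith

/-- This replaces the additivity of a random walk, and it is what makes a renewal argument possible
for the maximal excess. -/
lemma excess_add_le (hw : ∀ i, 0 ≤ (w i).1) (k j : ℕ) :
    excess β w (k + j) ≤ excess β w k + excess β (shift k w) j := by
  have h := lpp_add_le (β := β) hw k j
  rw [excess, excess, excess, Finset.sum_range_add]
  simp only [shift] at h ⊢
  linarith

/-- A large increase in one step can only come from one large service time; this controls the
overshoot at the first exit. -/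
lemma excess_succ_le (hβ : 0 ≤ β) (hw : ∀ i, 0 ≤ (w i).1) (hw' : ∀ i, 0 ≤ (w i).2) (k : ℕ) :
    excess β w (k + 1) ≤ excess β w k + β + (w k).1 := by
  have h := le_lpp (β := β) hw k
  have h2 : max (lpp β w k) ((k + 1 : ℕ) * β) ≤ lpp β w k + β := by
    refine max_le (by linarith) ?_
    push_cast
    linarith
  rw [excess, excess, lpp, Finset.sum_range_succ]
  linarith [hw' k]

/-- The path on which customer `n` starts service on arrival and the station is busy from then on.
-/
lemma le_lpp_succ {n k : ℕ} (h : n ≤ k) :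
    ((n + 1 : ℕ) : ℝ) * β + ∑ i ∈ Finset.Ico n (k + 1), (w i).1 ≤ lpp β w (k + 1) := by
  induction k, h using Nat.le_induction with
  | base =>
    rw [lpp]
    simp
  | succ k hk ih =>
    rw [Finset.sum_Ico_succ_top (by omega), lpp, ← add_assoc]
    exact add_le_add (ih.trans (le_max_left _ _)) le_rfl

/-- The index `n` opens the current busy period. The bound is not sharp at `k = 0`, where `lpp` is
`0` and the right side is `β`. -/
lemma exists_lpp_le (hβ : 0 ≤ β) (k : ℕ) :
    ∃ n ≤ k, lpp β w k ≤ ((n + 1 : ℕ) : ℝ) * β + ∑ i ∈ Finset.Ico n k, (w i).1 := by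
  induction k with
  | zero => exact ⟨0, le_rfl, by simpa [lpp] using hβ⟩
  | succ k ih =>
    obtain ⟨n, hn, h⟩ := ih
    rw [lpp]
    rcases le_total (lpp β w k) (((k + 1 : ℕ) : ℝ) * β) with h1 | h1
    · refine ⟨k, by omega, ?_⟩
      rw [max_eq_right h1]
      simp
    · refine ⟨n, by omega, ?_⟩
      rw [max_eq_left h1, Finset.sum_Ico_succ_top hn]
      linarith

end Paths

/-! ### Tightness and conditioning -/

section Probability

variable {Ω : Type*} [MeasurableSpace Ω] {P : Measure Ω}

/-- An almost surely finite supremum is tight, by continuity of the measure from above. -/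
lemma exists_forall_le_of_bddAbove [IsProbabilityMeasure P] {f : ℕ → Ω → ℝ}
    (hf : ∀ k, Measurable (f k)) (hb : ∀ᵐ ω ∂P, BddAbove (range fun k => f k ω)) {δ : ℝ}
    (hδ : 0 < δ) : ∃ K : ℝ, 0 ≤ K ∧ P.real {ω | ∃ k, K < f k ω} ≤ δ := by
  have hm : ∀ K : ℝ, MeasurableSet {ω | ∃ k, K < f k ω} := fun K => by
    rw [Set.ofPred_exists]
    exact MeasurableSet.iUnion fun k => measurableSet_lt measurable_const (hf k)
  have h : Tendsto (P ∘ fun n : ℕ => {ω | ∃ k, (n : ℝ) < f k ω}) atTop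
      (𝓝 (P (⋂ n : ℕ, {ω | ∃ k, (n : ℝ) < f k ω}))) := by
    refine tendsto_measure_iInter_atTop (fun n => (hm n).nullMeasurableSet) ?_
      ⟨0, measure_ne_top _ _⟩
    rintro n m hnm ω ⟨k, hk⟩
    exact ⟨k, lt_of_le_of_lt (Nat.cast_le.2 hnm) hk⟩
  have h0 : P (⋂ n : ℕ, {ω | ∃ k, (n : ℝ) < f k ω}) = 0 := by
    refine measure_mono_null ?_ hb
    intro ω hω hbd
    obtain ⟨B, hB⟩ := hbd
    obtain ⟨n, hn⟩ := exists_nat_ge B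
    obtain ⟨k, hk⟩ := mem_iInter.1 hω n
    exact absurd (hB ⟨k, rfl⟩) (not_le.2 (hn.trans_lt hk))
  rw [h0] at h
  have h' := (ENNReal.tendsto_toReal ENNReal.zero_ne_top).comp h
  obtain ⟨n, hn⟩ := (h'.eventually_le_const (show (0 : ℝ≥0∞).toReal < δ by simpa using hδ)).exists
  exact ⟨n, n.cast_nonneg, hn⟩

/-- Independence of the past `U`, together with an event `A` of the past, from the future `V`, in
the form needed at an exit time. -/
lemma map_restrict_prod_map [IsProbabilityMeasure P] {E E' : Type*} [MeasurableSpace E]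
    [MeasurableSpace E'] {U : Ω → E} {V : Ω → E'} (hU : Measurable U) (hV : Measurable V)
    (hUV : IndepFun U V P) {A : Set E} (hA : MeasurableSet A) {f : E → ℝ} {g : E' → ℝ}
    (hf : Measurable f) (hg : Measurable g) :
    ((P.restrict (U ⁻¹' A)).map (fun ω => f (U ω))).prod (P.map (fun ω => g (V ω))) =
      (P.restrict (U ⁻¹' A)).map (fun ω => (f (U ω), g (V ω))) := by
  have hfU : Measurable fun ω => f (U ω) := hf.comp hU
  have hgV : Measurable fun ω => g (V ω) := hg.comp hV
  have := Measure.isProbabilityMeasure_map (μ := P) hgV.aemeasurable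
  refine (Measure.prod_eq fun s t hs ht => ?_)
  rw [Measure.map_apply (hfU.prodMk hgV) (hs.prod ht), Measure.map_apply hfU hs,
    Measure.map_apply hgV ht, Measure.restrict_apply (hfU hs),
    Measure.restrict_apply ((hfU.prodMk hgV) (hs.prod ht))]
  have h := hUV.measure_inter_preimage_eq_mul (f ⁻¹' s ∩ A) (g ⁻¹' t) ((hf hs).inter hA) (hg ht)
  have e1 : (fun ω => (f (U ω), g (V ω))) ⁻¹' s ×ˢ t ∩ U ⁻¹' A =
      U ⁻¹' (f ⁻¹' s ∩ A) ∩ V ⁻¹' (g ⁻¹' t) := by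
    ext ω
    simp only [mem_inter_iff, mem_preimage, mem_prod]
    tauto
  rw [e1, h]
  rfl

end Probability

/-! ### The maximal excess -/

section Excess

variable {Ω : Type*} [MeasurableSpace Ω] {P : Measure Ω}

/-- The maximal excess along the first `N` entries of the path. -/
noncomputable def maxExcess (β : ℝ) (N : ℕ) (w : ℕ → ℝ × ℝ) : ℝ :=
  (Finset.range (N + 1)).sup' Finset.nonempty_range_add_one fun k => excess β w k

lemma lt_maxExcess {β : ℝ} {N : ℕ} {w : ℕ → ℝ × ℝ} {x : ℝ} :
    x < maxExcess β N w ↔ ∃ k ≤ N, x < excess β w k := by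
  simp [maxExcess, Finset.lt_sup'_iff]

lemma measurable_maxExcess (β : ℝ) (N : ℕ) : Measurable (maxExcess β N) :=
  Finset.measurable_range_sup'' fun k _ => measurable_excess β k

/-- The set of paths whose excess exceeds the line `K - k c` for the first time at `k`. -/
def firstExit (β K c : ℝ) (k : ℕ) : Set (ℕ → ℝ × ℝ) :=
  {w | K - k * c < excess β w k ∧ ∀ j < k, excess β w j ≤ K - j * c}

lemma measurableSet_firstExit (β K c : ℝ) (k : ℕ) : MeasurableSet (firstExit β K c k) := by
  refine (measurableSet_lt measurable_const (measurable_excess β k)).inter ?_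
  have : {w | ∀ j < k, excess β w j ≤ K - j * c} =
      ⋂ j : ℕ, ⋂ _ : j < k, {w | excess β w j ≤ K - j * c} := by
    ext w
    simp
  change MeasurableSet {w | ∀ j < k, excess β w j ≤ K - j * c}
  rw [this]
  exact MeasurableSet.iInter fun j => MeasurableSet.iInter fun _ =>
    measurableSet_le (measurable_excess β j) measurable_const

/-- The first exit is a stopping time: whether it occurs at `k` is decided by the first `k` entries.
-/
lemma trunc_mem_firstExit {β K c : ℝ} {k : ℕ} {w : ℕ → ℝ × ℝ} :
    trunc k w ∈ firstExit β K c k ↔ w ∈ firstExit β K c k := by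
  simp only [firstExit, mem_ofPred_eq, excess_trunc le_rfl]
  refine and_congr Iff.rfl (forall₂_congr fun j hj => ?_)
  rw [excess_trunc hj.le]

lemma disjoint_firstExit {β K c : ℝ} :
    Pairwise (Function.onFun Disjoint fun k => firstExit β K c k) := by
  have key : ∀ i j : ℕ, i < j → Disjoint (firstExit β K c i) (firstExit β K c j) := by
    intro i j hij
    rw [Set.disjoint_left]
    intro w h1 h2
    exact absurd (h2.2 i hij) (not_le.2 h1.1)
  intro i j hij
  rcases lt_or_gt_of_ne hij with h | h
  · exact key i j h
  · exact (key j i h).symm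

/-- The law of the excess at the time of the first exit. -/
noncomputable def exitLaw (P : Measure Ω) (X : Ω → ℕ → ℝ × ℝ) (β K c : ℝ) : Measure ℝ :=
  Measure.sum fun k => (P.restrict (X ⁻¹' firstExit β K c k)).map fun ω => excess β (X ω) k

variable {X : Ω → ℕ → ℝ × ℝ}

lemma exitLaw_apply (hX : Measurable X) (β K c : ℝ) {s : Set ℝ} (hs : MeasurableSet s) :
    exitLaw P X β K c s =
      ∑' k, P {ω | X ω ∈ firstExit β K c k ∧ excess β (X ω) k ∈ s} := by
  rw [exitLaw, Measure.sum_apply _ hs]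
  refine tsum_congr fun k => ?_
  have hm : Measurable fun ω => excess β (X ω) k := (measurable_excess β k).comp hX
  rw [Measure.map_apply hm hs, Measure.restrict_apply (hm hs), inter_comm]
  rfl

/-- The exits at different times are disjoint, so their total mass is at most the probability of
ever crossing the line, which is small for large `K`. -/
lemma exitLaw_univ_le (hX : Measurable X) (β K c : ℝ) :
    exitLaw P X β K c univ ≤ P {ω | ∃ k : ℕ, K < excess β (X ω) k + k * c} := by
  rw [exitLaw_apply hX β K c MeasurableSet.univ]
  simp only [mem_univ, and_true]
  have : (⋃ k, X ⁻¹' firstExit β K c k) ⊆ {ω | ∃ k : ℕ, K < excess β (X ω) k + k * c} := by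
    intro ω hω
    obtain ⟨k, hk⟩ := mem_iUnion.1 hω
    exact ⟨k, by linarith [hk.1]⟩
  refine le_trans (le_of_eq ?_) (measure_mono this)
  rw [measure_iUnion (fun i j hij => (disjoint_firstExit hij).preimage X)
    fun k => hX (measurableSet_firstExit β K c k)]
  rfl

/-- A path whose excess passes `x ≥ K` has crossed the line `K - k c` by then. After the first
crossing, subadditivity leaves the excess of the shifted path, which is independent of the past and
has the law of `X`. The crossing is not at `k = 0`, because `K ≥ 0`, so at most `N` entries remain.
-/
lemma exitLaw_prod_ge [IsProbabilityMeasure P] (hX : Measurable X) {β K c : ℝ} (hK : 0 ≤ K) (hc : 0 ≤ c) (hw : ∀ ω i, 0 ≤ (X ω i).1)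
    (hind : ∀ k, IndepFun (fun ω => trunc k (X ω)) (fun ω => shift k (X ω)) P)
    (hshift : ∀ k, P.map (fun ω => shift k (X ω)) = P.map X) (N : ℕ) {x : ℝ} (hx : K ≤ x) :
    P {ω | x < maxExcess β (N + 1) (X ω)} ≤
      ((exitLaw P X β K c).prod (P.map fun ω => maxExcess β N (X ω)))
        {p : ℝ × ℝ | x < p.1 + p.2} := by
  have hms := measurableSet_lt_add x
  have hM := (measurable_maxExcess β N)
  have hsub : {ω | x < maxExcess β (N + 1) (X ω)} ⊆
      ⋃ k, {ω | X ω ∈ firstExit β K c k ∧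
        x < excess β (X ω) k + maxExcess β N (shift k (X ω))} := by
    intro ω hω
    obtain ⟨k', hk', hlt⟩ := lt_maxExcess.1 hω
    have hex : ∃ k : ℕ, K - k * c < excess β (X ω) k :=
      ⟨k', by have : 0 ≤ (k' : ℝ) * c := by positivity
              linarith⟩
    classical
    set k := Nat.find hex with hk
    have hspec : K - k * c < excess β (X ω) k := Nat.find_spec hex
    have hkk' : k ≤ k' := Nat.find_min' hex (by
      have : 0 ≤ (k' : ℝ) * c := by positivity
      linarith)
    have hk0 : k ≠ 0 := by
      intro h0
      rw [h0, excess_zero] at hspec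
      simp at hspec
      linarith
    refine mem_iUnion.2 ⟨k, ⟨hspec, fun j hj => not_lt.1 (Nat.find_min hex hj)⟩, ?_⟩
    obtain ⟨j, rfl⟩ := Nat.exists_eq_add_of_le hkk'
    have h1 := excess_add_le (β := β) (hw ω) k j
    have h2 : excess β (shift k (X ω)) j ≤ maxExcess β N (shift k (X ω)) :=
      not_lt.1 fun h => by
        have := not_lt.2 le_rfl (lt_maxExcess.2 ⟨j, by omega, h⟩)
        exact this
    linarith
  refine (measure_mono hsub).trans ((measure_iUnion_le _).trans (le_of_eq ?_))
  rw [Measure.prod_apply hms, exitLaw, lintegral_sum_measure]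
  refine tsum_congr fun k => ?_
  have e1 : P.map (fun ω => maxExcess β N (X ω)) =
      P.map (fun ω => maxExcess β N (shift k (X ω))) := by
    have a1 := Measure.map_map (μ := P) hM hX
    have a2 := Measure.map_map (μ := P) hM ((measurable_shift k).comp hX)
    simp only [Function.comp_def] at a1 a2
    rw [← a1, ← a2, hshift k]
  have e2 : X ⁻¹' firstExit β K c k = (fun ω => trunc k (X ω)) ⁻¹' firstExit β K c k := by
    ext ω
    exact trunc_mem_firstExit.symm
  have e3 : (fun ω => excess β (X ω) k) = fun ω => excess β (trunc k (X ω)) k := by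
    ext ω
    exact (excess_trunc le_rfl).symm
  have hT : Measurable fun ω => trunc k (X ω) := (measurable_trunc k).comp hX
  have hS : Measurable fun ω => shift k (X ω) := (measurable_shift k).comp hX
  rw [← Measure.prod_apply hms, e1, e2, e3, map_restrict_prod_map hT hS (hind k)
    (measurableSet_firstExit β K c k) (measurable_excess β k) hM]
  have hm2 : Measurable fun ω => (excess β (trunc k (X ω)) k, maxExcess β N (shift k (X ω))) :=
    ((measurable_excess β k).comp hT).prodMk (hM.comp hS)
  rw [Measure.map_apply hm2 hms, Measure.restrict_apply (hm2 hms)]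
  congr 1
  ext ω
  simp only [mem_inter_iff, mem_preimage, mem_ofPred_eq, trunc_mem_firstExit,
    excess_trunc le_rfl]
  tauto

/-- Just before an exit at `k + 1` the excess is at most `K - k c`. To land beyond `x`, the service
time `k` alone must exceed `x - (K + β) + k c`. -/
lemma exitLaw_tail_le [IsProbabilityMeasure P] (hX : Measurable X) {β K c : ℝ} (hβ : 0 ≤ β) (hK : 0 ≤ K) (hw : ∀ ω i, 0 ≤ (X ω i).1)
    (hw' : ∀ ω i, 0 ≤ (X ω i).2) {q : ℝ → ℝ} (hq : ∀ k x, P.real {ω | x < (X ω k).1} = q x)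
    {x B : ℝ} (hB : 0 ≤ B)
    (hsum : ∀ M : ℕ, ∑ k ∈ Finset.range M, q (x - (K + β) + k * c) ≤ B) :
    tail (exitLaw P X β K c) x ≤ B := by
  rw [tail, Measure.real]
  refine ENNReal.toReal_le_of_le_ofReal hB ?_
  rw [exitLaw_apply hX β K c measurableSet_Ioi]
  refine ENNReal.tsum_le_of_sum_range_le fun M => ?_
  have h0 : ∀ k : ℕ, P {ω | X ω ∈ firstExit β K c (k + 1) ∧ excess β (X ω) (k + 1) ∈ Ioi x} ≤
      ENNReal.ofReal (q (x - (K + β) + k * c)) := by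
    intro k
    rw [← hq k, ofReal_measureReal]
    refine measure_mono fun ω hω => ?_
    have h1 := hω.1.2 k (Nat.lt_succ_self k)
    have h2 := excess_succ_le hβ (hw ω) (hw' ω) k
    have h3 : x < excess β (X ω) (k + 1) := hω.2
    show x - (K + β) + k * c < (X ω k).1
    linarith
  cases M with
  | zero => simp
  | succ M =>
    rw [Finset.sum_range_succ']
    have hz : {ω | X ω ∈ firstExit β K c 0 ∧ excess β (X ω) 0 ∈ Ioi x} = ∅ := by
      ext ω
      simp only [firstExit, mem_ofPred_eq, excess_zero, mem_empty_iff_false, iff_false]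
      rintro ⟨⟨h, -⟩, -⟩
      simp at h
      linarith
    rw [hz, measure_empty, add_zero]
    refine (Finset.sum_le_sum fun k _ => h0 k).trans ?_
    have hq0 : ∀ y, 0 ≤ q y := fun y => hq 0 y ▸ measureReal_nonneg
    rw [← ENNReal.ofReal_sum_of_nonneg fun k _ => hq0 _]
    exact ENNReal.ofReal_le_ofReal (hsum M)

/-- The maximal excess of a stationary path with independent entries, whose excess drifts to `-∞`
at rate at least `c`, is asymptotically dominated by `d / c` times the integrated tail. -/
theorem eventually_maxExcess_le [IsProbabilityMeasure P] (hX : Measurable X) {F : Measure ℝ} [IsProbabilityMeasure F]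
    (hF : IntegrableOn (tail F) (Ioi 0)) (hFpos : ∀ x, 0 < tail F x)
    (hFs : IsSubexponential (integratedTailLaw F)) {β c d : ℝ} (hβ : 0 ≤ β) (hc : 0 < c)
    (hd : 0 ≤ d) (hw : ∀ ω i, 0 ≤ (X ω i).1) (hw' : ∀ ω i, 0 ≤ (X ω i).2)
    (hind : ∀ k, IndepFun (fun ω => trunc k (X ω)) (fun ω => shift k (X ω)) P)
    (hshift : ∀ k, P.map (fun ω => shift k (X ω)) = P.map X)
    (hbdd : ∀ᵐ ω ∂P, BddAbove (range fun k : ℕ => excess β (X ω) k + k * c))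
    (hq : Tendsto (fun x => P.real {ω | x < (X ω 0).1} / tail F x) atTop (𝓝 d))
    {L : ℝ} (hL : d / c < L) :
    ∀ᶠ x in atTop, ∀ N, P.real {ω | ∃ k ≤ N, x < excess β (X ω) k} ≤
      L * tail (integratedTailLaw F) x := by
  obtain ⟨L', hL', hLL'⟩ := exists_between hL
  have hL'0 : 0 < L' := lt_of_le_of_lt (by positivity) hL'
  -- The mass `γ` of the exit law costs a factor `1 / (1 - γ)`, so it is fixed first; `K` is then
  -- taken large enough to achieve it.
  obtain ⟨γ, hγ0, hγ1, hγL⟩ : ∃ γ : ℝ, 0 < γ ∧ γ < 1 ∧ L' / (1 - γ) < L := by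
    have : Tendsto (fun γ : ℝ => L' / (1 - γ)) (𝓝[>] 0) (𝓝 (L' / (1 - 0))) := by
      refine Tendsto.mono_left (ContinuousAt.tendsto ?_) nhdsWithin_le_nhds
      exact continuousAt_const.div (by fun_prop) (by norm_num)
    have h2 : L' / (1 - 0) < L := by simpa using hLL'
    obtain ⟨γ, ⟨h3, h4⟩, h5⟩ := ((this.eventually_lt_const h2).and
      (nhdsWithin_le_nhds (Iio_mem_nhds one_pos)) |>.and self_mem_nhdsWithin).exists
    exact ⟨γ, h5, h4, h3⟩
  obtain ⟨K, hK, hKγ⟩ := exists_forall_le_of_bddAbove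
    (fun k => ((measurable_excess β k).comp hX).add_const _) hbdd hγ0
  have hqk : ∀ k x, P.real {ω | x < (X ω k).1} = P.real {ω | x < (X ω 0).1} := by
    intro k x
    have ms : MeasurableSet {w : ℕ → ℝ × ℝ | x < (w 0).1} :=
      measurableSet_lt measurable_const (measurable_fst.comp (measurable_pi_apply 0))
    have hS : Measurable fun ω => shift k (X ω) := (measurable_shift k).comp hX
    have h := congrArg (fun ν => ν {w : ℕ → ℝ × ℝ | x < (w 0).1}) (hshift k)
    simp only [Measure.map_apply hS ms, Measure.map_apply hX ms] at h
    exact congrArg ENNReal.toReal h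
  have hHle := exitLaw_univ_le (P := P) hX β K c
  have hfin : IsFiniteMeasure (exitLaw P X β K c) :=
    ⟨hHle.trans_lt (measure_lt_top _ _)⟩
  have hHγ : (exitLaw P X β K c).real univ ≤ γ :=
    (ENNReal.toReal_mono (measure_ne_top _ _) hHle).trans hKγ
  have hM : ∀ N, Measurable fun ω => maxExcess β N (X ω) := fun N =>
    (measurable_maxExcess β N).comp hX
  have hprob : ∀ N, IsProbabilityMeasure (P.map fun ω => maxExcess β N (X ω)) := fun N =>
    Measure.isProbabilityMeasure_map (hM N).aemeasurable
  have htail : ∀ N x, tail (P.map fun ω => maxExcess β N (X ω)) x =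
      P.real {ω | x < maxExcess β N (X ω)} := by
    intro N x
    rw [tail, map_measureReal_apply (hM N) measurableSet_Ioi]
    rfl
  have hH : ∀ᶠ x in atTop, tail (exitLaw P X β K c) x ≤ L' * tail (integratedTailLaw F) x := by
    filter_upwards [eventually_sum_le hF hFpos hFs hd hq hc hL' (K + β)] with x hx
    exact exitLaw_tail_le hX hβ hK hw hw' hqk (mul_nonneg hL'0.le (tail_nonneg _ _)) hx
  have key := renewal_bound hFs hγ0.le hγ1 hL'0.le hHγ hH
    (ρ := fun N => P.map fun ω => maxExcess β N (X ω))
    (by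
      intro x hx
      rw [htail]
      have : {ω | x < maxExcess β 0 (X ω)} = ∅ := by
        ext ω
        simp [lt_maxExcess, excess_zero, hx]
      rw [this, measureReal_empty])
    (K := K)
    (by
      intro N x hx
      rw [htail]
      exact ENNReal.toReal_mono (measure_ne_top _ _)
        (exitLaw_prod_ge hX hK hc.le hw hind hshift N hx))
    (sub_pos.2 hγL)
  filter_upwards [key] with x h N
  have h1 := h N
  rw [htail] at h1
  simp only [lt_maxExcess] at h1
  convert h1 using 2
  ring

end Excess

/-! ### Partial sums of independent identically distributed variables -/

section PartialSums

variable {Ω : Type*} [MeasurableSpace Ω] {P : Measure Ω}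

lemma ae_bddAbove_sum_sub {Y : ℕ → Ω → ℝ} (hint : Integrable (Y 0) P) (hind : iIndepFun Y P)
    (hid : ∀ i, IdentDistrib (Y i) (Y 0) P P) {m : ℝ} (hm : ∫ ω, Y 0 ω ∂P < m) :
    ∀ᵐ ω ∂P, BddAbove (range fun n : ℕ => ∑ i ∈ Finset.range n, Y i ω - n * m) := by
  filter_upwards [strong_law_ae_real Y hint (fun i j hij => hind.indepFun hij) hid] with ω hω
  refine IsBoundedUnder.bddAbove_range ⟨0, ?_⟩
  rw [eventually_map]
  filter_upwards [hω.eventually_lt_const hm, eventually_gt_atTop 0] with n hn hn0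
  rw [div_lt_iff₀ (Nat.cast_pos.2 hn0)] at hn
  linarith

lemma ae_bddAbove_sub_sum {Y : ℕ → Ω → ℝ} (hint : Integrable (Y 0) P) (hind : iIndepFun Y P)
    (hid : ∀ i, IdentDistrib (Y i) (Y 0) P P) {m : ℝ} (hm : m < ∫ ω, Y 0 ω ∂P) :
    ∀ᵐ ω ∂P, BddAbove (range fun n : ℕ => n * m - ∑ i ∈ Finset.range n, Y i ω) := by
  filter_upwards [strong_law_ae_real Y hint (fun i j hij => hind.indepFun hij) hid] with ω hω
  refine IsBoundedUnder.bddAbove_range ⟨0, ?_⟩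
  rw [eventually_map]
  filter_upwards [hω.eventually_const_lt hm, eventually_gt_atTop 0] with n hn hn0
  rw [lt_div_iff₀ (Nat.cast_pos.2 hn0)] at hn
  linarith

/-- By dominated convergence `E (1 - exp (-s Y)) / s` tends to `E Y`, while `(1 - exp (-s b)) / s`
tends to `b < E Y`. Nonnegativity of `Y` supplies the dominating function `Y`, so a finite mean
suffices. -/
lemma exists_mgf_neg_lt [IsProbabilityMeasure P] {Y : Ω → ℝ} (hY : Measurable Y)
    (h0 : ∀ ω, 0 ≤ Y ω) (hint : Integrable Y P) {b : ℝ} (hb : b < ∫ ω, Y ω ∂P) :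
    ∃ s : ℝ, 0 < s ∧ mgf Y P (-s) < Real.exp (-(s * b)) := by
  have hslope : ∀ y : ℝ, Tendsto (fun s : ℝ => (1 - Real.exp (-s * y)) / s) (𝓝[>] 0) (𝓝 y) := by
    intro y
    have h1 : HasDerivAt (fun s : ℝ => 1 - Real.exp (-s * y)) y 0 := by
      have : HasDerivAt (fun s : ℝ => -s * y) (-1 * y) 0 := (hasDerivAt_id 0).neg.mul_const y
      have := this.exp.const_sub 1
      simpa using this
    have h2 := h1.tendsto_slope_zero_right
    simpa [div_eq_inv_mul] using h2
  have hlim : Tendsto (fun s : ℝ => ∫ ω, (1 - Real.exp (-s * Y ω)) / s ∂P) (𝓝[>] 0)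
      (𝓝 (∫ ω, Y ω ∂P)) := by
    refine tendsto_integral_filter_of_dominated_convergence Y ?_ ?_ hint ?_
    · filter_upwards with s
      exact (by fun_prop : Measurable fun ω => (1 - Real.exp (-s * Y ω)) / s).aestronglyMeasurable
    · filter_upwards [self_mem_nhdsWithin] with s hs
      filter_upwards with ω
      have hs' : 0 < s := hs
      have hsy : 0 ≤ s * Y ω := mul_nonneg hs'.le (h0 ω)
      have h1 : Real.exp (-s * Y ω) ≤ 1 := Real.exp_le_one_iff.2 (by linarith)
      rw [Real.norm_of_nonneg (div_nonneg (by linarith) hs'.le), div_le_iff₀ hs']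
      have := Real.add_one_le_exp (-s * Y ω)
      linarith
    · filter_upwards with ω
      exact hslope (Y ω)
  obtain ⟨s, hs, hs0⟩ := (((hslope b).eventually_lt hlim hb).and self_mem_nhdsWithin).exists
  have hs0' : 0 < s := hs0
  refine ⟨s, hs0', ?_⟩
  have hexp : Integrable (fun ω => Real.exp (-s * Y ω)) P := by
    refine Integrable.of_bound (C := 1)
      (by fun_prop : Measurable fun ω => Real.exp (-s * Y ω)).aestronglyMeasurable ?_
    filter_upwards with ω
    rw [Real.norm_of_nonneg (Real.exp_pos _).le]
    exact Real.exp_le_one_iff.2 (by nlinarith [h0 ω])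
  rw [integral_div, integral_sub (integrable_const _) hexp, div_lt_div_iff_of_pos_right hs0'] at hs
  simp only [integral_const, probReal_univ, smul_eq_mul, mul_one] at hs
  rw [mgf, show -(s * b) = -s * b by ring]
  linarith

/-- Partial sums of nonnegative independent identically distributed variables fall below a line of
slope less than the mean with an exponentially small probability. -/
theorem exists_exp_bound [IsProbabilityMeasure P] {Y : ℕ → Ω → ℝ} (hY : ∀ i, Measurable (Y i))
    (h0 : ∀ i ω, 0 ≤ Y i ω) (hint : Integrable (Y 0) P) (hind : iIndepFun Y P)
    (hid : ∀ i, IdentDistrib (Y i) (Y 0) P P) {b : ℝ} (hb : b < ∫ ω, Y 0 ω ∂P) :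
    ∃ s C : ℝ, 0 < s ∧ 0 ≤ C ∧ ∀ z : ℝ,
      P.real {ω | ∃ n : ℕ, ∑ i ∈ Finset.range n, Y i ω < n * b - z} ≤ C * Real.exp (-(s * z)) := by
  obtain ⟨s, hs, hmgf⟩ := exists_mgf_neg_lt (hY 0) (h0 0) hint hb
  -- The Chernoff bound for the `n`-th partial sum is `exp (-(s z)) * r ^ n` with `r < 1`, and the
  -- geometric series bounds the union over `n`.
  set r := Real.exp (s * b) * mgf (Y 0) P (-s) with hr
  have hr0 : 0 ≤ r := mul_nonneg (Real.exp_pos _).le mgf_nonneg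
  have hr1 : r < 1 := by
    calc r < Real.exp (s * b) * Real.exp (-(s * b)) :=
          mul_lt_mul_of_pos_left hmgf (Real.exp_pos _)
      _ = 1 := by rw [← Real.exp_add]; simp
  refine ⟨s, (1 - r)⁻¹, hs, inv_nonneg.2 (by linarith), fun z => ?_⟩
  have hn : ∀ n : ℕ, P.real {ω | ∑ i ∈ Finset.range n, Y i ω < n * b - z} ≤
      Real.exp (-(s * z)) * r ^ n := by
    intro n
    have hS : Measurable fun ω => ∑ i ∈ Finset.range n, Y i ω :=
      Finset.measurable_sum _ fun i _ => hY i
    have hexp : Integrable (fun ω => Real.exp (-s * (∑ i ∈ Finset.range n, Y i) ω)) P := by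
      simp only [Finset.sum_apply]
      refine Integrable.of_bound (C := 1)
        (by fun_prop : Measurable fun ω =>
          Real.exp (-s * ∑ i ∈ Finset.range n, Y i ω)).aestronglyMeasurable ?_
      filter_upwards with ω
      rw [Real.norm_of_nonneg (Real.exp_pos _).le]
      have : 0 ≤ ∑ i ∈ Finset.range n, Y i ω := Finset.sum_nonneg fun i _ => h0 i ω
      exact Real.exp_le_one_iff.2 (by nlinarith)
    have h1 := measure_le_le_exp_mul_mgf (X := ∑ i ∈ Finset.range n, Y i) (μ := P)
      (n * b - z) (show -s ≤ 0 by linarith) hexp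
    rw [hind.mgf_sum hY] at h1
    have h2 : ∀ i ∈ Finset.range n, mgf (Y i) P (-s) = mgf (Y 0) P (-s) := fun i _ =>
      mgf_congr_identDistrib (hid i) |> fun h => congrFun h (-s)
    rw [Finset.prod_congr rfl h2, Finset.prod_const, Finset.card_range] at h1
    refine (measureReal_mono ?_).trans (h1.trans (le_of_eq ?_))
    · intro ω hω
      simp only [mem_ofPred_eq, Finset.sum_apply] at hω ⊢
      exact hω.le
    · rw [hr, mul_pow, ← Real.exp_nat_mul, ← mul_assoc, ← Real.exp_add]
      congr 2
      ring
  rw [Set.ofPred_exists, Measure.real]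
  refine ENNReal.toReal_le_of_le_ofReal
    (mul_nonneg (inv_nonneg.2 (by linarith)) (Real.exp_pos _).le) ((measure_iUnion_le _).trans ?_)
  refine ENNReal.tsum_le_of_sum_range_le fun M => ?_
  calc ∑ n ∈ Finset.range M, P {ω | ∑ i ∈ Finset.range n, Y i ω < n * b - z}
      ≤ ∑ n ∈ Finset.range M, ENNReal.ofReal (Real.exp (-(s * z)) * r ^ n) := by
        refine Finset.sum_le_sum fun n _ => ?_
        rw [← ofReal_measureReal]
        exact ENNReal.ofReal_le_ofReal (hn n)
    _ = ENNReal.ofReal (∑ n ∈ Finset.range M, Real.exp (-(s * z)) * r ^ n) :=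
        (ENNReal.ofReal_sum_of_nonneg fun n _ => by positivity).symm
    _ ≤ _ := by
        refine ENNReal.ofReal_le_ofReal ?_
        rw [← Finset.mul_sum, mul_comm]
        refine mul_le_mul_of_nonneg_right ?_ (Real.exp_pos _).le
        rw [← tsum_geometric_of_lt_one hr0 hr1]
        exact (summable_geometric_of_lt_one hr0 hr1).sum_le_tsum _ fun i _ => pow_nonneg hr0 i

end PartialSums

/-! ### Waiting times as maxima over paths -/

section Waiting

variable {σ₁ σ₂ τ : ℤ → ℝ}

/-- The departure time from station 1 of customer `s + k` in the network that starts empty with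
customer `s` arriving at time `0`. -/
def departure (σ₁ σ₂ τ : ℤ → ℝ) (s : ℤ) (k : ℕ) : ℝ :=
  ∑ i ∈ Finset.range k, τ (s + i) + (waiting σ₁ σ₂ τ s k).1 + σ₁ (s + k)

lemma departure_zero (s : ℤ) : departure σ₁ σ₂ τ s 0 = σ₁ s := by
  simp [departure, waiting]

lemma departure_succ (s : ℤ) (k : ℕ) : departure σ₁ σ₂ τ s (k + 1) =
    max (∑ i ∈ Finset.range (k + 1), τ (s + i)) (departure σ₁ σ₂ τ s k) +
      σ₁ (s + (k + 1 : ℕ)) := by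
  rw [departure, departure, waiting]
  simp only
  rw [← max_add_add_left]
  congr 2
  · simp
  · rw [Finset.sum_range_succ]
    ring

/-- The interarrival times at station 2 are differences of departure times from station 1, so queue
2 obeys a Lindley recursion whose sums telescope. -/
lemma waiting₂_succ (s : ℤ) (k : ℕ) : (waiting σ₁ σ₂ τ s (k + 1)).2 =
    max 0 ((waiting σ₁ σ₂ τ s k).2 + σ₂ (s + k) -
      (departure σ₁ σ₂ τ s (k + 1) - departure σ₁ σ₂ τ s k)) := by
  rw [waiting]
  simp only
  congr 2
  rw [interarrival₂, departure_succ, departure, Finset.sum_range_succ]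
  have e : s + ((k + 1 : ℕ) : ℤ) = s + k + 1 := by push_cast; ring
  rw [e]
  have := max_add_add_left (∑ i ∈ Finset.range k, τ (s + i) + τ (s + k)) 0
    ((waiting σ₁ σ₂ τ s k).1 + σ₁ (s + k) - τ (s + k))
  have h2 := min_add_max 0 ((waiting σ₁ σ₂ τ s k).1 + σ₁ (s + k) - τ (s + k))
  rw [add_zero, show ∑ i ∈ Finset.range k, τ (s + i) + τ (s + k) +
    ((waiting σ₁ σ₂ τ s k).1 + σ₁ (s + k) - τ (s + k)) =
    ∑ i ∈ Finset.range k, τ (s + i) + (waiting σ₁ σ₂ τ s k).1 + σ₁ (s + k) by ring] at this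
  rw [this]
  linarith

/-- Unfolding the maximum in the recursion: `j` is the customer who opens the busy period of station
1 containing customer `s + k`. -/
lemma exists_departure_eq (s : ℤ) (k : ℕ) : ∃ j ≤ k, departure σ₁ σ₂ τ s k =
    ∑ i ∈ Finset.range j, τ (s + i) + ∑ i ∈ Finset.Ico j (k + 1), σ₁ (s + i) := by
  induction k with
  | zero => exact ⟨0, le_rfl, by simp [departure_zero]⟩
  | succ k ih =>
    obtain ⟨j, hj, h⟩ := ih
    rw [departure_succ]
    rcases le_total (∑ i ∈ Finset.range (k + 1), τ (s + i)) (departure σ₁ σ₂ τ s k) with h1 | h1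
    · refine ⟨j, by omega, ?_⟩
      rw [max_eq_right h1, h, Finset.sum_Ico_succ_top (by omega : j ≤ k + 1), add_assoc]
    · refine ⟨k + 1, le_rfl, ?_⟩
      rw [max_eq_left h1]
      simp

lemma departure_add_le (s : ℤ) {l k : ℕ} (h : l ≤ k) :
    departure σ₁ σ₂ τ s l + ∑ i ∈ Finset.Ico (l + 1) (k + 1), σ₁ (s + i) ≤
      departure σ₁ σ₂ τ s k := by
  induction k, h using Nat.le_induction with
  | base => simp
  | succ k hk ih =>
    rw [departure_succ, Finset.sum_Ico_succ_top (by omega : l + 1 ≤ k + 1), ← add_assoc]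
    exact add_le_add (ih.trans (le_max_right _ _)) le_rfl

lemma waiting₁_nonneg (s : ℤ) (k : ℕ) : 0 ≤ (waiting σ₁ σ₂ τ s k).1 := by
  cases k with
  | zero => exact le_rfl
  | succ k => exact le_max_left _ _

lemma exists_waiting₂_eq (s : ℤ) (k : ℕ) : ∃ l ≤ k, (waiting σ₁ σ₂ τ s k).2 =
    ∑ i ∈ Finset.Ico l k, σ₂ (s + i) -
      (departure σ₁ σ₂ τ s k - departure σ₁ σ₂ τ s l) := by
  induction k with
  | zero => exact ⟨0, le_rfl, by simp [waiting]⟩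
  | succ k ih =>
    obtain ⟨l, hl, h⟩ := ih
    rw [waiting₂_succ]
    rcases le_total 0 ((waiting σ₁ σ₂ τ s k).2 + σ₂ (s + k) -
      (departure σ₁ σ₂ τ s (k + 1) - departure σ₁ σ₂ τ s k)) with h1 | h1
    · refine ⟨l, by omega, ?_⟩
      rw [max_eq_right h1, h, Finset.sum_Ico_succ_top hl]
      ring
    · refine ⟨k + 1, le_rfl, ?_⟩
      rw [max_eq_left h1]
      simp

lemma le_waiting₂ (s : ℤ) {l k : ℕ} (h : l ≤ k) : ∑ i ∈ Finset.Ico l k, σ₂ (s + i) -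
    (departure σ₁ σ₂ τ s k - departure σ₁ σ₂ τ s l) ≤ (waiting σ₁ σ₂ τ s k).2 := by
  induction k, h using Nat.le_induction with
  | base =>
    simp only [Finset.Ico_self, Finset.sum_empty, sub_self]
    cases l with
    | zero => exact le_rfl
    | succ l => exact le_max_left _ _
  | succ k hk ih =>
    rw [waiting₂_succ, Finset.sum_Ico_succ_top hk]
    exact le_trans (by linarith) (le_max_right _ _)

lemma sum_Ico_reverse (f : ℤ → ℝ) {m j l : ℕ} (hl : l ≤ m) :
    ∑ i ∈ Finset.Ico j l, f (-(m : ℤ) + i) =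
      ∑ r ∈ Finset.Ico (m - l) (m - j), f (-((r : ℤ) + 1)) := by
  cases m with
  | zero =>
    obtain rfl : l = 0 := by omega
    simp
  | succ m =>
    rw [← Finset.sum_Ico_reflect (fun r : ℕ => f (-((r : ℤ) + 1))) j hl]
    refine Finset.sum_congr rfl fun i hi => ?_
    have := (Finset.mem_Ico.1 hi).2
    congr 1
    push_cast [Nat.cast_sub (show i ≤ m by omega)]
    ring

/-- If customer `0` has to wait for more than `x` in queue 2, then there are an earlier customer
from whom on station 2 has been busy, and an even earlier one from whom on station 1 had been
busy until then. -/
theorem exists_of_lt_waiting₂ (h1 : ∀ n, 0 ≤ σ₁ n) {m : ℕ} {x : ℝ} (hx : 0 ≤ x)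
    (h : x < (waiting σ₁ σ₂ τ (-m) m).2) :
    ∃ k < m, ∃ n ≤ k,
      x < ∑ r ∈ Finset.range (n + 1), σ₂ (-((r : ℤ) + 1)) -
        ∑ r ∈ Finset.range n, σ₁ (-((r : ℤ) + 1)) ∧
      x < ∑ r ∈ Finset.range (n + 1), σ₂ (-((r : ℤ) + 1)) +
        ∑ r ∈ Finset.Ico n (k + 1), σ₁ (-((r : ℤ) + 1)) -
        ∑ r ∈ Finset.range (k + 1), τ (-((r : ℤ) + 1)) := by
  obtain ⟨l, hl, hw⟩ := exists_waiting₂_eq (σ₁ := σ₁) (σ₂ := σ₂) (τ := τ) (-m) m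
  rw [hw] at h
  have hlm : l < m := by
    refine lt_of_le_of_ne hl ?_
    rintro rfl
    simp at h
    linarith
  obtain ⟨j, hj, hd⟩ := exists_departure_eq (σ₁ := σ₁) (σ₂ := σ₂) (τ := τ) (-m) l
  -- Two lower bounds for the departure of customer `0` from station 1. Counting the services after
  -- customer `l` gives the first inequality; counting only the arrivals, with the exact formula for
  -- the departure of `l`, gives the second.
  have hdl := departure_add_le (σ₁ := σ₁) (σ₂ := σ₂) (τ := τ) (-m) hl
  have hdm : ∑ i ∈ Finset.range m, τ (-m + i) ≤ departure σ₁ σ₂ τ (-m) m := by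
    have := waiting₁_nonneg (σ₁ := σ₁) (σ₂ := σ₂) (τ := τ) (-m) m
    have := h1 (-m + m)
    rw [departure]
    linarith
  have e2 : ∑ i ∈ Finset.Ico l m, σ₂ (-m + i) =
      ∑ r ∈ Finset.range (m - 1 - l + 1), σ₂ (-((r : ℤ) + 1)) := by
    rw [sum_Ico_reverse σ₂ le_rfl, Finset.range_eq_Ico]
    congr 2 <;> omega
  have e1 : ∑ r ∈ Finset.range (m - 1 - l), σ₁ (-((r : ℤ) + 1)) ≤
      ∑ i ∈ Finset.Ico (l + 1) (m + 1), σ₁ (-m + i) := by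
    rw [Finset.sum_Ico_succ_top (by omega), sum_Ico_reverse σ₁ le_rfl, Finset.range_eq_Ico]
    have : Finset.Ico 0 (m - 1 - l) = Finset.Ico (m - m) (m - (l + 1)) := by congr 1 <;> omega
    rw [this]
    linarith [h1 (-m + m)]
  have e3 : ∑ i ∈ Finset.Ico j (l + 1), σ₁ (-m + i) =
      ∑ r ∈ Finset.Ico (m - 1 - l) (m - 1 - j + 1), σ₁ (-((r : ℤ) + 1)) := by
    rw [sum_Ico_reverse σ₁ (by omega)]
    congr 2 <;> omega
  have e4 : ∑ i ∈ Finset.range m, τ (-m + i) - ∑ i ∈ Finset.range j, τ (-m + i) =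
      ∑ r ∈ Finset.range (m - 1 - j + 1), τ (-((r : ℤ) + 1)) := by
    rw [← Finset.sum_Ico_eq_sub (fun i : ℕ => τ (-m + i)) (show j ≤ m by omega),
      sum_Ico_reverse τ le_rfl, Finset.range_eq_Ico]
    congr 2 <;> omega
  refine ⟨m - 1 - j, by omega, m - 1 - l, by omega, ?_, ?_⟩
  · rw [← e2]
    linarith
  · rw [← e2, ← e3, ← e4]
    linarith

/-- A lower bound for the waiting time of customer `0` in queue 2, when customer `-(n + 1)` is the
first one. -/
theorem lt_waiting₂ {n : ℕ} {x : ℝ}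
    (h1 : x < ∑ r ∈ Finset.range (n + 1), σ₂ (-((r : ℤ) + 1)) - σ₁ 0 -
      ∑ r ∈ Finset.range n, σ₁ (-((r : ℤ) + 1)))
    (h2 : ∀ j ≤ n, x < ∑ r ∈ Finset.range (n + 1), σ₂ (-((r : ℤ) + 1)) + σ₁ (-((n : ℤ) + 1)) -
      ∑ r ∈ Finset.range (n + 1), τ (-((r : ℤ) + 1)) -
      (σ₁ 0 + ∑ r ∈ Finset.range j, σ₁ (-((r : ℤ) + 1)) -
        ∑ r ∈ Finset.range j, τ (-((r : ℤ) + 1)))) :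
    x < (waiting σ₁ σ₂ τ (-(n + 1 : ℕ)) (n + 1)).2 := by
  have hw := le_waiting₂ (σ₁ := σ₁) (σ₂ := σ₂) (τ := τ) (-((n + 1 : ℕ) : ℤ)) (Nat.zero_le (n + 1))
  refine lt_of_lt_of_le ?_ hw
  obtain ⟨j, hj, hd⟩ := exists_departure_eq (σ₁ := σ₁) (σ₂ := σ₂) (τ := τ)
    (-((n + 1 : ℕ) : ℤ)) (n + 1)
  rw [hd, departure_zero, sum_Ico_reverse σ₂ le_rfl, Finset.sum_Ico_succ_top hj,
    sum_Ico_reverse σ₁ le_rfl, Finset.range_eq_Ico, sum_Ico_reverse τ hj]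
  simp only [Nat.sub_self, Nat.sub_zero, ← Finset.range_eq_Ico, neg_add_cancel]
  have e0 : (-((n + 1 : ℕ) : ℤ)) = -((n : ℤ) + 1) := by push_cast; ring
  rw [e0]
  -- If station 1 has been busy since the first customer, that customer's service cancels and `h1`
  -- applies. Otherwise a later customer opens the busy period, which is the case of `h2`.
  rcases Nat.eq_zero_or_pos j with rfl | hj0
  · simp only [Nat.sub_zero, Finset.Ico_self, Finset.sum_empty]
    rw [Finset.sum_range_succ (fun r : ℕ => σ₁ (-((r : ℤ) + 1)))]
    linarith
  · have h3 := h2 (n + 1 - j) (by omega)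
    rw [Finset.sum_Ico_eq_sub (fun r : ℕ => τ (-((r : ℤ) + 1))) (show n + 1 - j ≤ n + 1 by omega)]
    linarith

end Waiting

/-! ### Independence of functions of disjoint sets of variables -/

section Independence

variable {Ω ι : Type*}

/-- The σ-algebra generated by the variables `Y i` with `i ∈ S`. -/
abbrev sigmaOf (Y : ι → Ω → ℝ) (S : Set ι) : MeasurableSpace Ω :=
  ⨆ i ∈ S, MeasurableSpace.comap (Y i) inferInstance

lemma measurable_sigmaOf {Y : ι → Ω → ℝ} {S : Set ι} {i : ι} (hi : i ∈ S) :
    Measurable[sigmaOf Y S] (Y i) :=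
  (comap_measurable (Y i)).mono (le_iSup₂_of_le i hi le_rfl) le_rfl

variable {u t : ℕ → Ω → ℝ}

/-- The path of the pairs `(u r, t r)`. -/
def pairPath (u t : ℕ → Ω → ℝ) (ω : Ω) : ℕ → ℝ × ℝ := fun r => (u r ω, t r ω)

lemma measurable_pairPath {m : MeasurableSpace Ω} (hu : ∀ r, Measurable (u r))
    (ht : ∀ r, Measurable (t r)) : Measurable (pairPath u t) :=
  measurable_pi_lambda _ fun r => (hu r).prodMk (ht r)

lemma measurable_trunc_pairPath {m : MeasurableSpace Ω} {k : ℕ}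
    (hu : ∀ r < k, Measurable (u r)) (ht : ∀ r < k, Measurable (t r)) :
    Measurable fun ω => trunc k (pairPath u t ω) := by
  refine measurable_pi_lambda _ fun r => ?_
  by_cases h : r < k
  · simpa [trunc, pairPath, h] using (hu r h).prodMk (ht r h)
  · simp [trunc, h]

lemma measurable_shift_pairPath {m : MeasurableSpace Ω} {k : ℕ}
    (hu : ∀ r, k ≤ r → Measurable (u r)) (ht : ∀ r, k ≤ r → Measurable (t r)) :
    Measurable fun ω => shift k (pairPath u t ω) :=
  measurable_pi_lambda _ fun r => (hu _ (Nat.le_add_right k r)).prodMk (ht _ (Nat.le_add_right k r))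

variable [MeasurableSpace Ω] {P : Measure Ω}

lemma indepFun_of_disjoint {Y : ι → Ω → ℝ} (hY : ∀ i, Measurable (Y i)) (hind : iIndepFun Y P)
    {S T : Set ι} (hST : Disjoint S T) {E E' : Type*} [mE : MeasurableSpace E]
    [mE' : MeasurableSpace E'] {f : Ω → E} {g : Ω → E'} (hf : Measurable[sigmaOf Y S] f)
    (hg : Measurable[sigmaOf Y T] g) : IndepFun f g P := by
  have h := indep_iSup_of_disjoint (fun i => (hY i).comap_le) hind.iIndep hST
  rw [IndepFun_iff_Indep]
  exact indep_of_indep_of_le_left (indep_of_indep_of_le_right h hg.comap_le) hf.comap_le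

lemma indepSet_of_disjoint {Y : ι → Ω → ℝ} (hY : ∀ i, Measurable (Y i)) (hind : iIndepFun Y P)
    {S T : Set ι} (hST : Disjoint S T) {A B : Set Ω} (hA : MeasurableSet[sigmaOf Y S] A)
    (hB : MeasurableSet[sigmaOf Y T] B) : P.real (A ∩ B) = P.real A * P.real B := by
  have h := indep_iSup_of_disjoint (fun i => (hY i).comap_le) hind.iIndep hST
  have := (Indep_iff _ _ _).1 h A B hA hB
  rw [Measure.real, this, ENNReal.toReal_mul]
  rfl

lemma sigmaOf_le {Y : ι → Ω → ℝ} (hY : ∀ i, Measurable (Y i)) (S : Set ι) :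
    sigmaOf Y S ≤ ‹MeasurableSpace Ω› :=
  iSup₂_le fun i _ => (hY i).comap_le

lemma map_precomp_eq [IsProbabilityMeasure P] {κ : Type*} {Y : ι → Ω → ℝ}
    (hY : ∀ i, Measurable (Y i)) (hind : iIndepFun Y P) {e e' : κ → ι}
    (he : Function.Injective e) (he' : Function.Injective e')
    (hid : ∀ k, IdentDistrib (Y (e k)) (Y (e' k)) P P) :
    P.map (fun ω k => Y (e k) ω) = P.map (fun ω k => Y (e' k) ω) := by
  rw [(hind.precomp he).map_fun_eq_infinitePi_map fun k => hY (e k),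
    (hind.precomp he').map_fun_eq_infinitePi_map fun k => hY (e' k)]
  congr 1
  ext1 k
  exact (hid k).map_eq

lemma indepFun_trunc_shift (hu : ∀ r, Measurable (u r)) (ht : ∀ r, Measurable (t r))
    (hind : iIndepFun (Sum.elim u t) P) (k : ℕ) :
    IndepFun (fun ω => trunc k (pairPath u t ω)) (fun ω => shift k (pairPath u t ω)) P := by
  refine indepFun_of_disjoint (Y := Sum.elim u t) (fun i => by cases i <;> simp [hu, ht]) hind
    (S := {i | Sum.elim id id i < k}) (T := {i | k ≤ Sum.elim id id i}) ?_
    (measurable_trunc_pairPath ?_ ?_) (measurable_shift_pairPath ?_ ?_)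
  · rw [Set.disjoint_left]
    intro i h1 h2
    exact absurd (show _ < k from h1) (not_lt.2 h2)
  · exact fun r hr => measurable_sigmaOf (Y := Sum.elim u t) (i := Sum.inl r) hr
  · exact fun r hr => measurable_sigmaOf (Y := Sum.elim u t) (i := Sum.inr r) hr
  · exact fun r hr => measurable_sigmaOf (Y := Sum.elim u t) (i := Sum.inl r) hr
  · exact fun r hr => measurable_sigmaOf (Y := Sum.elim u t) (i := Sum.inr r) hr

lemma map_shift_pairPath [IsProbabilityMeasure P] (hu : ∀ r, Measurable (u r)) (ht : ∀ r, Measurable (t r))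
    (hind : iIndepFun (Sum.elim u t) P) (huid : ∀ r, IdentDistrib (u r) (u 0) P P)
    (htid : ∀ r, IdentDistrib (t r) (t 0) P P) (k : ℕ) :
    P.map (fun ω => shift k (pairPath u t ω)) = P.map (pairPath u t) := by
  have hY : ∀ i, Measurable (Sum.elim u t i) := fun i => by cases i <;> simp [hu, ht]
  have h := map_precomp_eq hY hind (e := Sum.map (k + ·) (k + ·)) (e' := id)
    ((add_right_injective k).sumMap (add_right_injective k)) Function.injective_id
    (by
      rintro (r | r)
      · exact (huid (k + r)).trans (huid r).symm
      · exact (htid (k + r)).trans (htid r).symm)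
  have hφ : Measurable fun (y : ℕ ⊕ ℕ → ℝ) (r : ℕ) => (y (Sum.inl r), y (Sum.inr r)) := by
    fun_prop
  have h1 := congrArg (Measure.map fun (y : ℕ ⊕ ℕ → ℝ) (r : ℕ) => (y (Sum.inl r), y (Sum.inr r))) h
  rw [Measure.map_map hφ (measurable_pi_lambda _ fun i => hY _),
    Measure.map_map hφ (measurable_pi_lambda _ fun i => hY _)] at h1
  exact h1

lemma indepFun_trunc_shift_const (hu : ∀ r, Measurable (u r)) (hind : iIndepFun u P) (c : ℝ)
    (k : ℕ) : IndepFun (fun ω => trunc k (pairPath u (fun _ _ => c) ω))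
      (fun ω => shift k (pairPath u (fun _ _ => c) ω)) P := by
  refine indepFun_of_disjoint hu hind (S := {i | i < k}) (T := {i | k ≤ i}) ?_
    (measurable_trunc_pairPath ?_ ?_) (measurable_shift_pairPath ?_ ?_)
  · rw [Set.disjoint_left]
    intro i h1 h2
    exact absurd (show _ < k from h1) (not_lt.2 h2)
  · exact fun r hr => measurable_sigmaOf hr
  · exact fun r hr => measurable_const
  · exact fun r hr => measurable_sigmaOf hr
  · exact fun r hr => measurable_const

lemma map_shift_pairPath_const [IsProbabilityMeasure P] (hu : ∀ r, Measurable (u r)) (hind : iIndepFun u P)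
    (huid : ∀ r, IdentDistrib (u r) (u 0) P P) (c : ℝ) (k : ℕ) :
    P.map (fun ω => shift k (pairPath u (fun _ _ => c) ω)) =
      P.map (pairPath u (fun _ _ => c)) := by
  have h := map_precomp_eq hu hind (e := (k + ·)) (e' := id) (add_right_injective k)
    Function.injective_id fun r => (huid (k + r)).trans (huid r).symm
  have hφ : Measurable fun (y : ℕ → ℝ) (r : ℕ) => (y r, c) := by fun_prop
  have h1 := congrArg (Measure.map fun (y : ℕ → ℝ) (r : ℕ) => (y r, c)) h
  rw [Measure.map_map hφ (measurable_pi_lambda _ fun i => hu _),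
    Measure.map_map hφ (measurable_pi_lambda _ fun i => hu _)] at h1
  exact h1

end Independence

/-! ### The upper bound -/

section Upper

variable {Ω : Type*} [MeasurableSpace Ω]

/-- The driving sequences of a tandem queue, numbered backwards in time: independent sequences of
independent identically distributed nonnegative service times `u`, `v` and interarrival times `t`
with the means `b₁`, `b₂` and `a`. -/
structure TandemInput (P : Measure Ω) (u v t : ℕ → Ω → ℝ) (b₁ b₂ a : ℝ) : Prop where
  meas_u : ∀ r, Measurable (u r)
  meas_v : ∀ r, Measurable (v r)
  meas_t : ∀ r, Measurable (t r)
  nonneg_u : ∀ r ω, 0 ≤ u r ω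
  nonneg_v : ∀ r ω, 0 ≤ v r ω
  nonneg_t : ∀ r ω, 0 ≤ t r ω
  indep : iIndepFun (Sum.elim u (Sum.elim v t)) P
  ident_u : ∀ r, IdentDistrib (u r) (u 0) P P
  ident_v : ∀ r, IdentDistrib (v r) (v 0) P P
  ident_t : ∀ r, IdentDistrib (t r) (t 0) P P
  int_u : Integrable (u 0) P
  int_v : Integrable (v 0) P
  int_t : Integrable (t 0) P
  mean_u : ∫ ω, u 0 ω ∂P = b₁
  mean_v : ∫ ω, v 0 ω ∂P = b₂
  mean_t : ∫ ω, t 0 ω ∂P = a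

namespace TandemInput

variable {P : Measure Ω} {u v t : ℕ → Ω → ℝ} {b₁ b₂ a : ℝ}

lemma meas (I : TandemInput P u v t b₁ b₂ a) (i : ℕ ⊕ ℕ ⊕ ℕ) :
    Measurable (Sum.elim u (Sum.elim v t) i) := by
  rcases i with r | r | r
  · exact I.meas_u r
  · exact I.meas_v r
  · exact I.meas_t r

lemma indep_u (I : TandemInput P u v t b₁ b₂ a) : iIndepFun u P :=
  I.indep.precomp (g := Sum.inl) Sum.inl_injective

lemma indep_v (I : TandemInput P u v t b₁ b₂ a) : iIndepFun v P :=
  I.indep.precomp (g := fun r => Sum.inr (Sum.inl r))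
    (Sum.inr_injective.comp Sum.inl_injective)

lemma indep_t (I : TandemInput P u v t b₁ b₂ a) : iIndepFun t P :=
  I.indep.precomp (g := fun r => Sum.inr (Sum.inr r))
    (Sum.inr_injective.comp Sum.inr_injective)

lemma indep_ut (I : TandemInput P u v t b₁ b₂ a) : iIndepFun (Sum.elim u t) P := by
  have h := I.indep.precomp (g := Sum.map id Sum.inr)
    (Function.injective_id.sumMap Sum.inr_injective)
  convert h using 1
  ext (r | r) <;> rfl

lemma b₁_nonneg (I : TandemInput P u v t b₁ b₂ a) : 0 ≤ b₁ :=
  I.mean_u ▸ integral_nonneg (I.nonneg_u 0)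

lemma b₂_nonneg (I : TandemInput P u v t b₁ b₂ a) : 0 ≤ b₂ :=
  I.mean_v ▸ integral_nonneg (I.nonneg_v 0)

/-- By the law of large numbers the last-passage time grows like the maximum of `n β + (k - n) b₁`
over `n ≤ k`, which is `k β` because `b₁ ≤ β`, while the interarrival times add up to about `k a`.
-/
lemma ae_bddAbove_excess (I : TandemInput P u v t b₁ b₂ a) {β c : ℝ} (hβ : b₁ ≤ β)
    (hc : β + c < a) :
    ∀ᵐ ω ∂P, BddAbove (range fun k : ℕ => excess β (pairPath u t ω) k + k * c) := by
  obtain ⟨e, he, hec⟩ : ∃ e, 0 < e ∧ 3 * e ≤ a - β - c := ⟨(a - β - c) / 3, by linarith, by linarith⟩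
  filter_upwards [ae_bddAbove_sum_sub I.int_u I.indep_u I.ident_u
      (show _ < b₁ + e by rw [I.mean_u]; linarith),
    ae_bddAbove_sub_sum I.int_u I.indep_u I.ident_u
      (show b₁ - e < _ by rw [I.mean_u]; linarith),
    ae_bddAbove_sub_sum I.int_t I.indep_t I.ident_t
      (show a - e < _ by rw [I.mean_t]; linarith)] with ω ⟨B₁, h1⟩ ⟨B₂, h2⟩ ⟨B₃, h3⟩
  refine ⟨β + B₁ + B₂ + B₃, ?_⟩
  rintro _ ⟨k, rfl⟩
  obtain ⟨n, hn, hlpp⟩ := exists_lpp_le (w := pairPath u t ω) (I.b₁_nonneg.trans hβ) k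
  have h1' := h1 ⟨k, rfl⟩
  have h2' := h2 ⟨n, rfl⟩
  have h3' := h3 ⟨k, rfl⟩
  rw [Finset.sum_Ico_eq_sub _ hn] at hlpp
  simp only [pairPath] at h1' h2' h3' hlpp
  simp only [excess, pairPath]
  have hnk : (n : ℝ) ≤ k := Nat.cast_le.2 hn
  have e1 : (n : ℝ) * (β - b₁ + e) ≤ k * (β - b₁ + e) :=
    mul_le_mul_of_nonneg_right hnk (by linarith)
  have e2 : (k : ℝ) * (3 * e) ≤ k * (a - β - c) :=
    mul_le_mul_of_nonneg_left hec k.cast_nonneg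
  push_cast at hlpp
  linarith

end TandemInput

/-- At slope `0` the excess is an ordinary random walk, so `eventually_maxExcess_le` also serves
station 2, with a constant second coordinate. -/
lemma excess_zero_slope {w : ℕ → ℝ × ℝ} (hw : ∀ i, 0 ≤ (w i).1) (k : ℕ) :
    excess 0 w k = ∑ i ∈ Finset.range k, (w i).1 - ∑ i ∈ Finset.range k, (w i).2 := by
  rw [excess]
  congr 1
  induction k with
  | zero => simp [lpp]
  | succ k ih =>
    have h := le_lpp (β := 0) hw k
    rw [lpp, Finset.sum_range_succ, ih.symm, mul_zero, max_eq_left (by simpa using h)]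

lemma exists_rate {d r L : ℝ} (hd : 0 ≤ d) (hr : 0 < r) (hL : d / r < L) :
    ∃ c, 0 < c ∧ c < r ∧ d / c < L := by
  have hL0 : 0 < L := lt_of_le_of_lt (by positivity) hL
  have h : d / L < r := by
    rw [div_lt_iff₀ hr] at hL
    rw [div_lt_iff₀ hL0]
    linarith
  obtain ⟨c, h1, h2⟩ := exists_between h
  have hc : 0 < c := lt_of_le_of_lt (by positivity) h1
  refine ⟨c, hc, h2, ?_⟩
  rw [div_lt_iff₀ hL0] at h1
  rw [div_lt_iff₀ hc]
  linarith

lemma measurableSet_exists_lt {E : Type*} {m : MeasurableSpace E} {f : ℕ → E → ℝ}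
    (hf : ∀ k, Measurable[m] (f k)) (K : ℝ) : MeasurableSet[m] {ω | ∃ k, K < f k ω} := by
  rw [Set.ofPred_exists]
  exact MeasurableSet.iUnion fun k => measurableSet_lt measurable_const (hf k)

variable {P : Measure Ω} [IsProbabilityMeasure P]

lemma eventually_exp_bound_le {μ : Measure ℝ} (hμ : IsSubexponential μ) {Y : ℕ → Ω → ℝ}
    (hY : ∀ i, Measurable (Y i)) (h0 : ∀ i ω, 0 ≤ Y i ω) (hint : Integrable (Y 0) P)
    (hind : iIndepFun Y P) (hid : ∀ i, IdentDistrib (Y i) (Y 0) P P) {b : ℝ}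
    (hb : b < ∫ ω, Y 0 ω ∂P) {ε δ : ℝ} (hε : 0 < ε) (hδ : 0 < δ) :
    ∀ᶠ y in atTop, P.real {ω | ∃ n : ℕ, ∑ i ∈ Finset.range n, Y i ω < n * b - ε * y} ≤
      δ * tail μ y := by
  obtain ⟨s, C, hs, hC, h⟩ := exists_exp_bound hY h0 hint hind hid hb
  filter_upwards [hμ.eventually_exp_le (mul_pos hs hε) (show 0 < δ / (C + 1) by positivity)]
    with y hy
  have hG := hμ.tail_pos y
  calc _ ≤ C * Real.exp (-(s * (ε * y))) := h (ε * y)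
    _ ≤ (C + 1) * (δ / (C + 1) * tail μ y) := by
        rw [← mul_assoc]
        exact mul_le_mul (by linarith) hy (Real.exp_pos _).le (by linarith)
    _ = _ := by field_simp

variable {u v t : ℕ → Ω → ℝ} {b₁ b₂ a : ℝ}
  {F : Measure ℝ} [IsProbabilityMeasure F]

/-- The event that customer `0` waits for more than `y` in queue 2, if the service times in station
2 are all equal to `β` and the first customer is `-m`. -/
def fluidEvent (u t : ℕ → Ω → ℝ) (β : ℝ) (m : ℕ) (y : ℝ) : Set Ω :=
  {ω | ∃ k < m, ∃ n ≤ k,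
    y < ((n + 1 : ℕ) : ℝ) * β - ∑ r ∈ Finset.range n, u r ω ∧
    y < ((n + 1 : ℕ) : ℝ) * β + ∑ r ∈ Finset.Ico n (k + 1), u r ω -
      ∑ r ∈ Finset.range (k + 1), t r ω}

/-- The event that the waiting time of customer `0` in queue 2 can exceed `x` when the first
customer is `-m`. -/
def delayEvent (u v t : ℕ → Ω → ℝ) (m : ℕ) (x : ℝ) : Set Ω :=
  {ω | ∃ k < m, ∃ n ≤ k,
    x < ∑ r ∈ Finset.range (n + 1), v r ω - ∑ r ∈ Finset.range n, u r ω ∧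
    x < ∑ r ∈ Finset.range (n + 1), v r ω + ∑ r ∈ Finset.Ico n (k + 1), u r ω -
      ∑ r ∈ Finset.range (k + 1), t r ω}

/-- If `U_n` is not exceptionally small, the first condition forces `n` to be at least about `y / (β
- b₁)`. The first `N` interarrival times, for such an `N`, take about `N a`, so the path without its
first `N` entries needs an excess of about `y + N (a - β)`, roughly `y (a - b₁) / (β - b₁)`. The
exceptions have exponentially small probability. -/
lemma eventually_fluidEvent_le (I : TandemInput P u v t b₁ b₂ a)
    (hF : IntegrableOn (tail F) (Ioi 0)) (hFpos : ∀ x, 0 < tail F x)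
    (hFs : IsSubexponential (integratedTailLaw F)) {d : ℝ} (hd : 0 ≤ d)
    (hq : Tendsto (fun x => P.real {ω | x < u 0 ω} / tail F x) atTop (𝓝 d))
    {β ε : ℝ} (hε : 0 < ε) (hε1 : ε < 1) (hβ : b₁ < β) (hβa : β + ε < a) {L c δ : ℝ}
    (hL : d / (a - β) < L) (hc : c < (1 - ε) * (a - b₁) / (β - b₁ + ε))
    (hδ : 0 < δ) :
    ∀ᶠ y in atTop, ∀ m, P.real (fluidEvent u t β m y) ≤
      L * tail (integratedTailLaw F) (c * y) + δ * tail (integratedTailLaw F) y := by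
  have := hFs.isProbabilityMeasure
  have hβ0 : 0 ≤ β := I.b₁_nonneg.trans hβ.le
  have hL0 : 0 < L := lt_of_le_of_lt (div_nonneg hd (by linarith)) hL
  obtain ⟨r, hr0, hr, hdr⟩ := exists_rate hd (show 0 < a - β by linarith) hL
  have hX := measurable_pairPath I.meas_u I.meas_t
  obtain ⟨z₀, hz₀⟩ := eventually_atTop.1 (eventually_maxExcess_le hX hF hFpos hFs hβ0 hr0 hd
    (fun ω i => I.nonneg_u i ω) (fun ω i => I.nonneg_t i ω)
    (indepFun_trunc_shift I.meas_u I.meas_t I.indep_ut)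
    (map_shift_pairPath I.meas_u I.meas_t I.indep_ut I.ident_u I.ident_t)
    (I.ae_bddAbove_excess hβ.le (by linarith)) hq hdr)
  set κ := β - b₁ + ε with hκ
  have hκ0 : 0 < κ := by linarith
  set l := a - ε - β with hl
  have hl0 : 0 < l := by linarith
  have hslope : Tendsto (fun y : ℝ => ((1 - ε) * (a - b₁) / κ - c) * y) atTop atTop :=
    tendsto_id.const_mul_atTop (by linarith)
  have hslope' : Tendsto (fun y : ℝ => (1 - ε) * y) atTop atTop :=
    tendsto_id.const_mul_atTop (by linarith)
  filter_upwards [hslope.eventually_ge_atTop ((β / κ + 1) * l),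
    hslope'.eventually_ge_atTop z₀,
    eventually_exp_bound_le hFs I.meas_u I.nonneg_u I.int_u I.indep_u I.ident_u
      (show b₁ - ε < _ by rw [I.mean_u]; linarith) hε (half_pos hδ),
    eventually_exp_bound_le hFs I.meas_t I.nonneg_t I.int_t I.indep_t I.ident_t
      (show a - ε < _ by rw [I.mean_t]; linarith) hε (half_pos hδ)] with y h1 h2 h3 h4 m
  -- Outside the exceptional events every admissible `n` satisfies `q < n`, and `z` is the excess
  -- then required of the shifted path. The threshold `(β / κ + 1) * l` above absorbs the `β` in `q`
  -- and the rounding.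
  set q := ((1 - ε) * y - β) / κ with hqd
  set N := ⌊q⌋₊ with hN
  set z := (1 - ε) * y + N * l with hz
  have hqN : q < N + 1 := Nat.lt_floor_add_one q
  have hzz₀ : z₀ ≤ z := h2.trans (le_add_of_nonneg_right (by positivity))
  have hzc : c * y ≤ z := by
    have e1 : (q - 1) * l ≤ N * l := mul_le_mul_of_nonneg_right (by linarith) hl0.le
    have e2 : (1 - ε) * y + (q - 1) * l =
        (1 - ε) * (a - b₁) / κ * y - (β / κ + 1) * l := by
      rw [hqd, show a - b₁ = κ + l by rw [hκ, hl]; ring]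
      field_simp
      ring
    linarith
  have hsub : fluidEvent u t β m y ⊆
      {ω | ∃ k ≤ m, z < excess β (shift N (pairPath u t ω)) k} ∪
      ({ω | ∃ n : ℕ, ∑ i ∈ Finset.range n, u i ω < n * (b₁ - ε) - ε * y} ∪
        {ω | ∃ n : ℕ, ∑ i ∈ Finset.range n, t i ω < n * (a - ε) - ε * y}) := by
    rintro ω ⟨k, hk, n, hn, hy1, hy2⟩
    by_cases hu : ∃ n : ℕ, ∑ i ∈ Finset.range n, u i ω < n * (b₁ - ε) - ε * y
    · exact Or.inr (Or.inl hu)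
    by_cases ht : ∃ n : ℕ, ∑ i ∈ Finset.range n, t i ω < n * (a - ε) - ε * y
    · exact Or.inr (Or.inr ht)
    refine Or.inl ?_
    simp only [not_exists, not_lt] at hu ht
    have hu' := hu n
    have ht' := ht N
    have hNn : N ≤ n := by
      refine Nat.floor_le_of_le ?_
      rw [hqd, div_le_iff₀ hκ0, hκ]
      push_cast at hy1
      linarith
    refine ⟨k - N + 1, by omega, ?_⟩
    have hlp := le_lpp_succ (β := β) (w := shift N (pairPath u t ω))
      (show n - N ≤ k - N by omega)
    have e1 : ∑ i ∈ Finset.Ico (n - N) (k - N + 1), (shift N (pairPath u t ω) i).1 =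
        ∑ i ∈ Finset.Ico n (k + 1), u i ω := by
      rw [show k - N + 1 = k + 1 - N by omega]
      have := Finset.sum_Ico_add (fun i => u i ω) (n - N) (k + 1 - N) N
      rw [show n - N + N = n by omega, show k + 1 - N + N = k + 1 by omega] at this
      exact this
    have e2 : ∑ i ∈ Finset.range (k - N + 1), (shift N (pairPath u t ω) i).2 =
        ∑ i ∈ Finset.range (k + 1), t i ω - ∑ i ∈ Finset.range N, t i ω := by
      have := Finset.sum_range_add (fun i => t i ω) N (k - N + 1)
      rw [show N + (k - N + 1) = k + 1 by omega] at this
      rw [this, add_sub_cancel_left]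
      rfl
    rw [excess, e2]
    rw [e1] at hlp
    push_cast [Nat.cast_sub hNn] at hlp hy2
    rw [hz, hl]
    linarith
  have hshift : P.real {ω | ∃ k ≤ m, z < excess β (shift N (pairPath u t ω)) k} =
      P.real {ω | ∃ k ≤ m, z < excess β (pairPath u t ω) k} := by
    have ms : MeasurableSet {w : ℕ → ℝ × ℝ | ∃ k ≤ m, z < excess β w k} := by
      simp only [← lt_maxExcess]
      exact measurableSet_lt measurable_const (measurable_maxExcess β m)
    have hS : Measurable fun ω => shift N (pairPath u t ω) := (measurable_shift N).comp hX
    have h := congrArg (fun ν => ν {w : ℕ → ℝ × ℝ | ∃ k ≤ m, z < excess β w k})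
      (map_shift_pairPath I.meas_u I.meas_t I.indep_ut I.ident_u I.ident_t N)
    simp only [Measure.map_apply hS ms, Measure.map_apply hX ms] at h
    exact congrArg ENNReal.toReal h
  have hz1 := hz₀ z hzz₀ m
  have hz2 := tail_anti (integratedTailLaw F) hzc
  have hz3 := mul_le_mul_of_nonneg_left hz2 hL0.le
  have h5 := (measureReal_mono (μ := P) hsub).trans ((measureReal_union_le _ _).trans
    (add_le_add le_rfl (measureReal_union_le _ _)))
  rw [hshift] at h5
  linarith

/-- Inserting `± (n + 1) s` bounds the second expression in the event by `M + R`, with `M` a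
function of `v` alone and `R` of `u` and `t`. If `M` is not large, then either both are moderate,
which is unlikely, or `R` is large; in the latter case `v` is independent of `R` and almost always
below a line of slope `β`. -/
lemma eventually_delayEvent_le_fluid (I : TandemInput P u v t b₁ b₂ a)
    (hF : IntegrableOn (tail F) (Ioi 0)) (hFpos : ∀ x, 0 < tail F x)
    (hFs : IsSubexponential (integratedTailLaw F)) {d₁ d₂ : ℝ} (hd₁ : 0 ≤ d₁) (hd₂ : 0 ≤ d₂)
    (hq₁ : Tendsto (fun x => P.real {ω | x < u 0 ω} / tail F x) atTop (𝓝 d₁))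
    (hq₂ : Tendsto (fun x => P.real {ω | x < v 0 ω} / tail F x) atTop (𝓝 d₂))
    {s β : ℝ} (hβ : b₂ < β) (hs₁ : b₁ ≤ s) (hs₂ : b₂ < s) (hsa : s < a) {L δ : ℝ}
    (hL : d₂ / (s - b₂) < L) (hδ : 0 < δ) :
    ∃ K, ∀ᶠ x in atTop, ∀ m, P.real (delayEvent u v t m x) ≤
      (L + δ) * tail (integratedTailLaw F) x + P.real (fluidEvent u t β m (x - K)) := by
  have := hFs.isProbabilityMeasure
  have hs0 : 0 ≤ s := I.b₁_nonneg.trans hs₁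
  have hX := measurable_pairPath I.meas_u I.meas_t
  have hXv := measurable_pairPath I.meas_v (t := fun _ _ => s) fun _ => measurable_const
  obtain ⟨L₀, hL₀, hL₀L⟩ := exists_between hL
  have hL₀0 : 0 < L₀ := lt_of_le_of_lt (div_nonneg hd₂ (by linarith)) hL₀
  obtain ⟨r, hr0, hr, hdr⟩ := exists_rate hd₂ (show 0 < s - b₂ by linarith) hL₀
  have hbddv : ∀ᵐ ω ∂P, BddAbove (range fun k : ℕ =>
      excess 0 (pairPath v (fun _ _ => s) ω) k + k * r) := by
    filter_upwards [ae_bddAbove_sum_sub I.int_v I.indep_v I.ident_v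
      (show _ < s - r by rw [I.mean_v]; linarith)] with ω hω
    convert hω using 3 with k
    rw [excess_zero_slope fun i => I.nonneg_v i ω]
    simp only [pairPath, Finset.sum_const, Finset.card_range, nsmul_eq_mul]
    ring
  have hV := eventually_maxExcess_le hXv hF hFpos hFs le_rfl hr0 hd₂
    (fun ω i => I.nonneg_v i ω) (fun ω i => hs0)
    (indepFun_trunc_shift_const I.meas_v I.indep_v s)
    (map_shift_pairPath_const I.meas_v I.indep_v I.ident_v s) hbddv hq₂ hdr
  -- A crude rate suffices for `R`: its constant is only ever multiplied by `η`, which is chosen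
  -- afterwards.
  have hr'0 : 0 < (a - s) / 2 := by linarith
  have hR := eventually_maxExcess_le hX hF hFpos hFs hs0 hr'0 hd₁
    (fun ω i => I.nonneg_u i ω) (fun ω i => I.nonneg_t i ω)
    (indepFun_trunc_shift I.meas_u I.meas_t I.indep_ut)
    (map_shift_pairPath I.meas_u I.meas_t I.indep_ut I.ident_u I.ident_t)
    (I.ae_bddAbove_excess hs₁ (by linarith)) hq₁ (lt_add_one (d₁ / ((a - s) / 2)))
  obtain ⟨x₁, hx₁⟩ := eventually_atTop.1 hV
  obtain ⟨x₂, hx₂⟩ := eventually_atTop.1 hR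
  set G := tail (integratedTailLaw F) with hG
  set L₁ := d₁ / ((a - s) / 2) + 1
  have hL₁0 : 0 ≤ L₁ := by positivity
  have hG1 := hFs.tail_pos x₁
  have hG2 := hFs.tail_pos x₂
  have hMm : ∀ m, Measurable fun ω => maxExcess 0 m (pairPath v (fun _ _ => s) ω) := fun m =>
    (measurable_maxExcess 0 m).comp hXv
  have hRm : ∀ m, Measurable fun ω => maxExcess s m (pairPath u t ω) := fun m =>
    (measurable_maxExcess s m).comp hX
  have htM : ∀ m x, tail (P.map fun ω => maxExcess 0 m (pairPath v (fun _ _ => s) ω)) x =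
      P.real {ω | x < maxExcess 0 m (pairPath v (fun _ _ => s) ω)} := by
    intro m x
    rw [tail, map_measureReal_apply (hMm m) measurableSet_Ioi]
    rfl
  have htR : ∀ m x, tail (P.map fun ω => maxExcess s m (pairPath u t ω)) x =
      P.real {ω | x < maxExcess s m (pairPath u t ω)} := by
    intro m x
    rw [tail, map_measureReal_apply (hRm m) measurableSet_Ioi]
    rfl
  have hMle : ∀ m x, x₁ ≤ x →
      P.real {ω | x < maxExcess 0 m (pairPath v (fun _ _ => s) ω)} ≤ L₀ * G x := by
    intro m x hx
    simp only [lt_maxExcess]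
    exact hx₁ x hx m
  have hRle : ∀ m x, x₂ ≤ x →
      P.real {ω | x < maxExcess s m (pairPath u t ω)} ≤ L₁ * G x := by
    intro m x hx
    simp only [lt_maxExcess]
    exact hx₂ x hx m
  set C := L₀ + 1 / G x₁ with hC
  have hC0 : 0 ≤ C := by positivity
  set α := L₁ + 1 / G x₂ with hα
  have hα0 : 0 ≤ α := by positivity
  have hMall : ∀ m x, tail (P.map fun ω => maxExcess 0 m (pairPath v (fun _ _ => s) ω)) x ≤
      C * G x := fun m x => by
    rw [htM]
    exact hFs.le_mul_tail_of_forall_ge zero_le_one hL₀0.le measureReal_le_one (hMle m x)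
  have hRall : ∀ m x, tail (P.map fun ω => maxExcess s m (pairPath u t ω)) x ≤ α * G x :=
    fun m x => by
      rw [htR]
      exact hFs.le_mul_tail_of_forall_ge zero_le_one hL₁0 measureReal_le_one (hRle m x)
  set η := δ / (4 * (α + 1)) with hη
  have hη0 : 0 < η := by positivity
  have hαη : α * η ≤ δ / 4 := by
    calc α * η ≤ (α + 1) * η := mul_le_mul_of_nonneg_right (by linarith) hη0.le
      _ = δ / 4 := by
        rw [hη]
        field_simp
  obtain ⟨A, hA0, hA⟩ := hFs.exists_prod_both_le hC0 hη0
  obtain ⟨K, hK0, hK⟩ := exists_forall_le_of_bddAbove (P := P)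
    (f := fun n ω => ∑ i ∈ Finset.range n, v i ω - n * β)
    (fun n => (Finset.measurable_sum _ fun i _ => I.meas_v i).sub_const _)
    (ae_bddAbove_sum_sub I.int_v I.indep_v I.ident_v (show _ < β by rw [I.mean_v]; exact hβ)) hη0
  refine ⟨K, ?_⟩
  filter_upwards [hA, eventually_ge_atTop (x₁ + A),
    hFs.eventually_tail_sub_le A (show 1 < L / L₀ by rwa [one_lt_div hL₀0]),
    hFs.eventually_tail_sub_le A one_lt_two] with x h1 h2 h3 h4 m
  have hGx := hFs.tail_pos x
  set Mm := fun ω => maxExcess 0 m (pairPath v (fun _ _ => s) ω) with hMmd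
  set Rm := fun ω => maxExcess s m (pairPath u t ω) with hRmd
  set Ev := {ω | ∃ n : ℕ, K < ∑ i ∈ Finset.range n, v i ω - n * β} with hEv
  have hsub : delayEvent u v t m x ⊆ {ω | x - A < Mm ω} ∪
      ({ω | Mm ω ≤ x - A ∧ Rm ω ≤ x - A ∧ x < Mm ω + Rm ω} ∪
        (({ω | x - A < Rm ω} ∩ Ev) ∪ fluidEvent u t β m (x - K))) := by
    rintro ω ⟨k, hk, n, hn, hy1, hy2⟩
    rcases lt_or_ge (x - A) (Mm ω) with hM | hM
    · exact Or.inl hM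
    rcases lt_or_ge (x - A) (Rm ω) with hR | hR
    · by_cases hE : ω ∈ Ev
      · exact Or.inr (Or.inr (Or.inl ⟨hR, hE⟩))
      · refine Or.inr (Or.inr (Or.inr ⟨k, hk, n, hn, ?_⟩))
        simp only [hEv, mem_ofPred_eq, not_exists, not_lt] at hE
        have := hE (n + 1)
        constructor <;> linarith
    · refine Or.inr (Or.inl ⟨hM, hR, ?_⟩)
      have e1 : excess 0 (pairPath v (fun _ _ => s) ω) (n + 1) ≤ Mm ω :=
        not_lt.1 fun h => lt_irrefl _ (lt_maxExcess.2 ⟨n + 1, by omega, h⟩)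
      have e2 : excess s (pairPath u t ω) (k + 1) ≤ Rm ω :=
        not_lt.1 fun h => lt_irrefl _ (lt_maxExcess.2 ⟨k + 1, by omega, h⟩)
      rw [excess_zero_slope fun i => I.nonneg_v i ω] at e1
      have e3 := le_lpp_succ (β := s) (w := pairPath u t ω) hn
      rw [excess] at e2
      simp only [pairPath, Finset.sum_const, Finset.card_range, nsmul_eq_mul] at e1 e2 e3
      linarith
  have hind : IndepFun Mm Rm P := by
    refine indepFun_of_disjoint I.meas I.indep
      (S := range fun r : ℕ => Sum.inr (Sum.inl r))
      (T := range (fun r : ℕ => Sum.inl r) ∪ range fun r : ℕ => Sum.inr (Sum.inr r)) ?_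
      ((measurable_maxExcess 0 m).comp (measurable_pairPath (fun r => ?_) fun r => ?_))
      ((measurable_maxExcess s m).comp (measurable_pairPath (fun r => ?_) fun r => ?_))
    · rw [Set.disjoint_left]
      rintro _ ⟨r, rfl⟩ h
      simp at h
    · exact measurable_sigmaOf (Y := Sum.elim u (Sum.elim v t)) (i := Sum.inr (Sum.inl r)) ⟨r, rfl⟩
    · exact measurable_const
    · exact measurable_sigmaOf (Y := Sum.elim u (Sum.elim v t)) (i := Sum.inl r) (Or.inl ⟨r, rfl⟩)
    · exact measurable_sigmaOf (Y := Sum.elim u (Sum.elim v t)) (i := Sum.inr (Sum.inr r))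
        (Or.inr ⟨r, rfl⟩)
  have hboth : P.real {ω | Mm ω ≤ x - A ∧ Rm ω ≤ x - A ∧ x < Mm ω + Rm ω} ≤ δ / 4 * G x := by
    have hp := (indepFun_iff_map_prod_eq_prod_map_map (hMm m).aemeasurable
      (hRm m).aemeasurable).1 hind
    have ms : MeasurableSet {p : ℝ × ℝ | p.1 ≤ x - A ∧ p.2 ≤ x - A ∧ x < p.1 + p.2} :=
      (measurableSet_le measurable_fst measurable_const).inter
        ((measurableSet_le measurable_snd measurable_const).inter (measurableSet_lt_add x))
    have h5 := h1 (P.map Mm) (P.map Rm) (hMall m) α hα0 (hRall m)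
    rw [← hp, map_measureReal_apply ((hMm m).prodMk (hRm m)) ms] at h5
    exact h5.trans (mul_le_mul_of_nonneg_right hαη hGx.le)
  have hinter : P.real ({ω | x - A < Rm ω} ∩ Ev) ≤ δ / 2 * G x := by
    have h5 : P.real ({ω | x - A < Rm ω} ∩ Ev) = P.real {ω | x - A < Rm ω} * P.real Ev := by
      refine indepSet_of_disjoint I.meas I.indep
        (S := range (fun r : ℕ => Sum.inl r) ∪ range fun r : ℕ => Sum.inr (Sum.inr r))
        (T := range fun r : ℕ => Sum.inr (Sum.inl r)) ?_
        (measurableSet_lt measurable_const ((measurable_maxExcess s m).comp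
          (measurable_pairPath (fun r => ?_) fun r => ?_)))
        (measurableSet_exists_lt (fun n =>
          (Finset.measurable_sum _ fun r _ => ?_).sub_const _) K)
      · rw [Set.disjoint_left]
        rintro _ h ⟨r, rfl⟩
        simp at h
      · exact measurable_sigmaOf (Y := Sum.elim u (Sum.elim v t)) (i := Sum.inl r)
          (Or.inl ⟨r, rfl⟩)
      · exact measurable_sigmaOf (Y := Sum.elim u (Sum.elim v t)) (i := Sum.inr (Sum.inr r))
          (Or.inr ⟨r, rfl⟩)
      · exact measurable_sigmaOf (Y := Sum.elim u (Sum.elim v t)) (i := Sum.inr (Sum.inl r))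
          ⟨r, rfl⟩
    rw [h5]
    have h6 : P.real {ω | x - A < Rm ω} ≤ α * (2 * G x) := by
      rw [← htR]
      exact (hRall m _).trans (mul_le_mul_of_nonneg_left h4 hα0)
    calc _ ≤ α * (2 * G x) * η := mul_le_mul h6 hK measureReal_nonneg (by positivity)
      _ = 2 * (α * η) * G x := by ring
      _ ≤ 2 * (δ / 4) * G x := by gcongr
      _ = _ := by ring
  have hM : P.real {ω | x - A < Mm ω} ≤ L * G x := by
    calc _ ≤ L₀ * G (x - A) := hMle m _ (by linarith)
      _ ≤ L₀ * (L / L₀ * G x) := mul_le_mul_of_nonneg_left h3 hL₀0.le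
      _ = _ := by field_simp
  have h7 := (measureReal_mono (μ := P) hsub).trans ((measureReal_union_le _ _).trans
    (add_le_add le_rfl ((measureReal_union_le _ _).trans
      (add_le_add le_rfl (measureReal_union_le _ _)))))
  nlinarith

/-- The asymptotic upper bound, uniform in the first customer. -/
theorem eventually_delayEvent_le (I : TandemInput P u v t b₁ b₂ a)
    (hF : IntegrableOn (tail F) (Ioi 0)) (hFpos : ∀ x, 0 < tail F x)
    (hFs : IsSubexponential (integratedTailLaw F)) {d₁ d₂ : ℝ} (hd₁ : 0 ≤ d₁) (hd₂ : 0 ≤ d₂)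
    (hq₁ : Tendsto (fun x => P.real {ω | x < u 0 ω} / tail F x) atTop (𝓝 d₁))
    (hq₂ : Tendsto (fun x => P.real {ω | x < v 0 ω} / tail F x) atTop (𝓝 d₂))
    (hb : b₁ < b₂) (hba : b₂ < a) {κ : ℝ} (hκ : 0 < κ) :
    ∀ᶠ x in atTop, ∀ m, P.real (delayEvent u v t m x) ≤
      d₂ / (a - b₂) * tail (integratedTailLaw F) x +
        d₁ / (a - b₂) * tail (integratedTailLaw F) (x * ((a - b₁) / (b₂ - b₁))) +
        κ * tail (integratedTailLaw F) x := by
  have := hFs.isProbabilityMeasure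
  set c := (a - b₁) / (b₂ - b₁) with hc
  have hc1 : 1 < c := by
    rw [hc, one_lt_div (by linarith)]
    linarith
  set D₁ := d₁ / (a - b₂) with hD₁
  set D₂ := d₂ / (a - b₂) with hD₂
  have hD₁0 : 0 ≤ D₁ := div_nonneg hd₁ (by linarith)
  -- Passing from the multiple `c₁` to `c` costs `(c - c₁) / (c₁ - 1)` by `integral_tail_mul_le`.
  -- The gap between `c₁` and the `c₂` chosen next absorbs the shift `K`, since eventually `c₂ * (x
  -- - K) ≥ c₁ * x`.
  obtain ⟨c₁, hc₁1, hc₁c, hc₁κ⟩ : ∃ c₁, 1 < c₁ ∧ c₁ < c ∧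
      (D₁ + 1) * ((c - c₁) / (c₁ - 1)) < κ / 4 := by
    have hcont : ContinuousAt (fun c₁ : ℝ => (D₁ + 1) * ((c - c₁) / (c₁ - 1))) c :=
      continuousAt_const.mul (ContinuousAt.div (by fun_prop) (by fun_prop) (by linarith))
    have h0 : (fun c₁ : ℝ => (D₁ + 1) * ((c - c₁) / (c₁ - 1))) c < κ / 4 := by
      simpa using hκ
    have h1 := hcont.eventually_lt continuousAt_const h0
    obtain ⟨c₁, ⟨h2, h3⟩, h4⟩ := (((h1.and (Ioi_mem_nhds hc1)).filter_mono
      (nhdsWithin_le_nhds (s := Iio c))).and self_mem_nhdsWithin).exists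
    exact ⟨c₁, h3, h4, h2⟩
  obtain ⟨c₂, hc₁₂, hc₂c⟩ := exists_between hc₁c
  set κ₁ := min 1 (κ / 4) with hκ₁
  have hκ₁0 : 0 < κ₁ := lt_min one_pos (by linarith)
  obtain ⟨ε, hε, hε1, hεa, hεD₂, hεD₁, hεc⟩ : ∃ ε : ℝ, 0 < ε ∧ ε < 1 ∧ b₂ + ε + ε < a ∧
      d₂ / (a - ε - b₂) < D₂ + κ / 8 ∧ d₁ / (a - (b₂ + ε)) < D₁ + κ₁ ∧
      c₂ < (1 - ε) * (a - b₁) / (b₂ + ε - b₁ + ε) := by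
    have hne : a - b₂ ≠ 0 := by linarith
    have k1 : ContinuousAt (fun ε : ℝ => b₂ + ε + ε) 0 := by fun_prop
    have k2 : ContinuousAt (fun ε : ℝ => d₂ / (a - ε - b₂)) 0 :=
      ContinuousAt.div (by fun_prop) (by fun_prop) (by simpa using hne)
    have k3 : ContinuousAt (fun ε : ℝ => d₁ / (a - (b₂ + ε))) 0 :=
      ContinuousAt.div (by fun_prop) (by fun_prop) (by simpa using hne)
    have k4 : ContinuousAt (fun ε : ℝ => (1 - ε) * (a - b₁) / (b₂ + ε - b₁ + ε)) 0 :=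
      ContinuousAt.div (by fun_prop) (by fun_prop) (by simp; linarith)
    have e1 := k1.eventually_lt (continuousAt_const (y := a)) (by simpa using hba)
    have e2 := k2.eventually_lt (continuousAt_const (y := D₂ + κ / 8)) (by simp; linarith)
    have e3 := k3.eventually_lt (continuousAt_const (y := D₁ + κ₁)) (by simp; linarith)
    have e4 := (continuousAt_const (y := c₂)).eventually_lt k4 (by simpa using hc₂c)
    obtain ⟨ε, h1, h2⟩ := (((((e1.and e2).and (e3.and e4)).and
      (Iio_mem_nhds one_pos)).filter_mono (nhdsWithin_le_nhds (s := Ioi 0))).and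
        self_mem_nhdsWithin).exists
    exact ⟨ε, h2, h1.2, h1.1.1.1, h1.1.1.2, h1.1.2.1, h1.1.2.2⟩
  obtain ⟨K, hK⟩ := eventually_delayEvent_le_fluid I hF hFpos hFs hd₁ hd₂ hq₁ hq₂
    (show b₂ < b₂ + ε by linarith) (show b₁ ≤ a - ε by linarith) (show b₂ < a - ε by linarith)
    (show a - ε < a by linarith) hεD₂ (show 0 < κ / 8 by linarith)
  have hfl := eventually_fluidEvent_le I hF hFpos hFs hd₁ hq₁ hε hε1
    (show b₁ < b₂ + ε by linarith) hεa hεD₁ hεc (show 0 < κ / 16 by linarith)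
  have hshift : Tendsto (fun x : ℝ => x - K) atTop atTop :=
    tendsto_atTop_add_const_right atTop (-K) tendsto_id
  have hslope : Tendsto (fun x : ℝ => (c₂ - c₁) * x) atTop atTop :=
    tendsto_id.const_mul_atTop (by linarith)
  have hI := eventually_integratedTail_eq hF hFs
  have hmul : ∀ {r : ℝ}, 1 < r → Tendsto (fun x : ℝ => r * x) atTop atTop := fun hr =>
    tendsto_id.const_mul_atTop (by linarith)
  filter_upwards [hK, hshift.eventually hfl, hslope.eventually_ge_atTop (c₂ * K),
    hFs.eventually_tail_sub_le K one_lt_two, hI, (hmul hc1).eventually hI,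
    (hmul hc₁1).eventually hI, eventually_ge_atTop 0] with x h1 h2 h3 h4 h5 h6 h7 h8 m
  have h9 := h1 m
  have h10 := h2 m
  have h11 := integral_tail_mul_le hF hc₁1 hc₁c.le h8
  rw [← h5, ← h6, ← h7] at h11
  have h12 : tail (integratedTailLaw F) (c₂ * (x - K)) ≤ tail (integratedTailLaw F) (c₁ * x) :=
    tail_anti _ (by linarith)
  have h13 : tail (integratedTailLaw F) (c * x) ≤ tail (integratedTailLaw F) x :=
    tail_anti _ (by nlinarith)
  have hGx := hFs.tail_pos x
  have hGcx := hFs.tail_pos (c * x)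
  rw [mul_comm x c]
  set G := tail (integratedTailLaw F)
  have h14 : (D₁ + κ₁) * G (c₂ * (x - K)) ≤ D₁ * G (c * x) + κ / 4 * G x + κ / 4 * G x := by
    calc (D₁ + κ₁) * G (c₂ * (x - K))
        ≤ (D₁ + κ₁) * (G (c * x) + (c - c₁) / (c₁ - 1) * G x) :=
          mul_le_mul_of_nonneg_left (h12.trans h11) (by linarith)
      _ = D₁ * G (c * x) + κ₁ * G (c * x) + (D₁ + κ₁) * ((c - c₁) / (c₁ - 1)) * G x := by ring
      _ ≤ D₁ * G (c * x) + κ / 4 * G x + κ / 4 * G x := by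
          have hr : 0 ≤ (c - c₁) / (c₁ - 1) := div_nonneg (by linarith) (by linarith)
          have hκ₁1 : κ₁ ≤ 1 := min_le_left _ _
          have hκ₁κ : κ₁ ≤ κ / 4 := min_le_right _ _
          have i1 : (D₁ + κ₁) * ((c - c₁) / (c₁ - 1)) ≤ κ / 4 :=
            (mul_le_mul_of_nonneg_right (by linarith) hr).trans hc₁κ.le
          have i2 := mul_le_mul_of_nonneg_right i1 hGx.le
          have i3 : κ₁ * G (c * x) ≤ κ / 4 * G x := mul_le_mul hκ₁κ h13 hGcx.le (by linarith)
          linarith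
  have h15 : κ / 16 * G (x - K) ≤ κ / 16 * (2 * G x) :=
    mul_le_mul_of_nonneg_left h4 (by linarith)
  have h16 : (D₂ + κ / 8 + κ / 8) * G x = D₂ * G x + κ / 4 * G x := by ring
  have h17 : 0 < κ * G x := mul_pos hκ hGx
  rw [h16] at h9
  linarith

end Upper

/-! ### The lower bound -/

section Lower

variable {Ω : Type*} [MeasurableSpace Ω] {P : Measure Ω}

/-- A second-order Bonferroni inequality for a union of events that are most of pairwise
independent events. -/
lemma le_measureReal_biUnion [IsProbabilityMeasure P] {ι : Type*} [DecidableEq ι] {A E : ι → Set Ω}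
    (hAE : ∀ i, A i ⊆ E i) (hA : ∀ i, MeasurableSet (A i)) {θ : ℝ}
    (hθ : ∀ i, θ * P.real (E i) ≤ P.real (A i))
    (hE : ∀ i j, i ≠ j → P.real (E i ∩ E j) = P.real (E i) * P.real (E j)) (J : Finset ι) :
    θ * ∑ i ∈ J, P.real (E i) - (∑ i ∈ J, P.real (E i)) ^ 2 ≤ P.real (⋃ i ∈ J, A i) := by
  induction J using Finset.induction_on with
  | empty => simp
  | insert i J hi ih =>
    rw [Finset.sum_insert hi, Finset.set_biUnion_insert]
    have h1 := measureReal_union_add_inter' (μ := P) (t := ⋃ j ∈ J, A j) (hA i)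
      (measure_ne_top _ _) (measure_ne_top _ _)
    -- No independence is known for the sets `A`, so overlaps are estimated through the larger,
    -- pairwise independent sets `E`.
    have h2 : P.real (A i ∩ ⋃ j ∈ J, A j) ≤ P.real (E i) * ∑ j ∈ J, P.real (E j) := by
      rw [Finset.mul_sum]
      calc P.real (A i ∩ ⋃ j ∈ J, A j) ≤ P.real (⋃ j ∈ J, E i ∩ E j) := by
            refine measureReal_mono ?_ (measure_ne_top _ _)
            rintro ω ⟨hω, hω'⟩
            simp only [mem_iUnion] at hω' ⊢
            obtain ⟨j, hj, hωj⟩ := hω'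
            exact ⟨j, hj, hAE i hω, hAE j hωj⟩
        _ ≤ ∑ j ∈ J, P.real (E i ∩ E j) := measureReal_biUnion_finset_le J _
        _ = ∑ j ∈ J, P.real (E i) * P.real (E j) :=
            Finset.sum_congr rfl fun j hj => hE i j fun h => hi (h ▸ hj)
    have h3 := hθ i
    have h4 : 0 ≤ P.real (E i) := measureReal_nonneg
    have h5 : 0 ≤ ∑ j ∈ J, P.real (E j) := Finset.sum_nonneg fun j _ => measureReal_nonneg
    nlinarith

variable {u v t : ℕ → Ω → ℝ} {b₁ b₂ a : ℝ}

/-- The event that the waiting time of customer `0` in queue 2 exceeds `x` for some first customer.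
Here `u 0` is the service time of customer `0` in station 1, and the service times in station 1 of
the earlier customers are `u 1, u 2, …`. -/
def lowerEvent (u v t : ℕ → Ω → ℝ) (x : ℝ) : Set Ω :=
  {ω | ∃ n : ℕ,
    x < ∑ r ∈ Finset.range (n + 1), v r ω - ∑ r ∈ Finset.range (n + 1), u r ω ∧
    ∀ j ≤ n, x < ∑ r ∈ Finset.range (n + 1), v r ω + u (n + 1) ω -
      ∑ r ∈ Finset.range (n + 1), t r ω -
      (∑ r ∈ Finset.range (j + 1), u r ω - ∑ r ∈ Finset.range j, t r ω)}

/-- The event that the partial sums up to `n` are close to their means. -/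
def typicalEvent (u v t : ℕ → Ω → ℝ) (b₁ b₂ a ε K : ℝ) (n : ℕ) : Set Ω :=
  {ω | (∀ j ≤ n + 1, ∑ r ∈ Finset.range j, u r ω - j * (b₁ + ε) ≤ K ∧
    ∑ r ∈ Finset.range j, t r ω - j * (a + ε) ≤ K ∧
    j * (a - ε) - ∑ r ∈ Finset.range j, t r ω ≤ K) ∧
    n * (b₂ - ε) - ∑ r ∈ Finset.range n, v r ω ≤ K}

/-- The ranges `r ≤ n` and `r < n` leave out `u (n + 1)` and `v n`, the two possible places of the
jump. The σ-algebra is arbitrary so that independence of the jump can be read off. -/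
lemma measurableSet_typicalEvent {E : Type*} {m : MeasurableSpace E} {u v t : ℕ → E → ℝ}
    {b₁ b₂ a ε K : ℝ} {n : ℕ} (hu : ∀ r ≤ n, Measurable (u r)) (hv : ∀ r < n, Measurable (v r))
    (ht : ∀ r, Measurable (t r)) :
    MeasurableSet {ω | (∀ j ≤ n + 1, ∑ r ∈ Finset.range j, u r ω - j * (b₁ + ε) ≤ K ∧
    ∑ r ∈ Finset.range j, t r ω - j * (a + ε) ≤ K ∧
    j * (a - ε) - ∑ r ∈ Finset.range j, t r ω ≤ K) ∧
    n * (b₂ - ε) - ∑ r ∈ Finset.range n, v r ω ≤ K} := by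
  rw [Set.ofPred_and]
  refine MeasurableSet.inter ?_ (measurableSet_le (measurable_const.sub
    (Finset.measurable_sum _ fun r hr => hv r (Finset.mem_range.1 hr))) measurable_const)
  rw [Set.ofPred_forall]
  refine MeasurableSet.iInter fun j => ?_
  rw [Set.ofPred_forall]
  refine MeasurableSet.iInter fun hj => ?_
  have hU : Measurable fun ω => ∑ r ∈ Finset.range j, u r ω :=
    Finset.measurable_sum _ fun r hr => hu r (by have := Finset.mem_range.1 hr; omega)
  have hT : Measurable fun ω => ∑ r ∈ Finset.range j, t r ω :=
    Finset.measurable_sum _ fun r _ => ht r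
  exact (measurableSet_le (hU.sub_const _) measurable_const).inter
    ((measurableSet_le (hT.sub_const _) measurable_const).inter
      (measurableSet_le (measurable_const.sub hT) measurable_const))

lemma exists_le_typicalEvent [IsProbabilityMeasure P] (I : TandemInput P u v t b₁ b₂ a)
    {ε δ : ℝ} (hε : 0 < ε)
    (hδ : 0 < δ) : ∃ K : ℝ, 0 ≤ K ∧ ∀ n, 1 - δ ≤ P.real (typicalEvent u v t b₁ b₂ a ε K n) := by
  set f : ℕ → Ω → ℝ := fun n ω =>
    max (max (∑ r ∈ Finset.range n, u r ω - n * (b₁ + ε))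
      (∑ r ∈ Finset.range n, t r ω - n * (a + ε)))
    (max (n * (a - ε) - ∑ r ∈ Finset.range n, t r ω)
      (n * (b₂ - ε) - ∑ r ∈ Finset.range n, v r ω)) with hf
  have hU : ∀ n, Measurable fun ω => ∑ r ∈ Finset.range n, u r ω := fun n =>
    Finset.measurable_sum _ fun r _ => I.meas_u r
  have hV : ∀ n, Measurable fun ω => ∑ r ∈ Finset.range n, v r ω := fun n =>
    Finset.measurable_sum _ fun r _ => I.meas_v r
  have hT : ∀ n, Measurable fun ω => ∑ r ∈ Finset.range n, t r ω := fun n =>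
    Finset.measurable_sum _ fun r _ => I.meas_t r
  have hfm : ∀ n, Measurable (f n) := fun n =>
    (((hU n).sub_const _).max ((hT n).sub_const _)).max
      ((measurable_const.sub (hT n)).max (measurable_const.sub (hV n)))
  have hbdd : ∀ᵐ ω ∂P, BddAbove (range fun n => f n ω) := by
    filter_upwards [ae_bddAbove_sum_sub I.int_u I.indep_u I.ident_u
        (show _ < b₁ + ε by rw [I.mean_u]; linarith),
      ae_bddAbove_sum_sub I.int_t I.indep_t I.ident_t
        (show _ < a + ε by rw [I.mean_t]; linarith),
      ae_bddAbove_sub_sum I.int_t I.indep_t I.ident_t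
        (show a - ε < _ by rw [I.mean_t]; linarith),
      ae_bddAbove_sub_sum I.int_v I.indep_v I.ident_v
        (show b₂ - ε < _ by rw [I.mean_v]; linarith)] with ω ⟨B₁, h1⟩ ⟨B₂, h2⟩ ⟨B₃, h3⟩ ⟨B₄, h4⟩
    refine ⟨max (max B₁ B₂) (max B₃ B₄), ?_⟩
    rintro _ ⟨n, rfl⟩
    exact max_le_max (max_le_max (h1 ⟨n, rfl⟩) (h2 ⟨n, rfl⟩))
      (max_le_max (h3 ⟨n, rfl⟩) (h4 ⟨n, rfl⟩))
  obtain ⟨K, hK0, hK⟩ := exists_forall_le_of_bddAbove hfm hbdd hδ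
  refine ⟨K, hK0, fun n => ?_⟩
  have h1 : P.real {ω | ∃ k, K < f k ω}ᶜ = 1 - P.real {ω | ∃ k, K < f k ω} :=
    probReal_compl_eq_one_sub (measurableSet_exists_lt hfm K)
  have h2 : {ω | ∃ k, K < f k ω}ᶜ ⊆ typicalEvent u v t b₁ b₂ a ε K n := by
    intro ω hω
    simp only [mem_compl_iff, mem_ofPred_eq, not_exists, not_lt, hf, max_le_iff] at hω
    exact ⟨fun j _ => ⟨(hω j).1.1, (hω j).1.2, (hω j).2.1⟩, (hω n).2.2⟩
  have h3 := measureReal_mono (μ := P) h2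
  linarith

/-- A jump of `v n` raises both expressions. A jump of `u (n + 1)` does not enter the first one, so
there the drift `(n + 1) (b₂ - b₁)` has to pass `x` by itself. The `4 * K` covers four deviations:
of `V`, of `T` up to `n + 1`, and of `U` and `T` up to the index `j`. -/
lemma mem_lowerEvent (I : TandemInput P u v t b₁ b₂ a) {ε K x : ℝ} {n : ℕ} {ω : Ω}
    (hε : 0 < ε) (hK : 0 ≤ K) (hb : b₁ + 2 * ε ≤ b₂) (hba : b₁ + ε ≤ a - ε) (hba' : b₂ ≤ a)
    (hω : ω ∈ typicalEvent u v t b₁ b₂ a ε K n)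
    (h : x + (b₁ + b₂ + ε + 4 * K) + (n + 1) * (a - b₂ + 2 * ε) < v n ω ∨
      (x + (b₁ + b₂ + ε + 4 * K) + (n + 1) * (a - b₂ + 2 * ε) < u (n + 1) ω ∧
        x + (b₁ + b₂ + ε + 4 * K) < (n + 1) * (b₂ - b₁ - 2 * ε))) :
    ω ∈ lowerEvent u v t x := by
  obtain ⟨hω1, hω2⟩ := hω
  have hn : (0 : ℝ) ≤ n := n.cast_nonneg
  have hU := (hω1 (n + 1) le_rfl).1
  have hT := (hω1 (n + 1) le_rfl).2.1
  have hvn := I.nonneg_v n ω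
  have hun := I.nonneg_u (n + 1) ω
  have hb1 := I.b₁_nonneg
  have hb2 := I.b₂_nonneg
  push_cast at hU hT
  have hsum : x + (b₁ + b₂ + ε + 4 * K) + (n + 1) * (a - b₂ + 2 * ε) < v n ω + u (n + 1) ω := by
    rcases h with h | ⟨h, -⟩ <;> linarith
  refine ⟨n, ?_, fun j hj => ?_⟩
  · rw [Finset.sum_range_succ]
    have e1 : 0 ≤ ((n : ℝ) + 1) * (b₂ - b₁ - 2 * ε) := mul_nonneg (by linarith) (by linarith)
    have e2 : 0 ≤ ((n : ℝ) + 1) * (a - b₂ + 2 * ε) := mul_nonneg (by linarith) (by linarith)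
    rcases h with h | ⟨-, h⟩ <;> linarith
  · rw [Finset.sum_range_succ (fun r => v r ω)]
    have hUj := (hω1 (j + 1) (by omega)).1
    have hTj := (hω1 j (by omega)).2.2
    have hj0 : (0 : ℝ) ≤ j := j.cast_nonneg
    have e1 : (j : ℝ) * (b₁ + ε) ≤ j * (a - ε) := mul_le_mul_of_nonneg_left hba hj0
    push_cast at hUj
    linarith

variable [IsProbabilityMeasure P] {F : Measure ℝ} [IsProbabilityMeasure F]

/-- The error `η` includes the case `d = 0`, where no nonnegative constant lies below `d`. -/
lemma eventually_le_sum_sub (hF : IntegrableOn (tail F) (Ioi 0)) (hFpos : ∀ x, 0 < tail F x)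
    {q : ℝ → ℝ} (hq0 : ∀ x, 0 ≤ q x) {d : ℝ} (hd : 0 ≤ d)
    (hq : Tendsto (fun x => q x / tail F x) atTop (𝓝 d)) {c η : ℝ} (hc : 0 < c) (hη : 0 < η) :
    ∀ᶠ y in atTop, ∀ M : ℕ,
      d / c * ((∫ u in Ioi y, tail F u) - ∫ u in Ioi (y + M * c), tail F u) -
        η * (∫ u in Ioi y, tail F u) ≤ ∑ k ∈ Finset.range M, q (y + k * c) := by
  rcases hd.eq_or_lt with rfl | hd
  · filter_upwards with y M
    have h1 := integral_tail_nonneg (F := F) y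
    have h2 : 0 ≤ ∑ k ∈ Finset.range M, q (y + k * c) := Finset.sum_nonneg fun k _ => hq0 _
    have h3 := mul_nonneg hη.le h1
    rw [zero_div, zero_mul]
    linarith
  · set d' := max 0 (d - η * c) with hd'
    have hd'd : d' < d := max_lt hd (by have := mul_pos hη hc; linarith)
    filter_upwards [eventually_le_sum hF hFpos hq (le_max_left 0 (d - η * c)) hd'd hc] with y hy M
    refine le_trans ?_ (hy M)
    have h1 := integral_tail_nonneg (F := F) y
    have h2 := integral_tail_nonneg (F := F) (y + M * c)
    have h3 := (integral_tail_bounds F (show y ≤ y + M * c by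
      have : 0 ≤ (M : ℝ) * c := by positivity
      linarith)).1
    have h4 : d / c - η ≤ d' / c := by
      rw [le_div_iff₀ hc, sub_mul, div_mul_cancel₀ _ hc.ne']
      exact le_max_right _ _
    have h5 := mul_le_mul_of_nonneg_right h4 (sub_nonneg.2 h3)
    have h6 := mul_nonneg hη.le h2
    linarith

/-- A jump concerns the single variable `key i`: `inl n` stands for `v n` and `inr n` for `u (n +
1)`. Different jumps use different variables, and the typical event avoids the variable of its jump,
which is all that `le_measureReal_biUnion` asks for. -/
lemma lowerEvent_ge_sum (I : TandemInput P u v t b₁ b₂ a) {ε K x δ : ℝ} {N : ℕ}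
    (hε : 0 < ε) (hK : 0 ≤ K) (hb : b₁ + 2 * ε ≤ b₂) (hba : b₁ + ε ≤ a - ε) (hba' : b₂ ≤ a)
    (hδ : ∀ n, 1 - δ ≤ P.real (typicalEvent u v t b₁ b₂ a ε K n))
    (hN : x + (b₁ + b₂ + ε + 4 * K) < (N + 1) * (b₂ - b₁ - 2 * ε)) (M : ℕ) {S : ℝ}
    (hS : S = ∑ n ∈ Finset.range M,
        P.real {ω | x + (b₁ + b₂ + ε + 4 * K) + (n + 1) * (a - b₂ + 2 * ε) < v n ω} +
      ∑ n ∈ Finset.Ico N (N + M),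
        P.real {ω | x + (b₁ + b₂ + ε + 4 * K) + (n + 1) * (a - b₂ + 2 * ε) < u (n + 1) ω}) :
    (1 - δ) * S - S ^ 2 ≤ P.real (lowerEvent u v t x) := by
  set s : ℕ → ℝ := fun n => x + (b₁ + b₂ + ε + 4 * K) + (n + 1) * (a - b₂ + 2 * ε) with hs
  set key : ℕ ⊕ ℕ → ℕ ⊕ (ℕ ⊕ ℕ) :=
    Sum.elim (fun n => Sum.inr (Sum.inl n)) (fun n => Sum.inl (n + 1)) with hkey
  have hinj : Function.Injective key := by
    rintro (n | n) (m | m) h <;> simp [key] at h ⊢ <;> exact h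
  set idx : ℕ ⊕ ℕ → ℕ := Sum.elim id id with hidx
  set E : ℕ ⊕ ℕ → Set Ω := fun i => {ω | s (idx i) < Sum.elim u (Sum.elim v t) (key i) ω} with hE
  have hEm : ∀ i, MeasurableSet[sigmaOf (Sum.elim u (Sum.elim v t)) {key i}] (E i) := fun i =>
    measurableSet_lt measurable_const (measurable_sigmaOf (mem_singleton _))
  have hTm : ∀ i, MeasurableSet[sigmaOf (Sum.elim u (Sum.elim v t)) {key i}ᶜ]
      (typicalEvent u v t b₁ b₂ a ε K (idx i)) := by
    intro i
    refine measurableSet_typicalEvent (fun r hr => ?_) (fun r hr => ?_) fun r => ?_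
    · refine measurable_sigmaOf (Y := Sum.elim u (Sum.elim v t)) (i := Sum.inl r) ?_
      rcases i with n | n <;> simp [key, idx] at hr ⊢
      omega
    · refine measurable_sigmaOf (Y := Sum.elim u (Sum.elim v t)) (i := Sum.inr (Sum.inl r)) ?_
      rcases i with n | n <;> simp [key, idx] at hr ⊢
      omega
    · refine measurable_sigmaOf (Y := Sum.elim u (Sum.elim v t)) (i := Sum.inr (Sum.inr r)) ?_
      rcases i with n | n <;> simp [key]
  have hmain := le_measureReal_biUnion (P := P)
    (A := fun i => E i ∩ typicalEvent u v t b₁ b₂ a ε K (idx i)) (E := E)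
    (fun i => inter_subset_left)
    (fun i => (sigmaOf_le I.meas _ _ (hEm i)).inter (sigmaOf_le I.meas _ _ (hTm i)))
    (θ := 1 - δ)
    (by
      intro i
      rw [indepSet_of_disjoint I.meas I.indep disjoint_compl_right (hEm i) (hTm i), mul_comm]
      exact mul_le_mul_of_nonneg_left (hδ _) measureReal_nonneg)
    (by
      intro i j hij
      exact indepSet_of_disjoint I.meas I.indep
        (disjoint_singleton.2 fun h => hij (hinj h)) (hEm i) (hEm j))
    ((Finset.range M).disjSum (Finset.Ico N (N + M)))
  rw [Finset.sum_disjSum] at hmain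
  have hS' : ∑ i ∈ Finset.range M, P.real (E (Sum.inl i)) +
      ∑ i ∈ Finset.Ico N (N + M), P.real (E (Sum.inr i)) = S := hS.symm
  rw [hS'] at hmain
  refine hmain.trans (measureReal_mono ?_)
  refine iUnion₂_subset fun i hi => ?_
  rintro ω ⟨hω, hω'⟩
  refine mem_lowerEvent I hε hK hb hba hba' hω' ?_
  rcases i with n | n
  · exact Or.inl hω
  · refine Or.inr ⟨hω, ?_⟩
    have hn : N ≤ n := (Finset.mem_Ico.1 (Finset.inr_mem_disjSum.1 hi)).1
    have hn' : (N : ℝ) ≤ n := Nat.cast_le.2 hn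
    refine hN.trans_le (mul_le_mul_of_nonneg_right ?_ (by linarith))
    exact add_le_add hn' le_rfl

lemma tendsto_integral_tail (hF : IntegrableOn (tail F) (Ioi 0))
    (hFs : IsSubexponential (integratedTailLaw F)) :
    Tendsto (fun x => ∫ u in Ioi x, tail F u) atTop (𝓝 0) := by
  have := hFs.isProbabilityMeasure
  exact (tendsto_tail_atTop (integratedTailLaw F)).congr' (eventually_integratedTail_eq hF hFs)

/-- For large `x` the sum `S` of the jump probabilities is at most `δ`, so `(1 - δ) * S - S ^ 2 ≥ (1
- 2 * δ) * S`. The number `M` of terms is finite in each Bonferroni estimate and is sent to infinity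
at the end. -/
lemma eventually_lowerEvent_ge_aux (I : TandemInput P u v t b₁ b₂ a)
    (hF : IntegrableOn (tail F) (Ioi 0)) (hFpos : ∀ x, 0 < tail F x)
    (hFs : IsSubexponential (integratedTailLaw F)) {d₁ d₂ : ℝ} (hd₁ : 0 ≤ d₁) (hd₂ : 0 ≤ d₂)
    (hq₁ : Tendsto (fun x => P.real {ω | x < u 0 ω} / tail F x) atTop (𝓝 d₁))
    (hq₂ : Tendsto (fun x => P.real {ω | x < v 0 ω} / tail F x) atTop (𝓝 d₂))
    (hba : b₂ < a) {ε δ η : ℝ} (hε : 0 < ε) (hb : b₁ + 2 * ε < b₂)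
    (hδ : 0 < δ) (hδ2 : 2 * δ ≤ 1) (hη : 0 < η) :
    ∃ D, 0 ≤ D ∧ ∀ᶠ x in atTop, ∀ N : ℕ, x + D < (N + 1) * (b₂ - b₁ - 2 * ε) →
      (1 - 2 * δ) * (d₂ / (a - b₂ + 2 * ε) * (∫ y in Ioi (x + D + (a - b₂ + 2 * ε)), tail F y) +
        d₁ / (a - b₂ + 2 * ε) * (∫ y in Ioi (x + D + (N + 1) * (a - b₂ + 2 * ε)), tail F y) -
        2 * η * ∫ y in Ioi (x + D + (a - b₂ + 2 * ε)), tail F y) ≤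
      P.real (lowerEvent u v t x) := by
  have := hFs.isProbabilityMeasure
  obtain ⟨K, hK0, hK⟩ := exists_le_typicalEvent I hε hδ
  set D := b₁ + b₂ + ε + 4 * K with hD
  set c := a - b₂ + 2 * ε with hcd
  have hc : 0 < c := by linarith
  set q₁ : ℝ → ℝ := fun y => P.real {ω | y < u 0 ω} with hq₁d
  set q₂ : ℝ → ℝ := fun y => P.real {ω | y < v 0 ω} with hq₂d
  have hq₁0 : ∀ y, 0 ≤ q₁ y := fun y => measureReal_nonneg
  have hq₂0 : ∀ y, 0 ≤ q₂ y := fun y => measureReal_nonneg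
  have hu : ∀ r y, P.real {ω | y < u r ω} = q₁ y := fun r y =>
    congrArg ENNReal.toReal ((I.ident_u r).measure_mem_eq measurableSet_Ioi)
  have hv : ∀ r y, P.real {ω | y < v r ω} = q₂ y := fun r y =>
    congrArg ENNReal.toReal ((I.ident_v r).measure_mem_eq measurableSet_Ioi)
  obtain ⟨x₁, hx₁⟩ := eventually_atTop.1 (eventually_le_sum_sub hF hFpos hq₁0 hd₁ hq₁ hc hη)
  obtain ⟨x₂, hx₂⟩ := eventually_atTop.1 (eventually_le_sum_sub hF hFpos hq₂0 hd₂ hq₂ hc hη)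
  set C₁ := d₁ / c + 1
  set C₂ := d₂ / c + 1
  have hC : Tendsto (fun x => (C₁ + C₂) * tail (integratedTailLaw F) x) atTop (𝓝 0) := by
    simpa using (tendsto_tail_atTop (integratedTailLaw F)).const_mul (C₁ + C₂)
  refine ⟨D, by linarith [I.b₁_nonneg, I.b₂_nonneg], ?_⟩
  filter_upwards [eventually_ge_atTop (x₁ - D), eventually_ge_atTop (x₂ - D),
    eventually_sum_le hF hFpos hFs hd₁ hq₁ hc (lt_add_one (d₁ / c)) (-(D + c)),
    eventually_sum_le hF hFpos hFs hd₂ hq₂ hc (lt_add_one (d₂ / c)) (-(D + c)),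
    hC.eventually_le_const hδ] with x h1 h2 h3 h4 h5 N hN
  set Y₂ := x + D + c with hY₂
  set Y₁ := x + D + (N + 1) * c with hY₁
  have hY₁₂ : Y₂ ≤ Y₁ := by
    have : 0 ≤ (N : ℝ) * c := by positivity
    linarith
  have hbound : ∀ M : ℕ, (1 - 2 * δ) *
      ((d₂ / c * ((∫ y in Ioi Y₂, tail F y) - ∫ y in Ioi (Y₂ + M * c), tail F y) -
          η * (∫ y in Ioi Y₂, tail F y)) +
        (d₁ / c * ((∫ y in Ioi Y₁, tail F y) - ∫ y in Ioi (Y₁ + M * c), tail F y) -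
          η * (∫ y in Ioi Y₂, tail F y))) ≤ P.real (lowerEvent u v t x) := by
    intro M
    have hS := lowerEvent_ge_sum I hε hK0 hb.le (by linarith) hba.le hK hN M rfl
    simp only [hu, hv] at hS
    rw [Finset.sum_Ico_eq_sum_range] at hS
    have e2 : ∑ n ∈ Finset.range M, q₂ (x + D + ((n : ℝ) + 1) * c) =
        ∑ n ∈ Finset.range M, q₂ (Y₂ + n * c) := by
      refine Finset.sum_congr rfl fun n _ => ?_
      congr 1
      rw [hY₂]
      ring
    have e1 : ∑ n ∈ Finset.range (N + M - N), q₁ (x + D + (((N + n : ℕ) : ℝ) + 1) * c) =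
        ∑ n ∈ Finset.range M, q₁ (Y₁ + n * c) := by
      rw [Nat.add_sub_cancel_left]
      refine Finset.sum_congr rfl fun n _ => ?_
      congr 1
      rw [hY₁]
      push_cast
      ring
    rw [e1, e2] at hS
    have g1 : ∑ n ∈ Finset.range M, q₁ (Y₁ + n * c) ≤ C₁ * tail (integratedTailLaw F) x := by
      refine le_trans (Finset.sum_le_sum fun n _ => ?_) (h3 M)
      refine measureReal_mono fun ω hω => ?_
      have hω' : Y₁ + n * c < u 0 ω := hω
      show x - -(D + c) + n * c < u 0 ω
      linarith
    have g2 : ∑ n ∈ Finset.range M, q₂ (Y₂ + n * c) ≤ C₂ * tail (integratedTailLaw F) x := by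
      refine le_trans (Finset.sum_le_sum fun n _ => ?_) (h4 M)
      refine measureReal_mono fun ω hω => ?_
      have hω' : Y₂ + n * c < v 0 ω := hω
      show x - -(D + c) + n * c < v 0 ω
      linarith
    have l1 := hx₁ Y₁ (by linarith) M
    have l2 := hx₂ Y₂ (by linarith) M
    have l3 := mul_le_mul_of_nonneg_left (integral_tail_bounds F hY₁₂).1 hη.le
    have n1 : 0 ≤ ∑ n ∈ Finset.range M, q₁ (Y₁ + n * c) := Finset.sum_nonneg fun n _ => hq₁0 _
    have n2 : 0 ≤ ∑ n ∈ Finset.range M, q₂ (Y₂ + n * c) := Finset.sum_nonneg fun n _ => hq₂0 _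
    set S := ∑ n ∈ Finset.range M, q₂ (Y₂ + n * c) + ∑ n ∈ Finset.range M, q₁ (Y₁ + n * c)
    have hSδ : S ≤ δ := by linarith
    have hS0 : 0 ≤ S := add_nonneg n2 n1
    have hSS : S ^ 2 ≤ δ * S := by
      rw [pow_two]
      exact mul_le_mul_of_nonneg_right hSδ hS0
    refine le_trans (mul_le_mul_of_nonneg_left (show _ ≤ S by linarith) (by linarith)) ?_
    linarith
  have hlimI : ∀ y : ℝ, Tendsto (fun M : ℕ => ∫ z in Ioi (y + M * c), tail F z) atTop (𝓝 0) := by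
    intro y
    refine (tendsto_integral_tail hF hFs).comp ?_
    exact tendsto_atTop_add_const_left _ _ (tendsto_natCast_atTop_atTop.atTop_mul_const hc)
  have hlim := ((((((hlimI Y₂).const_sub (∫ y in Ioi Y₂, tail F y)).const_mul (d₂ / c)).sub_const
      (η * (∫ y in Ioi Y₂, tail F y))).add
    ((((hlimI Y₁).const_sub (∫ y in Ioi Y₁, tail F y)).const_mul (d₁ / c)).sub_const
      (η * (∫ y in Ioi Y₂, tail F y)))).const_mul (1 - 2 * δ))
  refine le_trans (le_of_eq ?_) (le_of_tendsto' hlim hbound)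
  ring

/-- The asymptotic lower bound. -/
theorem eventually_le_lowerEvent (I : TandemInput P u v t b₁ b₂ a)
    (hF : IntegrableOn (tail F) (Ioi 0)) (hFpos : ∀ x, 0 < tail F x)
    (hFs : IsSubexponential (integratedTailLaw F)) {d₁ d₂ : ℝ} (hd₁ : 0 ≤ d₁) (hd₂ : 0 ≤ d₂)
    (hq₁ : Tendsto (fun x => P.real {ω | x < u 0 ω} / tail F x) atTop (𝓝 d₁))
    (hq₂ : Tendsto (fun x => P.real {ω | x < v 0 ω} / tail F x) atTop (𝓝 d₂))
    (hb : b₁ < b₂) (hba : b₂ < a) {κ : ℝ} (hκ : 0 < κ) :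
    ∀ᶠ x in atTop, d₂ / (a - b₂) * tail (integratedTailLaw F) x +
        d₁ / (a - b₂) * tail (integratedTailLaw F) (x * ((a - b₁) / (b₂ - b₁))) ≤
      P.real (lowerEvent u v t x) + κ * tail (integratedTailLaw F) x := by
  have := hFs.isProbabilityMeasure
  set c := (a - b₁) / (b₂ - b₁) with hc
  have hc1 : 1 < c := by
    rw [hc, one_lt_div (by linarith)]
    linarith
  set D₁ := d₁ / (a - b₂) with hD₁
  set D₂ := d₂ / (a - b₂) with hD₂
  have hD₁0 : 0 ≤ D₁ := div_nonneg hd₁ (by linarith)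
  have hD₂0 : 0 ≤ D₂ := div_nonneg hd₂ (by linarith)
  -- Now `c₁` lies above `c`, leaving room for `ε`, the shift `D` and the rounding of `N`.
  obtain ⟨c₁, hcc₁, hc₁κ⟩ : ∃ c₁, c < c₁ ∧ D₁ * ((c₁ - c) / (c - 1)) < κ / 8 := by
    have hcont : ContinuousAt (fun c₁ : ℝ => D₁ * ((c₁ - c) / (c - 1))) c := by fun_prop
    have h1 := hcont.eventually_lt (continuousAt_const (y := κ / 8)) (by simpa using hκ)
    obtain ⟨c₁, h2, h3⟩ := ((h1.filter_mono
      (nhdsWithin_le_nhds (s := Ioi c))).and self_mem_nhdsWithin).exists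
    exact ⟨c₁, h3, h2⟩
  obtain ⟨ε, hε, hεb, hεD₂, hεD₁, hεc⟩ : ∃ ε : ℝ, 0 < ε ∧ b₁ + 2 * ε < b₂ ∧
      D₂ - κ / 8 < d₂ / (a - b₂ + 2 * ε) ∧ D₁ - κ / 8 < d₁ / (a - b₂ + 2 * ε) ∧
      1 + (a - b₂ + 2 * ε) / (b₂ - b₁ - 2 * ε) < c₁ := by
    have hne : a - b₂ ≠ 0 := by linarith
    have hne' : b₂ - b₁ ≠ 0 := by linarith
    have k1 : ContinuousAt (fun ε : ℝ => b₁ + 2 * ε) 0 := by fun_prop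
    have k2 : ContinuousAt (fun ε : ℝ => d₂ / (a - b₂ + 2 * ε)) 0 :=
      ContinuousAt.div (by fun_prop) (by fun_prop) (by simpa using hne)
    have k3 : ContinuousAt (fun ε : ℝ => d₁ / (a - b₂ + 2 * ε)) 0 :=
      ContinuousAt.div (by fun_prop) (by fun_prop) (by simpa using hne)
    have k4 : ContinuousAt (fun ε : ℝ => 1 + (a - b₂ + 2 * ε) / (b₂ - b₁ - 2 * ε)) 0 :=
      continuousAt_const.add
        (ContinuousAt.div (by fun_prop) (by fun_prop) (by simpa using hne'))
    have e1 := k1.eventually_lt (continuousAt_const (y := b₂)) (by simpa using hb)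
    have e2 := (continuousAt_const (y := D₂ - κ / 8)).eventually_lt k2 (by simp; linarith)
    have e3 := (continuousAt_const (y := D₁ - κ / 8)).eventually_lt k3 (by simp; linarith)
    have e4 := k4.eventually_lt (continuousAt_const (y := c₁)) (by
      have : 1 + (a - b₂) / (b₂ - b₁) = c := by
        rw [hc]
        field_simp
        ring
      simpa [this] using hcc₁)
    obtain ⟨ε, h1, h2⟩ := ((((e1.and e2).and (e3.and e4)).filter_mono
      (nhdsWithin_le_nhds (s := Ioi 0))).and self_mem_nhdsWithin).exists
    exact ⟨ε, h2, h1.1.1, h1.1.2, h1.2.1, h1.2.2⟩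
  set l := a - b₂ + 2 * ε with hl
  set p := b₂ - b₁ - 2 * ε with hp
  have hl0 : 0 < l := by linarith
  have hp0 : 0 < p := by linarith
  set δ := min (1 / 4) (κ / (16 * (D₁ + D₂ + 1))) with hδ
  have hδ0 : 0 < δ := lt_min (by norm_num) (by positivity)
  have hδ4 : δ ≤ 1 / 4 := min_le_left _ _
  have hδD : (D₁ + D₂) * δ ≤ κ / 16 := by
    calc (D₁ + D₂) * δ ≤ (D₁ + D₂ + 1) * (κ / (16 * (D₁ + D₂ + 1))) :=
          mul_le_mul (by linarith) (min_le_right _ _) hδ0.le (by linarith)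
      _ = κ / 16 := by field_simp
  obtain ⟨D, hD0, hD⟩ := eventually_lowerEvent_ge_aux I hF hFpos hFs hd₁ hd₂ hq₁ hq₂ hba hε hεb hδ0
    (by linarith) (show 0 < κ / 8 by linarith)
  have hI := eventually_integratedTail_eq hF hFs
  have hmul : Tendsto (fun x : ℝ => c * x) atTop atTop := tendsto_id.const_mul_atTop (by linarith)
  have hadd : Tendsto (fun x : ℝ => x + (D + l)) atTop atTop :=
    tendsto_atTop_add_const_right atTop (D + l) tendsto_id
  have hslope : Tendsto (fun x : ℝ => (c₁ - (1 + l / p)) * x) atTop atTop :=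
    tendsto_id.const_mul_atTop (by linarith)
  have hlong := hadd.eventually (hFs.eventually_tail_sub_le (D + l)
    (show 1 < 1 + δ by linarith))
  filter_upwards [hD, hI, hmul.eventually hI, hadd.eventually hI, hlong,
    hslope.eventually_ge_atTop (D * (1 + l / p) + l), eventually_ge_atTop 0]
    with x h1 h2 h3 h4 h5 h6 h7
  -- The first `N` for which the backlog growth `(N + 1) * p` passes `x + D`. The jumps at station 1
  -- then start at the level `x + D + (N + 1) * l`, which is at most `c₁ * x`.
  have hN := h1 ⌊(x + D) / p⌋₊ (by
    rw [← div_lt_iff₀ hp0]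
    exact Nat.lt_floor_add_one _)
  set N := ⌊(x + D) / p⌋₊
  have hNle : (N : ℝ) ≤ (x + D) / p := Nat.floor_le (div_nonneg (by linarith) hp0.le)
  have hY₁ : x + D + (N + 1) * l ≤ c₁ * x := by
    have e1 : (N : ℝ) * l ≤ (x + D) / p * l := mul_le_mul_of_nonneg_right hNle hl0.le
    have e2 : (x + D) / p * l = (x + D) * (l / p) := by ring
    linarith
  have g1 := integral_tail_mul_le hF hc1 hcc₁.le h7
  have g2 : ∫ y in Ioi (c₁ * x), tail F y ≤ ∫ y in Ioi (x + D + (N + 1) * l), tail F y :=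
    (integral_tail_bounds F hY₁).1
  have g3 : ∫ y in Ioi (x + D + (N + 1) * l), tail F y ≤ ∫ y in Ioi (x + D + l), tail F y := by
    refine (integral_tail_bounds F ?_).1
    have : 0 ≤ (N : ℝ) * l := by positivity
    linarith
  rw [show x + (D + l) - (D + l) = x by ring] at h5
  rw [show x + (D + l) = x + D + l by ring] at h4 h5
  have g4 : tail (integratedTailLaw F) (x + D + l) ≤ tail (integratedTailLaw F) x :=
    tail_anti _ (by linarith)
  rw [← h3, ← h2] at g1
  rw [← h4] at hN g3
  rw [mul_comm x c]
  have hGx := hFs.tail_pos x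
  have hi0 := integral_tail_nonneg (F := F) (x + D + (N + 1) * l)
  set G := tail (integratedTailLaw F)
  set i₁ := ∫ y in Ioi (x + D + (N + 1) * l), tail F y
  set i₂ := G (x + D + l)
  set A₁ := d₁ / l
  set A₂ := d₂ / l
  have hA₁D : A₁ ≤ D₁ := div_le_div_of_nonneg_left hd₁ (by linarith) (by linarith)
  have hA₂D : A₂ ≤ D₂ := div_le_div_of_nonneg_left hd₂ (by linarith) (by linarith)
  have hi₂0 : 0 ≤ i₂ := tail_nonneg _ _
  have hi₁G : i₁ ≤ G x := g3.trans g4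
  have k1 : D₁ * i₁ - κ / 8 * G x ≤ A₁ * i₁ := by
    have := mul_le_mul_of_nonneg_right hεD₁.le hi0
    have := mul_le_mul_of_nonneg_left hi₁G (show 0 ≤ κ / 8 by linarith)
    linarith
  have k2 : D₂ * i₂ - κ / 8 * G x ≤ A₂ * i₂ := by
    have := mul_le_mul_of_nonneg_right hεD₂.le hi₂0
    have := mul_le_mul_of_nonneg_left g4 (show 0 ≤ κ / 8 by linarith)
    linarith
  have k3 : D₁ * G (c * x) ≤ D₁ * i₁ + κ / 8 * G x := by
    have e1 := mul_le_mul_of_nonneg_left (g1.trans (add_le_add g2 le_rfl)) hD₁0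
    have e2 := mul_le_mul_of_nonneg_right hc₁κ.le hGx.le
    linarith
  have k4 : D₂ * G x ≤ D₂ * i₂ + κ / 16 * G x := by
    have e1 := mul_le_mul_of_nonneg_left h5 hD₂0
    have e2 : D₂ * δ * i₂ ≤ κ / 16 * G x :=
      mul_le_mul (le_trans (mul_le_mul_of_nonneg_right (by linarith) hδ0.le) hδD) g4 hi₂0
        (by linarith)
    linarith
  have k5 : A₂ * i₂ + A₁ * i₁ ≤ (D₁ + D₂) * G x := by
    have e1 := mul_le_mul hA₁D hi₁G hi0 hD₁0
    have e2 := mul_le_mul hA₂D g4 hi₂0 hD₂0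
    linarith
  have k6 : 2 * δ * (A₂ * i₂ + A₁ * i₁ - 2 * (κ / 8) * i₂) ≤ κ / 8 * G x := by
    have e0 : 0 ≤ κ / 8 * i₂ := mul_nonneg (by linarith) hi₂0
    have e1 : A₂ * i₂ + A₁ * i₁ - 2 * (κ / 8) * i₂ ≤ (D₁ + D₂) * G x := by linarith
    have e2 := mul_le_mul_of_nonneg_left e1 (show 0 ≤ 2 * δ by linarith)
    have e3 := mul_le_mul_of_nonneg_right hδD hGx.le
    linarith
  have k7 : 2 * (κ / 8) * i₂ ≤ κ / 4 * G x := by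
    have := mul_le_mul_of_nonneg_left g4 (show 0 ≤ κ / 4 by linarith)
    linarith
  have k8 : 0 < κ * G x := mul_pos hκ hGx
  linarith

end Lower

/-! ### The tail of the stationary waiting time -/

section Path

variable {Ω : Type*} {σ₁ σ₂ τ : ℤ → Ω → ℝ}

lemma subset_iUnion_delayEvent (hσ₁ : ∀ n ω, 0 ≤ σ₁ n ω) {x : ℝ} (hx : 0 ≤ x) :
    {ω | ENNReal.ofReal x <
      stationaryWaiting₂ (fun n => σ₁ n ω) (fun n => σ₂ n ω) (fun n => τ n ω)} ⊆
    ⋃ m, delayEvent (fun r : ℕ => σ₁ (-((r + 1 : ℕ) : ℤ))) (fun r : ℕ => σ₂ (-((r : ℤ) + 1)))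
      (fun r : ℕ => τ (-((r : ℤ) + 1))) m x := by
  intro ω hω
  obtain ⟨m, hm⟩ := lt_iSup_iff.1 (show ENNReal.ofReal x < ⨆ m : ℕ, _ from hω)
  refine mem_iUnion.2 ⟨m, ?_⟩
  have h := exists_of_lt_waiting₂ (fun n => hσ₁ n ω) hx
    ((ENNReal.ofReal_lt_ofReal_iff_of_nonneg hx).1 hm)
  simpa only [delayEvent, mem_ofPred_eq, Nat.cast_add, Nat.cast_one] using h

lemma lowerEvent_subset {x : ℝ} (hx : 0 ≤ x) :
    lowerEvent (fun r : ℕ => σ₁ (-(r : ℤ))) (fun r : ℕ => σ₂ (-((r : ℤ) + 1)))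
      (fun r : ℕ => τ (-((r : ℤ) + 1))) x ⊆
    {ω | ENNReal.ofReal x <
      stationaryWaiting₂ (fun n => σ₁ n ω) (fun n => σ₂ n ω) (fun n => τ n ω)} := by
  rintro ω ⟨n, h1, h2⟩
  have hsum : ∀ j : ℕ, ∑ r ∈ Finset.range (j + 1), σ₁ (-(r : ℤ)) ω =
      σ₁ 0 ω + ∑ r ∈ Finset.range j, σ₁ (-((r : ℤ) + 1)) ω := by
    intro j
    rw [Finset.sum_range_succ', add_comm]
    simp
  have h := lt_waiting₂ (σ₁ := fun n => σ₁ n ω) (σ₂ := fun n => σ₂ n ω) (τ := fun n => τ n ω)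
    (n := n) (x := x) (by rw [hsum] at h1; linarith) (by
      intro j hj
      have h3 := h2 j hj
      rw [hsum] at h3
      push_cast at h3
      exact h3)
  exact lt_of_lt_of_le ((ENNReal.ofReal_lt_ofReal_iff_of_nonneg hx).2 h)
    (le_iSup (fun m : ℕ => ENNReal.ofReal
      (waiting (fun n => σ₁ n ω) (fun n => σ₂ n ω) (fun n => τ n ω) (-m) m).2) (n + 1))

lemma delayEvent_mono (u v t : ℕ → Ω → ℝ) (x : ℝ) : Monotone fun m => delayEvent u v t m x := by
  rintro m m' hm ω ⟨k, hk, h⟩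
  exact ⟨k, lt_of_lt_of_le hk hm, h⟩

end Path

section Main

variable {Ω : Type*} [MeasurableSpace Ω] {P : Measure Ω}

/-- The lower bound involves the service of customer `0` in station 1 and the upper bound only those
of earlier customers, so the two use the same input shifted by one. -/
lemma TandemInput.tail_service [IsProbabilityMeasure P] {u v t : ℕ → Ω → ℝ} {b₁ b₂ a : ℝ}
    (I : TandemInput P u v t b₁ b₂ a) : TandemInput P (fun r => u (r + 1)) v t b₁ b₂ a where
  meas_u r := I.meas_u _
  meas_v := I.meas_v
  meas_t := I.meas_t
  nonneg_u r := I.nonneg_u _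
  nonneg_v := I.nonneg_v
  nonneg_t := I.nonneg_t
  indep := by
    have h := I.indep.precomp (g := Sum.map (· + 1) id)
      ((add_left_injective 1).sumMap Function.injective_id)
    convert h using 1
    ext (r | r) <;> rfl
  ident_u r := (I.ident_u (r + 1)).trans (I.ident_u 1).symm
  ident_v := I.ident_v
  ident_t := I.ident_t
  int_u := (I.ident_u 1).integrable_iff.2 I.int_u
  int_v := I.int_v
  int_t := I.int_t
  mean_u := (I.ident_u 1).integral_eq.trans I.mean_u
  mean_v := I.mean_v
  mean_t := I.mean_t

lemma measureReal_iUnion_le_of_monotone [IsFiniteMeasure P] {A : ℕ → Set Ω} (hA : Monotone A)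
    {B : ℝ} (hB : ∀ m, P.real (A m) ≤ B) : P.real (⋃ m, A m) ≤ B := by
  have h := tendsto_measure_iUnion_atTop (μ := P) hA
  have h' := (ENNReal.tendsto_toReal (measure_ne_top P _)).comp h
  exact le_of_tendsto' h' hB

variable {σ₁ σ₂ τ : ℤ → Ω → ℝ}

/-- The two-sided asymptotic bound for the tail of the stationary waiting time in queue 2. -/
theorem eventually_abs_sub_le [IsProbabilityMeasure P] {b₁ b₂ a : ℝ}
    (hσ₁ : ∀ n ω, 0 ≤ σ₁ n ω)
    (I : TandemInput P (fun r : ℕ => σ₁ (-(r : ℤ))) (fun r : ℕ => σ₂ (-((r : ℤ) + 1)))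
      (fun r : ℕ => τ (-((r : ℤ) + 1))) b₁ b₂ a)
    {F : Measure ℝ} [IsProbabilityMeasure F]
    (hF : IntegrableOn (tail F) (Ioi 0)) (hFpos : ∀ x, 0 < tail F x)
    (hFs : IsSubexponential (integratedTailLaw F)) {d₁ d₂ : ℝ} (hd₁ : 0 ≤ d₁) (hd₂ : 0 ≤ d₂)
    (hq₁ : Tendsto (fun x => P.real {ω | x < σ₁ 0 ω} / tail F x) atTop (𝓝 d₁))
    (hq₂ : Tendsto (fun x => P.real {ω | x < σ₂ (-1) ω} / tail F x) atTop (𝓝 d₂))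
    (hb : b₁ < b₂) (hba : b₂ < a) {κ : ℝ} (hκ : 0 < κ) :
    ∀ᶠ x in atTop, |P.real {ω | ENNReal.ofReal x <
        stationaryWaiting₂ (fun n => σ₁ n ω) (fun n => σ₂ n ω) (fun n => τ n ω)} -
      (d₂ / (a - b₂) * integratedTail F x +
        d₁ / (a - b₂) * integratedTail F (x * ((a - b₁) / (b₂ - b₁))))| ≤
      κ * integratedTail F x := by
  have hc : 0 < (a - b₁) / (b₂ - b₁) := div_pos (by linarith) (by linarith)
  have hq₁' : Tendsto (fun x => P.real {ω | x < σ₁ (-((0 + 1 : ℕ) : ℤ)) ω} / tail F x) atTop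
      (𝓝 d₁) := by
    refine hq₁.congr fun x => ?_
    congr 1
    exact congrArg ENNReal.toReal ((I.ident_u 1).measure_mem_eq measurableSet_Ioi).symm
  filter_upwards [eventually_delayEvent_le I.tail_service hF hFpos hFs hd₁ hd₂ hq₁'
      (by simpa using hq₂) hb hba hκ,
    eventually_le_lowerEvent I hF hFpos hFs hd₁ hd₂ (by simpa using hq₁) (by simpa using hq₂)
      hb hba hκ, eventually_ge_atTop 0] with x h1 h2 hx
  rw [tail_integratedTailLaw F hF hx, tail_integratedTailLaw F hF (mul_nonneg hx hc.le)] at h2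
  simp only [tail_integratedTailLaw F hF hx, tail_integratedTailLaw F hF (mul_nonneg hx hc.le)]
    at h1
  have h3 := (measureReal_mono (μ := P) (subset_iUnion_delayEvent (σ₂ := σ₂) (τ := τ) hσ₁ hx)).trans
    (measureReal_iUnion_le_of_monotone (delayEvent_mono _ _ _ x) h1)
  have h4 := measureReal_mono (μ := P) (lowerEvent_subset (σ₁ := σ₁) (σ₂ := σ₂) (τ := τ) hx)
  rw [abs_le]
  constructor <;> linarith

/-- Doubling the argument costs at most a constant factor; repeat this until `2 ^ k` passes `c`. -/
lemma exists_le_integratedTail_mul {F : Measure ℝ} [IsProbabilityMeasure F]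
    (hpos : ∀ x, 0 ≤ x → 0 < integratedTail F x)
    (hl : 0 < liminf (fun x : ℝ => integratedTail F (2 * x) / integratedTail F x) atTop) (c : ℝ) :
    ∃ l, 0 < l ∧ ∀ᶠ x in atTop, l * integratedTail F x ≤ integratedTail F (x * c) := by
  obtain ⟨l, hl0, hl⟩ := exists_between hl
  have hev := eventually_lt_of_lt_liminf hl
    (isBoundedUnder_of ⟨0, fun x => div_nonneg (integratedTail_nonneg F _)
      (integratedTail_nonneg F _)⟩)
  obtain ⟨x₀, hx₀⟩ := eventually_atTop.1 (hev.and (eventually_ge_atTop 0))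
  have hx₀0 : 0 ≤ x₀ := (hx₀ x₀ le_rfl).2
  have hpow : ∀ k : ℕ, ∀ x, x₀ ≤ x → l ^ k * integratedTail F x ≤ integratedTail F (2 ^ k * x) := by
    intro k
    induction k with
    | zero => simp
    | succ k ih =>
      intro x hx
      have hx0 : 0 ≤ x := hx₀0.trans hx
      have h1 : x₀ ≤ 2 ^ k * x := hx.trans (le_mul_of_one_le_left hx0 (one_le_pow₀ one_le_two))
      have h2 := (hx₀ _ h1).1
      rw [lt_div_iff₀ (hpos _ (hx₀0.trans h1))] at h2
      calc l ^ (k + 1) * integratedTail F x = l * (l ^ k * integratedTail F x) := by ring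
        _ ≤ l * integratedTail F (2 ^ k * x) := mul_le_mul_of_nonneg_left (ih x hx) hl0.le
        _ ≤ integratedTail F (2 * (2 ^ k * x)) := h2.le
        _ = _ := by
          congr 1
          ring
  obtain ⟨k, hk⟩ := pow_unbounded_of_one_lt c one_lt_two
  refine ⟨l ^ k, pow_pos hl0 k, ?_⟩
  filter_upwards [eventually_ge_atTop x₀] with x hx
  refine (hpow k x hx).trans (integratedTail_antitone F ?_)
  rw [mul_comm x c]
  exact mul_le_mul_of_nonneg_right hk.le (hx₀0.trans hx)

end Main

end TandemQueue

/-! ### The asymptotics of the waiting time in queue 2 -/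

open TandemQueue in
theorem theorem12
    {Ω : Type*} [MeasurableSpace Ω] (P : Measure Ω) [IsProbabilityMeasure P]
    -- service times in the stations 1 and 2, and interarrival times at station 1
    (σ₁ σ₂ τ : ℤ → Ω → ℝ)
    (hσ₁_meas : ∀ n, Measurable (σ₁ n)) (hσ₂_meas : ∀ n, Measurable (σ₂ n))
    (hτ_meas : ∀ n, Measurable (τ n))
    (hσ₁_nonneg : ∀ n, ∀ᵐ ω ∂P, 0 ≤ σ₁ n ω) (hσ₂_nonneg : ∀ n, ∀ᵐ ω ∂P, 0 ≤ σ₂ n ω)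
    (hτ_nonneg : ∀ n, ∀ᵐ ω ∂P, 0 ≤ τ n ω)
    -- each of the three sequences is i.i.d., and they are mutually independent
    (h_indep : iIndepFun (Sum.elim σ₁ (Sum.elim σ₂ τ)) P)
    (hσ₁_ident : ∀ n, IdentDistrib (σ₁ n) (σ₁ 0) P P)
    (hσ₂_ident : ∀ n, IdentDistrib (σ₂ n) (σ₂ 0) P P)
    (hτ_ident : ∀ n, IdentDistrib (τ n) (τ 0) P P)
    -- finite means, and stability
    (hσ₁_int : Integrable (σ₁ 0) P) (hσ₂_int : Integrable (σ₂ 0) P) (hτ_int : Integrable (τ 0) P)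
    (a b₁ b₂ : ℝ) (ha : a = ∫ ω, τ 0 ω ∂P)
    (hb₁ : b₁ = ∫ ω, σ₁ 0 ω ∂P) (hb₂ : b₂ = ∫ ω, σ₂ 0 ω ∂P)
    (hb₁b₂ : b₁ < b₂) (hb₂a : b₂ < a)
    -- the reference distribution
    (F : Measure ℝ) [IsProbabilityMeasure F]
    (hF_moment : IntegrableOn (tail F) (Ioi 0))
    (hF : IsSubexponential F) (hFs : IsSubexponential (integratedTailLaw F))
    -- tails of the service times
    (d₁ d₂ : ℝ) (hd₁ : 0 ≤ d₁) (hd₂ : 0 ≤ d₂) (hd : 0 < d₁ + d₂)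
    (hσ₁_tail : Tendsto (fun x : ℝ => P.real {ω | x < σ₁ 0 ω} / tail F x) atTop (𝓝 d₁))
    (hσ₂_tail : Tendsto (fun x : ℝ => P.real {ω | x < σ₂ 0 ω} / tail F x) atTop (𝓝 d₂))
    -- the tail of the stationary waiting time in the second queue
    (T : ℝ → ℝ)
    (hT : ∀ x : ℝ, T x = P.real {ω | ENNReal.ofReal x <
      stationaryWaiting₂ (fun n => σ₁ n ω) (fun n => σ₂ n ω) (fun n => τ n ω)}) :
    ((fun x : ℝ => T x -
        (d₂ / (a - b₂) * integratedTail F x +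
          d₁ / (a - b₂) * integratedTail F (x * ((a - b₁) / (b₂ - b₁)))))
      =o[atTop] fun x : ℝ => integratedTail F x) ∧
    ((0 < d₂ ∨ (d₂ = 0 ∧ 0 < d₁ ∧
        0 < liminf (fun x : ℝ => integratedTail F (2 * x) / integratedTail F x) atTop)) →
      T ~[atTop] fun x : ℝ =>
        d₂ / (a - b₂) * integratedTail F x +
          d₁ / (a - b₂) * integratedTail F (x * ((a - b₁) / (b₂ - b₁)))) := by
  -- Nonnegativity holds only almost surely, whereas the path arguments need it everywhere. Positive
  -- parts change countably many variables on null sets only, and keep independence and the laws.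
  have hmax : Measurable fun y : ℝ => max 0 y := by fun_prop
  set ρ₁ : ℤ → Ω → ℝ := fun n ω => max 0 (σ₁ n ω)
  set ρ₂ : ℤ → Ω → ℝ := fun n ω => max 0 (σ₂ n ω)
  set θ : ℤ → Ω → ℝ := fun n ω => max 0 (τ n ω)
  have e₁ : ∀ n, ρ₁ n =ᵐ[P] σ₁ n := fun n => (hσ₁_nonneg n).mono fun ω h => max_eq_right h
  have e₂ : ∀ n, ρ₂ n =ᵐ[P] σ₂ n := fun n => (hσ₂_nonneg n).mono fun ω h => max_eq_right h
  have e₃ : ∀ n, θ n =ᵐ[P] τ n := fun n => (hτ_nonneg n).mono fun ω h => max_eq_right h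
  have id₁ : ∀ n m, IdentDistrib (ρ₁ n) (ρ₁ m) P P := fun n m =>
    ((hσ₁_ident n).trans (hσ₁_ident m).symm).comp hmax
  have id₂ : ∀ n m, IdentDistrib (ρ₂ n) (ρ₂ m) P P := fun n m =>
    ((hσ₂_ident n).trans (hσ₂_ident m).symm).comp hmax
  have id₃ : ∀ n m, IdentDistrib (θ n) (θ m) P P := fun n m =>
    ((hτ_ident n).trans (hτ_ident m).symm).comp hmax
  have I : TandemInput P (fun r : ℕ => ρ₁ (-(r : ℤ))) (fun r : ℕ => ρ₂ (-((r : ℤ) + 1)))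
      (fun r : ℕ => θ (-((r : ℤ) + 1))) b₁ b₂ a :=
    { meas_u := fun r => hmax.comp (hσ₁_meas _)
      meas_v := fun r => hmax.comp (hσ₂_meas _)
      meas_t := fun r => hmax.comp (hτ_meas _)
      nonneg_u := fun r ω => le_max_left _ _
      nonneg_v := fun r ω => le_max_left _ _
      nonneg_t := fun r ω => le_max_left _ _
      indep := by
        have hneg : Function.Injective fun r : ℕ => -((r : ℤ) + 1) := fun r s h => by
          simpa using h
        have h := (h_indep.comp (fun _ y => max 0 y) fun _ => hmax).precomp
          (g := Sum.map (fun r : ℕ => -(r : ℤ))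
            (Sum.map (fun r : ℕ => -((r : ℤ) + 1)) fun r : ℕ => -((r : ℤ) + 1)))
          (Function.Injective.sumMap (fun r s h => by simpa using h) (hneg.sumMap hneg))
        convert h using 1
        ext (r | r | r) <;> rfl
      ident_u := fun r => id₁ _ _
      ident_v := fun r => id₂ _ _
      ident_t := fun r => id₃ _ _
      int_u := (id₁ _ 0).integrable_iff.2 (hσ₁_int.congr (e₁ 0).symm)
      int_v := (id₂ _ 0).integrable_iff.2 (hσ₂_int.congr (e₂ 0).symm)
      int_t := (id₃ _ 0).integrable_iff.2 (hτ_int.congr (e₃ 0).symm)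
      mean_u := (id₁ _ 0).integral_eq.trans ((integral_congr_ae (e₁ 0)).trans hb₁.symm)
      mean_v := (id₂ _ 0).integral_eq.trans ((integral_congr_ae (e₂ 0)).trans hb₂.symm)
      mean_t := (id₃ _ 0).integral_eq.trans ((integral_congr_ae (e₃ 0)).trans ha.symm) }
  have hq₁ : Tendsto (fun x => P.real {ω | x < ρ₁ 0 ω} / tail F x) atTop (𝓝 d₁) := by
    refine hσ₁_tail.congr fun x => ?_
    congr 1
    refine measureReal_congr ?_
    filter_upwards [e₁ 0] with ω hω
    change (x < σ₁ 0 ω) = (x < ρ₁ 0 ω)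
    rw [hω]
  have hq₂ : Tendsto (fun x => P.real {ω | x < ρ₂ (-1) ω} / tail F x) atTop (𝓝 d₂) := by
    refine hσ₂_tail.congr fun x => ?_
    congr 1
    refine Eq.trans (measureReal_congr ?_)
      (congrArg ENNReal.toReal ((id₂ (-1) 0).measure_mem_eq measurableSet_Ioi)).symm
    filter_upwards [e₂ 0] with ω hω
    change (x < σ₂ 0 ω) = (x < ρ₂ 0 ω)
    rw [hω]
  have hTρ : ∀ x, T x = P.real {ω | ENNReal.ofReal x <
      stationaryWaiting₂ (fun n => ρ₁ n ω) (fun n => ρ₂ n ω) (fun n => θ n ω)} := by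
    intro x
    rw [hT]
    refine measureReal_congr ?_
    filter_upwards [ae_all_iff.2 e₁, ae_all_iff.2 e₂, ae_all_iff.2 e₃] with ω h1 h2 h3
    change (ENNReal.ofReal x < stationaryWaiting₂ (fun n => σ₁ n ω) (fun n => σ₂ n ω)
      fun n => τ n ω) = (ENNReal.ofReal x < stationaryWaiting₂ (fun n => ρ₁ n ω)
      (fun n => ρ₂ n ω) fun n => θ n ω)
    simp only [h1, h2, h3]
  have hpos : ∀ x, 0 ≤ x → 0 < integratedTail F x := fun x hx => by
    rw [← tail_integratedTailLaw F hF_moment hx]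
    exact hFs.tail_pos x
  have hlittle : (fun x : ℝ => T x -
      (d₂ / (a - b₂) * integratedTail F x +
        d₁ / (a - b₂) * integratedTail F (x * ((a - b₁) / (b₂ - b₁)))))
      =o[atTop] fun x : ℝ => integratedTail F x := by
    refine isLittleO_iff.2 fun κ hκ => ?_
    filter_upwards [eventually_abs_sub_le (σ₁ := ρ₁) (σ₂ := ρ₂) (τ := θ)
      (fun n ω => le_max_left _ _) I hF_moment hF.tail_pos hFs hd₁ hd₂ hq₁ hq₂ hb₁b₂ hb₂a hκ]
      with x hx
    rw [hTρ, Real.norm_eq_abs, Real.norm_of_nonneg (integratedTail_nonneg F x)]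
    exact hx
  refine ⟨hlittle, fun hcase => hlittle.trans_isBigO ?_⟩
  have hab : 0 < a - b₂ := by linarith
  -- Equivalence follows once the main term is at least a fixed multiple of `integratedTail F`: from
  -- the first summand if `d₂ > 0`, otherwise from the second by the condition on doubling.
  suffices h : ∃ l, 0 < l ∧ ∀ᶠ x in atTop, l * integratedTail F x ≤
      d₂ / (a - b₂) * integratedTail F x +
        d₁ / (a - b₂) * integratedTail F (x * ((a - b₁) / (b₂ - b₁))) by
    obtain ⟨l, hl, h⟩ := h
    refine IsBigO.of_bound l⁻¹ ?_
    filter_upwards [h] with x hx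
    have h0 := integratedTail_nonneg F x
    rw [Real.norm_of_nonneg h0, Real.norm_of_nonneg ((mul_nonneg hl.le h0).trans hx),
      ← div_eq_inv_mul, le_div_iff₀ hl, mul_comm]
    exact hx
  rcases hcase with h | ⟨-, h, hlim⟩
  · refine ⟨d₂ / (a - b₂), div_pos h hab, Eventually.of_forall fun x => ?_⟩
    exact le_add_of_nonneg_right
      (mul_nonneg (div_nonneg hd₁ hab.le) (integratedTail_nonneg F _))
  · obtain ⟨l, hl, hev⟩ := exists_le_integratedTail_mul hpos hlim ((a - b₁) / (b₂ - b₁))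
    refine ⟨d₁ / (a - b₂) * l, mul_pos (div_pos h hab) hl, ?_⟩
    filter_upwards [hev] with x hx
    rw [mul_assoc]
    exact le_add_of_nonneg_of_le
      (mul_nonneg (div_nonneg hd₂ hab.le) (integratedTail_nonneg F _))
      (mul_le_mul_of_nonneg_left hx (div_nonneg hd₁ hab.le))
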